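/- Let $M$ be a simply connected smooth manifold (Hausdorff, second countable, without boundary) of dimension $d\ge 2$, let $\mathbb K=\mathbb R$ or $\mathbb K=\mathbb H$, and let $G$ be the isometry group of the standard scalar product on $\mathbb K^n$, that is, $G=\mathrm O(n)$ for $\mathbb K=\mathbb R$ and $G=\mathrm{Sp}(n)$ for $\mathbb K=\mathbb H$. Let $P$ be a smooth principal $G$-bundle over $M$. A Howe subgroup of $G$ is a subgroup $H\subseteq G$ with $H=\mathrm C_G(\mathrm C_G(H))$, where $\mathrm C_G$ denotes the centralizer in $G$. A Howe subbundle of $P$ is a reduction $Q\subseteq P$ of $P$ to a Howe subgroup $H$ of $G$; $H$ is called the structure group of $Q$. A Howe subbundle $Q$ is called holonomy-induced if there are a smooth connection in $P$ and a point $p_0\in P$ such that $Q$ is the smallest Howe subbundle of $P$ containing the holonomy subbundle through $p_0$, i.e. the set of all points of $P$ that can be joined to $p_0$ by a piecewise $C^1$ horizontal curve. For $m,k\ge 1$ let $\mathrm O(m)_k=\{a\otimes \mathbb 1_k : a\in \mathrm O(m)\}$, a group of isometries of $\mathbb K^{mk}$. Say that $H$ contains a factor $S$, where $S$ is a group of isometries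 of $\mathbb K^q$, if $q\le n$ and $H$ is conjugate in $G$ to a block-diagonal direct product $S\times H'$ with $H'$ a Howe subgroup of the isometry group of $\mathbb K^{n-q}$. Theorem. Let $Q$ be a Howe subbundle of $P$ with structure group $H$. Then $Q$ is holonomy-induced if and only if $H$ contains neither a factor $\mathrm O(2)_k$ with $k\ge 1$ nor a double factor $\mathrm O(1)_k\times \mathrm O(1)_l$ (block-diagonal in $\mathbb K^{k+l}$) with $k,l\ge 1$. -/

import Mathlib

open scoped Manifold ContDiff Quaternion Matrix Kronecker

namespace HoweBundle

noncomputable section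

section Groups

/-- The isometry group `I_𝕂(ι)` of the standard scalar product on `𝕂 ^ ι`, as a group of matrices
(acting from the left): the orthogonal group for `𝕂 = ℝ`, the compact symplectic group for
`𝕂 = ℍ`. -/
abbrev IsoGroup (𝕂 : Type*) [Ring 𝕂] [StarRing 𝕂] (ι : Type*) [Fintype ι] [DecidableEq ι] :
    Type _ :=
  ↥(unitary (Matrix ι ι 𝕂))

/-- A Howe subgroup of `G` is a subgroup that equals its double centralizer in `G`. -/
def IsHowe {G : Type*} [Group G] (H : Subgroup G) : Prop :=
  Subgroup.centralizer (Subgroup.centralizer (H : Set G) : Set G) = H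

variable (𝕂 : Type*) [Ring 𝕂] [StarRing 𝕂] [Algebra ℝ 𝕂]

/-- `O(m)_k`: the matrices `a ⊗ 1_k` over `𝕂`, with `a` a real orthogonal `m × m` matrix. -/
def orthFactor (m k : ℕ) : Set (Matrix (Fin m × Fin k) (Fin m × Fin k) 𝕂) :=
  {A | ∃ a : IsoGroup ℝ (Fin m),
    A = (a : Matrix (Fin m) (Fin m) ℝ).map (algebraMap ℝ 𝕂) ⊗ₖ (1 : Matrix (Fin k) (Fin k) 𝕂)}

/-- `O(1)_k × O(1)_l`, embedded block-diagonally. -/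
def doubleOrthFactor (k l : ℕ) :
    Set (Matrix ((Fin 1 × Fin k) ⊕ (Fin 1 × Fin l)) ((Fin 1 × Fin k) ⊕ (Fin 1 × Fin l)) 𝕂) :=
  {A | ∃ a ∈ orthFactor 𝕂 1 k, ∃ b ∈ orthFactor 𝕂 1 l, A = Matrix.fromBlocks a 0 0 b}

variable {𝕂}

/-- `H` is conjugate in `I_𝕂(n)` to a block-diagonal direct product `S × H'`, where `H'` is a Howe
subgroup of `I_𝕂(r)`, with respect to some splitting of the `n` coordinates into `ι` and `r` further
ones. -/
def HasDirectFactor {n : ℕ} (H : Subgroup (IsoGroup 𝕂 (Fin n))) {ι : Type*}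
    (S : Set (Matrix ι ι 𝕂)) : Prop :=
  ∃ (r : ℕ) (e : ι ⊕ Fin r ≃ Fin n) (g : IsoGroup 𝕂 (Fin n))
    (H' : Subgroup (IsoGroup 𝕂 (Fin r))), IsHowe H' ∧
    ∀ h : IsoGroup 𝕂 (Fin n), h ∈ H ↔ ∃ a ∈ S, ∃ b ∈ H',
      (h : Matrix (Fin n) (Fin n) 𝕂) =
        (g : Matrix (Fin n) (Fin n) 𝕂) *
          Matrix.reindex e e (Matrix.fromBlocks a 0 0 (b : Matrix (Fin r) (Fin r) 𝕂)) *
          ((g⁻¹ : IsoGroup 𝕂 (Fin n)) : Matrix (Fin n) (Fin n) 𝕂)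

/-- `H` contains a factor `O(2)_k` for some `k ≥ 1`. -/
def HasFactorO2 {n : ℕ} (H : Subgroup (IsoGroup 𝕂 (Fin n))) : Prop :=
  ∃ k : ℕ, 1 ≤ k ∧ HasDirectFactor H (orthFactor 𝕂 2 k)

/-- `H` contains a double factor `O(1)_k × O(1)_l` for some `k, l ≥ 1`. -/
def HasDoubleFactorO1 {n : ℕ} (H : Subgroup (IsoGroup 𝕂 (Fin n))) : Prop :=
  ∃ k l : ℕ, 1 ≤ k ∧ 1 ≤ l ∧ HasDirectFactor H (doubleOrthFactor 𝕂 k l)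

end Groups

section Bundles

/-- Data of a local section: an open domain and a map (whose values off the domain are irrelevant). -/
structure LocalSection (M P : Type*) where
  dom : Set M
  sec : M → P

variable {d : ℕ}

/-- A function from a manifold to a matrix group is smooth on `W` if all its entries are. -/
def SmoothMatrixOn {M : Type*} [TopologicalSpace M] [ChartedSpace (EuclideanSpace ℝ (Fin d)) M]
    {𝕂 : Type*} [NormedRing 𝕂] [StarRing 𝕂] [NormedAlgebra ℝ 𝕂] {n : ℕ}
    (g : M → IsoGroup 𝕂 (Fin n)) (W : Set M) : Prop :=
  ∀ i j, ContMDiffOn (𝓡 d) 𝓘(ℝ, 𝕂) ∞ (fun x => (g x : Matrix (Fin n) (Fin n) 𝕂) i j) W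

/-- A smooth principal bundle over the `d`-manifold `M` with structure group `I_𝕂(n)` and total
space `P`: a right action on `P` that is simply transitive on the fibres of `proj`, and a family
of local sections over open sets covering `M` with smooth transition functions. A local section
`s` over `U` is the same as the equivariant local trivialization `(x, g) ↦ s x · g` over `U`, so
this is a bundle atlas; it determines the topology and the smooth structure of `P`. -/
structure PrincipalBundle (𝕂 : Type*) [NormedRing 𝕂] [StarRing 𝕂] [NormedAlgebra ℝ 𝕂] (n d : ℕ)
    (M : Type*) [TopologicalSpace M] [ChartedSpace (EuclideanSpace ℝ (Fin d)) M]
    (P : Type*) where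
  proj : P → M
  act : P → IsoGroup 𝕂 (Fin n) → P
  act_one : ∀ p, act p 1 = p
  act_mul : ∀ p g h, act p (g * h) = act (act p g) h
  proj_act : ∀ p g, proj (act p g) = proj p
  simply_transitive : ∀ p q, proj p = proj q → ∃! g, act p g = q
  atlas : Set (LocalSection M P)
  isOpen_dom : ∀ s ∈ atlas, IsOpen s.dom
  proj_sec : ∀ s ∈ atlas, ∀ x ∈ s.dom, proj (s.sec x) = x
  covers : ∀ x, ∃ s ∈ atlas, x ∈ s.dom
  smooth_transition : ∀ s ∈ atlas, ∀ t ∈ atlas, ∃ g : M → IsoGroup 𝕂 (Fin n),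
    (∀ x ∈ s.dom ∩ t.dom, t.sec x = act (s.sec x) (g x)) ∧ SmoothMatrixOn (d := d) g (s.dom ∩ t.dom)

namespace PrincipalBundle

variable {𝕂 : Type*} [NormedRing 𝕂] [StarRing 𝕂] [NormedAlgebra ℝ 𝕂] {n : ℕ}
  {M : Type*} [TopologicalSpace M] [ChartedSpace (EuclideanSpace ℝ (Fin d)) M]
  {P : Type*} (B : PrincipalBundle 𝕂 n d M P)

/-- `s` is a smooth section of the bundle over the open set `W`. -/
structure IsSmoothSectionOn (s : M → P) (W : Set M) : Prop where
  isOpen : IsOpen W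
  proj_eq : ∀ x ∈ W, B.proj (s x) = x
  smooth : ∀ t ∈ B.atlas, ∃ g : M → IsoGroup 𝕂 (Fin n),
    (∀ x ∈ t.dom ∩ W, s x = B.act (t.sec x) (g x)) ∧ SmoothMatrixOn (d := d) g (t.dom ∩ W)

/-- The subset `Q` of the total space is a reduction of the bundle to the subgroup `H`: `H` acts
(simply) transitively on the fibres of `Q`, and `Q` admits smooth local sections around every
point of the base. -/
structure IsReduction (Q : Set P) (H : Subgroup (IsoGroup 𝕂 (Fin n))) : Prop where
  act_mem_iff : ∀ p ∈ Q, ∀ g, B.act p g ∈ Q ↔ g ∈ H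
  exists_section : ∀ x : M, ∃ (W : Set M) (s : M → P),
    x ∈ W ∧ B.IsSmoothSectionOn s W ∧ ∀ y ∈ W, s y ∈ Q

/-- A Howe subbundle is a reduction to a Howe subgroup. -/
def IsHoweSubbundle (Q : Set P) : Prop :=
  ∃ H : Subgroup (IsoGroup 𝕂 (Fin n)), IsHowe H ∧ B.IsReduction Q H

/-- `Q` is the Howe subbundle generated by `R`: the smallest Howe subbundle containing `R`. -/
def IsGeneratedBy (Q R : Set P) : Prop :=
  IsLeast {Q' : Set P | B.IsHoweSubbundle Q' ∧ R ⊆ Q'} Q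

/-- A smooth connection, given by its local connection forms `A_s` (the pull-backs of the global
connection form along the local sections `s` of the atlas). These are smooth one-forms on the
domain of `s` with values in the Lie algebra of skew-adjoint matrices, and they obey
`A_t = g⁻¹ A_s g + g⁻¹ dg` where `t = s g`. -/
structure Connection [IsManifold (𝓡 d) ∞ M] where
  form : LocalSection M P → (x : M) → TangentSpace (𝓡 d) x →ₗ[ℝ] Matrix (Fin n) (Fin n) 𝕂
  skew : ∀ s ∈ B.atlas, ∀ x ∈ s.dom, ∀ v, form s x v ∈ skewAdjoint (Matrix (Fin n) (Fin n) 𝕂)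
  /- a one-form is smooth iff it is smooth as a function on the tangent bundle -/
  smooth : ∀ s ∈ B.atlas, ∀ i j, ContMDiffOn (𝓡 d).tangent 𝓘(ℝ, 𝕂) ∞
    (fun v : TangentBundle (𝓡 d) M => form s v.proj v.snd i j) {v | v.proj ∈ s.dom}
  transform : ∀ s ∈ B.atlas, ∀ t ∈ B.atlas, ∀ g : M → IsoGroup 𝕂 (Fin n),
    (∀ x ∈ s.dom ∩ t.dom, t.sec x = B.act (s.sec x) (g x)) →
    ∀ x ∈ s.dom ∩ t.dom, ∀ v : TangentSpace (𝓡 d) x,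
      form t x v =
        ((g x)⁻¹ : IsoGroup 𝕂 (Fin n)) * form s x v * (g x : Matrix (Fin n) (Fin n) 𝕂) +
        ((g x)⁻¹ : IsoGroup 𝕂 (Fin n)) * Matrix.of (fun i j =>
          (mfderiv (𝓡 d) 𝓘(ℝ, 𝕂) (fun y => (g y : Matrix (Fin n) (Fin n) 𝕂) i j) x v : 𝕂))

variable {B} [IsManifold (𝓡 d) ∞ M]

/-- The curve `c : [0,1] → P` is of class `C¹` and horizontal: its projection `γ` is `C¹`, and in
each local section `s` of the atlas, `c = s(γ) g` with `g' = - A_s(γ') g`. -/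
structure Connection.IsHorizontal (A : B.Connection) (c : ℝ → P) : Prop where
  base_contMDiffOn :
    ContMDiffOn 𝓘(ℝ, ℝ) (𝓡 d) 1 (fun τ => B.proj (c τ)) (Set.Icc 0 1)
  horizontal : ∀ s ∈ B.atlas, ∃ g : ℝ → IsoGroup 𝕂 (Fin n),
    ∀ τ ∈ Set.Icc (0 : ℝ) 1, B.proj (c τ) ∈ s.dom →
      c τ = B.act (s.sec (B.proj (c τ))) (g τ) ∧
      ∀ i j, HasDerivWithinAt (fun σ => (g σ : Matrix (Fin n) (Fin n) 𝕂) i j)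
        ((-(A.form s (B.proj (c τ))
            (mfderivWithin 𝓘(ℝ, ℝ) (𝓡 d) (fun σ => B.proj (c σ)) (Set.Icc 0 1) τ (1 : ℝ)) *
          (g τ : Matrix (Fin n) (Fin n) 𝕂))) i j)
        (Set.Icc 0 1) τ

/-- The holonomy subbundle of the connection through `p₀`: all points that can be joined to `p₀`
by a piecewise `C¹` horizontal curve. -/
def Connection.holonomyBundle (A : B.Connection) (p₀ : P) : Set P :=
  {p | Relation.ReflTransGen
    (fun q q' => ∃ c : ℝ → P, A.IsHorizontal c ∧ c 0 = q ∧ c 1 = q') p₀ p}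

variable (B)

/-- `Q` is holonomy-induced: it is generated, as a Howe subbundle, by the holonomy subbundle of
some connection. -/
def IsHolonomyInduced (Q : Set P) : Prop :=
  ∃ (A : B.Connection) (p₀ : P), B.IsGeneratedBy Q (A.holonomyBundle p₀)

end PrincipalBundle

end Bundles

end

end HoweBundle

/-! Write `G` for the isometry group and let `doubleCommutant H` be the real `*`-algebra of all
matrices commuting with the centralizer of `H`. For a Howe subgroup, `H` is exactly the unitary
group of this algebra (`IsHowe.mem_iff`), and its Lie algebra consists of the skew-adjoint elements.
Holonomy over a simply connected base only sees this Lie algebra, so the question is whether the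
skew-adjoint elements generate the whole algebra.

The algebraic core is `eq_top_or_exists_block`. A finite-dimensional real algebra with proper
involution is generated, as a unital algebra, by its skew elements unless it has a direct summand of
real `2 × 2` matrices (whose skew part generates only a copy of the complex numbers) or two summands
`ℝ` (which have no skew elements at all). A single summand `ℝ` does no harm, because the unit is
available. Orthonormal frames of the central projections turn such summands into factors `O(2)_k`
and `O(1)_k × O(1)_l` of `H` (`hasFactorO2_of_block`, `hasDoubleFactorO1_of_blocks`).

Forbidden factors obstruct. Either factor yields an element `J` of `G` that `H` does not fix under
conjugation but whose `H`-orbit is finite. The bundle associated with `Q` with this orbit as fibre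
is a finite covering of `M`; since `M` is simply connected it has a section through any point, that
is, there is a locally constant equivariant map `Φ` from `Q` to the orbit
(`IsReduction.exists_orbit_map`). `Φ` is constant along horizontal curves in `Q`, so the holonomy
bundle lies in a level set of `Φ`. That level set is a strictly smaller Howe subbundle, with
structure group `H ⊓ centralizer {J}`.

Without forbidden factors, a connection reducible to `Q` is glued by a partition of unity so that
near one point it has the form `∑ x^(j+1) dy X_j`, where the `X_j` form a basis of the Lie algebra.
Transport around coordinate rectangles gives the holonomies `exp (t ∑ u^(j+1) X_j)`. A matrix
commuting with all of them commutes with each `X_j` (differentiate in `t`, compare coefficients in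
`u`), hence by the algebraic core with `H`. So every Howe subgroup containing these holonomies
contains `H`; as the holonomy bundle meets every fibre, it generates `Q`. -/

namespace HoweBundle

/-! ### Algebras with proper involution: self-adjoint elements below a minimal projection. -/

section ProperStarAlgebra

variable {R : Type*} [Ring R] [StarRing R] [Algebra ℝ R]

/-- A self-adjoint idempotent. -/
structure IsProj (e : R) : Prop where
  star_eq : star e = e
  mul_self : e * e = e

/-- A nonzero projection that dominates no other nonzero projection. -/
structure IsMinProj (e : R) : Prop extends IsProj e where
  ne_zero : e ≠ 0
  minimal : ∀ f : R, IsProj f → e * f = f → f = 0 ∨ f = e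

/-- Properness of the involution: a sum of two squares vanishes only if both terms do. -/
def IsProper (R : Type*) [Ring R] [StarRing R] : Prop :=
  ∀ a b : R, star a * a + star b * b = 0 → a = 0

omit [Algebra ℝ R] in
theorem IsProper.eq_zero (hp : IsProper R) {a : R} (h : star a * a = 0) : a = 0 :=
  hp a 0 (by simpa using h)

variable [StarModule ℝ R]

/-- A complex root and its conjugate give a real factor. The quadratic one is written as a completed
square so that properness of an involution can rule it out. -/
theorem exists_root_or_quadratic_dvd (m : Polynomial ℝ) (hm : 0 < m.degree) :
    (∃ r : ℝ, (Polynomial.X - Polynomial.C r) ∣ m) ∨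
    ∃ r c : ℝ, c ≠ 0 ∧ ((Polynomial.X - Polynomial.C r) ^ 2 + Polynomial.C (c ^ 2)) ∣ m := by
  obtain ⟨z, hz⟩ := IsAlgClosed.exists_aeval_eq_zero ℂ m hm.ne'
  by_cases him : z.im = 0
  · left
    refine ⟨z.re, ?_⟩
    rw [Polynomial.dvd_iff_isRoot]
    have hz' : z = (algebraMap ℝ ℂ z.re) := by
      apply Complex.ext <;> simp [him]
    rw [hz', Polynomial.aeval_algebraMap_apply] at hz
    simpa [Polynomial.IsRoot] using hz
  · right
    refine ⟨z.re, z.im, him, ?_⟩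
    have h := Polynomial.quadratic_dvd_of_aeval_eq_zero_im_ne_zero m hz him
    convert h using 1
    rw [Complex.sq_norm, Complex.normSq_apply]
    simp only [map_add, map_mul, map_pow, map_ofNat]
    ring

theorem star_aeval {s : R} (hs : star s = s) (p : Polynomial ℝ) :
    star (Polynomial.aeval s p) = Polynomial.aeval s p := by
  induction p using Polynomial.induction_on' with
  | add p q hp hq => simp [hp, hq]
  | monomial n a =>
    simp [Polynomial.aeval_monomial, hs, ← Algebra.commutes, ← algebraMap_star_comm]

omit [StarRing R] [StarModule ℝ R] in
theorem commute_aeval {s e : R} (h : Commute e s) (p : Polynomial ℝ) :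
    Commute e (Polynomial.aeval s p) := by
  induction p using Polynomial.induction_on' with
  | add p q hp hq => simpa using hp.add_right hq
  | monomial n a =>
    rw [Polynomial.aeval_monomial]
    exact (Algebra.commute_algebraMap_right a e).mul_right (h.pow_right n)

omit [StarRing R] [StarModule ℝ R] in
/-- A nonzero annihilating polynomial of minimal degree of `s` on `e`. -/
theorem exists_minimal_annihilator [FiniteDimensional ℝ R] (s e : R) :
    ∃ m : Polynomial ℝ, m ≠ 0 ∧ Polynomial.aeval s m * e = 0 ∧
      ∀ q : Polynomial ℝ, q ≠ 0 → q.natDegree < m.natDegree → Polynomial.aeval s q * e ≠ 0 := by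
  classical
  have hex : ∃ k : ℕ, ∃ m : Polynomial ℝ, m ≠ 0 ∧ Polynomial.aeval s m * e = 0 ∧
      m.natDegree = k :=
    ⟨_, minpoly ℝ s, minpoly.ne_zero (Algebra.IsIntegral.isIntegral s), by simp, rfl⟩
  obtain ⟨m, hm0, hm, hk⟩ := Nat.find_spec hex
  refine ⟨m, hm0, hm, fun q hq hlt h => ?_⟩
  exact Nat.find_min hex (hk ▸ hlt) ⟨q, hq, h, rfl⟩

/-- Spectral theory without a spectral theorem: a linear factor of the minimal annihilator of `s` on
`e` produces a projection below `e`, which minimality forces to be `e`; an irreducible quadratic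
factor would produce a vanishing sum of two squares. -/
theorem IsMinProj.exists_eq_smul [FiniteDimensional ℝ R] (hp : IsProper R) {e s : R}
    (he : IsMinProj e) (hs : star s = s) (hes : e * s = s) : ∃ r : ℝ, s = r • e := by
  have hse : s * e = s := by
    have := congrArg star hes
    rwa [star_mul, he.star_eq, hs] at this
  have hcomm := commute_aeval (hes.trans hse.symm : Commute e s)
  obtain ⟨m, hm0, hm, hmin⟩ := exists_minimal_annihilator s e
  have hdeg : 0 < m.degree := by
    by_contra hcon
    have hc := Polynomial.eq_C_of_degree_le_zero (not_lt.1 hcon)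
    rw [hc, Polynomial.aeval_C, ← Algebra.smul_def, smul_eq_zero] at hm
    rcases hm with h | h
    · rw [h, map_zero] at hc; exact hm0 hc
    · exact he.ne_zero h
  have key : ∀ p q : Polynomial ℝ, m = p * q → 0 < p.natDegree →
      Polynomial.aeval s q * e ≠ 0 ∧ Polynomial.aeval s p * (Polynomial.aeval s q * e) = 0 := by
    intro p q hpq hpd
    have hp0 : p ≠ 0 := by rintro rfl; simp at hpd
    have hq0 : q ≠ 0 := by rintro rfl; simp [hm0] at hpq
    refine ⟨hmin q hq0 ?_, ?_⟩
    · rw [hpq, Polynomial.natDegree_mul hp0 hq0]; omega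
    · rw [← mul_assoc, ← map_mul, ← hpq, hm]
  have hself : ∀ q : Polynomial ℝ, star (Polynomial.aeval s q * e) = Polynomial.aeval s q * e := by
    intro q
    rw [star_mul, he.star_eq, star_aeval hs, (hcomm q).eq]
  -- Cancelling the factor from `m` leaves `q` of smaller degree, so `w = q(s) e` is nonzero
  -- although the factor annihilates it.
  rcases exists_root_or_quadratic_dvd m hdeg with ⟨r, q, hq⟩ | ⟨r, c, hc, q, hq⟩
  · obtain ⟨hw, hpw⟩ := key _ q hq (by simp)
    set w := Polynomial.aeval s q * e with hwdef
    have hew : e * w = w := by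
      rw [hwdef, ← mul_assoc, (hcomm q).eq, mul_assoc, he.mul_self]
    have hsw : s * w = r • w := by
      simp only [map_sub, Polynomial.aeval_X, Polynomial.aeval_C, sub_mul, ← Algebra.smul_def,
        sub_eq_zero] at hpw
      exact hpw
    have heval : ∀ p : Polynomial ℝ, Polynomial.aeval s p * w = p.eval r • w := by
      intro p
      induction p using Polynomial.induction_on' with
      | add p q hp hq => simp [add_mul, add_smul, hp, hq]
      | monomial n a =>
        have hpow : ∀ n : ℕ, s ^ n * w = r ^ n • w := by
          intro n
          induction n with
          | zero => simp
          | succ n ih => rw [pow_succ, mul_assoc, hsw, mul_smul_comm, ih, smul_smul, pow_succ,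
              mul_comm]
        rw [Polynomial.aeval_monomial, mul_assoc, hpow, ← Algebra.smul_def, smul_smul,
          Polynomial.eval_monomial]
    -- As `s` acts on `w` by the scalar `r`, the self-adjoint `w` is idempotent up to the factor
    -- `q(r)`, which is nonzero by properness.
    have hww : w * w = q.eval r • w := by
      conv_lhs => rw [hwdef, mul_assoc, hew, heval]
    have hq0 : q.eval r ≠ 0 := by
      intro h0
      rw [h0, zero_smul] at hww
      exact hw (hp.eq_zero (by rw [hself, hww]))
    have hf : IsProj ((q.eval r)⁻¹ • w) :=
      ⟨by rw [star_smul, hself, star_trivial], by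
        rw [smul_mul_smul_comm, hww, smul_smul, mul_assoc, inv_mul_cancel₀ hq0, mul_one]⟩
    rcases he.minimal _ hf (by rw [mul_smul_comm, hew]) with h | h
    · exact absurd h (smul_ne_zero (inv_ne_zero hq0) hw)
    · refine ⟨r, ?_⟩
      rw [← h, ← hse, ← h, mul_smul_comm, hsw, smul_comm]
  · obtain ⟨hw, hpw⟩ := key _ q hq (by
      rw [Polynomial.natDegree_add_C, Polynomial.natDegree_pow, Polynomial.natDegree_X_sub_C]
      norm_num)
    exfalso
    set w := Polynomial.aeval s q * e with hwdef
    apply hw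
    have h1 : star ((s - algebraMap ℝ R r) * w) = w * (s - algebraMap ℝ R r) := by
      rw [star_mul, hself, star_sub, hs, ← algebraMap_star_comm, star_trivial]
    have h2 : w * (s - algebraMap ℝ R r) = (s - algebraMap ℝ R r) * w := by
      have c1 : Commute s w := by
        rw [hwdef]
        exact (commute_aeval (Commute.refl s) q).mul_right (hse.trans hes.symm)
      exact (c1.sub_left (Algebra.commute_algebraMap_left r w)).eq.symm
    -- Both `(s - r) w` and `c w` are self-adjoint, and their squares add up to `w ((s - r)² + c²) w
    -- = 0`.
    have h3 : c • w = 0 := by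
      refine hp (c • w) ((s - algebraMap ℝ R r) * w) ?_
      rw [h1, h2, star_smul, hself, star_trivial]
      have h4 : (s - algebraMap ℝ R r) * ((s - algebraMap ℝ R r) * w) + c ^ 2 • w = 0 := by
        simpa [Algebra.smul_def, add_mul, pow_two, mul_assoc] using hpw
      have h5 : c • w * c • w = w * (c ^ 2 • w) := by
        rw [smul_mul_smul_comm, mul_smul_comm, pow_two]
      have h6 : (s - algebraMap ℝ R r) * w * ((s - algebraMap ℝ R r) * w) =
          w * ((s - algebraMap ℝ R r) * ((s - algebraMap ℝ R r) * w)) := by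
        rw [← h2, mul_assoc]
      rw [h5, h6, ← mul_add, add_comm, h4, mul_zero]
    exact (smul_eq_zero.1 h3).resolve_left hc

end ProperStarAlgebra
-- Resolutions into minimal projections and partial isometries between them.
section MinimalProjections

variable {R : Type*} [Ring R] [StarRing R] [Algebra ℝ R] [StarModule ℝ R]

omit [Algebra ℝ R] [StarModule ℝ R] in
theorem IsProj.mul_eq_iff {e f : R} (he : IsProj e) (hf : IsProj f) :
    e * f = f ↔ f * e = f := by
  constructor <;> intro h <;> simpa [he.star_eq, hf.star_eq] using congrArg star h

omit [Algebra ℝ R] [StarModule ℝ R] in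
theorem IsProj.sub {e f : R} (he : IsProj e) (hf : IsProj f) (h : e * f = f) :
    IsProj (e - f) :=
  ⟨by simp [he.star_eq, hf.star_eq], by
    rw [sub_mul, mul_sub, mul_sub, he.mul_self, hf.mul_self, h, (he.mul_eq_iff hf).1 h]; abel⟩

/-- `S` is a finite set of pairwise orthogonal minimal projections with sum `e`. -/
structure IsMinResolution (S : Finset R) (e : R) : Prop where
  minProj : ∀ x ∈ S, IsMinProj x
  orth : ∀ x ∈ S, ∀ y ∈ S, x ≠ y → x * y = 0
  sum_eq : ∑ x ∈ S, x = e

omit [Algebra ℝ R] [StarModule ℝ R] in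
theorem IsMinResolution.mul_eq {S : Finset R} {e : R} (h : IsMinResolution S e) {x : R}
    (hx : x ∈ S) : e * x = x ∧ x * e = x := by
  constructor
  · rw [← h.sum_eq, Finset.sum_mul, Finset.sum_eq_single x
      (fun y hy hyx => h.orth y hy x hx hyx) (fun h' => absurd hx h'), (h.minProj x hx).mul_self]
  · rw [← h.sum_eq, Finset.mul_sum, Finset.sum_eq_single x
      (fun y hy hyx => h.orth x hx y hy hyx.symm) (fun h' => absurd hx h'),
      (h.minProj x hx).mul_self]

omit [StarModule ℝ R] in
-- Induction on the dimension of the right ideal `e R`: a projection that is neither zero nor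
-- minimal splits as `f + (e - f)`, and both ideals are properly smaller.
theorem exists_isMinResolution [FiniteDimensional ℝ R] {e : R} (he : IsProj e) :
    ∃ S : Finset R, IsMinResolution S e := by
  classical
  induction hk : Module.finrank ℝ (LinearMap.range (LinearMap.mulLeft ℝ e)) using
    Nat.strong_induction_on generalizing e with
  | _ k ih =>
  by_cases h0 : e = 0
  · exact ⟨∅, by simp, by simp, by simp [h0]⟩
  by_cases hmin : IsMinProj e
  · exact ⟨{e}, by simpa using hmin, by simp, by simp⟩
  have hex : ∃ f : R, IsProj f ∧ e * f = f ∧ f ≠ 0 ∧ f ≠ e := by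
    by_contra hcon
    push Not at hcon
    refine hmin ⟨he, h0, fun f hf hef => ?_⟩
    by_cases hf0 : f = 0
    · exact Or.inl hf0
    · exact Or.inr (hcon f hf hef hf0)
  obtain ⟨f, hf, hef, hf0, hfe⟩ := hex
  have hlt : ∀ g : R, IsProj g → e * g = g → g ≠ e →
      Module.finrank ℝ (LinearMap.range (LinearMap.mulLeft ℝ g)) < k := by
    intro g hg heg hge
    rw [← hk]
    apply Submodule.finrank_lt_finrank_of_lt
    refine lt_of_le_of_ne ?_ ?_
    · rintro _ ⟨a, rfl⟩
      exact ⟨g * a, by simp [← mul_assoc, heg]⟩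
    · intro heq
      have : e ∈ LinearMap.range (LinearMap.mulLeft ℝ g) := heq ▸ ⟨1, by simp⟩
      obtain ⟨a, ha⟩ := this
      have h1 : g * e = e := by
        rw [← ha]; simp [← mul_assoc, hg.mul_self]
      exact hge (((he.mul_eq_iff hg).1 heg).symm.trans h1)
  have hef' := (he.mul_eq_iff hf).1 hef
  obtain ⟨S, hS⟩ := ih _ (hlt f hf hef hfe) hf rfl
  obtain ⟨T, hT⟩ := ih _ (hlt (e - f) (he.sub hf hef) (by rw [mul_sub, he.mul_self, hef])
    (by simpa using hf0)) (he.sub hf hef) rfl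
  have hST : ∀ x ∈ S, ∀ y ∈ T, x * y = 0 := by
    intro x hx y hy
    rw [← (hS.mul_eq hx).2, ← (hT.mul_eq hy).1, mul_assoc, ← mul_assoc f, mul_sub, hef',
      hf.mul_self, sub_self, zero_mul, mul_zero]
  have hTS : ∀ x ∈ S, ∀ y ∈ T, y * x = 0 := by
    intro x hx y hy
    have := congrArg star (hST x hx y hy)
    rwa [star_mul, (hS.minProj x hx).star_eq, (hT.minProj y hy).star_eq, star_zero] at this
  have hdisj : Disjoint S T := by
    rw [Finset.disjoint_left]
    intro x hx hy
    have := hST x hx x hy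
    rw [(hS.minProj x hx).mul_self] at this
    exact (hS.minProj x hx).ne_zero this
  refine ⟨S ∪ T, fun x hx => ?_, fun x hx y hy hxy => ?_, ?_⟩
  · rcases Finset.mem_union.1 hx with h | h
    exacts [hS.minProj x h, hT.minProj x h]
  · rcases Finset.mem_union.1 hx with h | h <;> rcases Finset.mem_union.1 hy with h' | h'
    exacts [hS.orth x h y h' hxy, hST x h y h', hTS y h' x h, hT.orth x h y h' hxy]
  · rw [Finset.sum_union hdisj, hS.sum_eq, hT.sum_eq]; abel

/-- A partial isometry from the projection `y` to the projection `x`. -/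
structure IsPartialIso (x y v : R) : Prop where
  left : x * v = v
  right : v * y = v
  mul_star : v * star v = x
  star_mul : star v * v = y

omit [Algebra ℝ R] [StarModule ℝ R] in
theorem IsPartialIso.symm {x y v : R} (hx : IsProj x) (hy : IsProj y) (h : IsPartialIso x y v) :
    IsPartialIso y x (star v) :=
  ⟨by simpa [hy.star_eq] using congrArg star h.right,
   by simpa [hx.star_eq] using congrArg star h.left,
   by simpa using h.star_mul, by simpa using h.mul_star⟩

/-- Minimality gives the real scalar. If it were nonpositive, `w * star w` plus the square of `√(-r)
• x` would vanish, contrary to properness. -/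
theorem IsMinProj.mul_star_self [FiniteDimensional ℝ R] (hp : IsProper R) {x w : R}
    (hx : IsMinProj x) (hw : x * w = w) (hw0 : w ≠ 0) : ∃ r : ℝ, 0 < r ∧ w * star w = r • x := by
  obtain ⟨r, hr⟩ := hx.exists_eq_smul hp (s := w * star w) (by simp) (by rw [← mul_assoc, hw])
  refine ⟨r, ?_, hr⟩
  by_contra hcon
  have h1 : star (star w) * star w + star (√(-r) • x) * (√(-r) • x) = 0 := by
    rw [star_star, hr, star_smul, star_trivial, smul_mul_smul_comm, hx.star_eq, hx.mul_self,
      Real.mul_self_sqrt (by linarith)]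
    simp
  exact hw0 (star_eq_zero.1 (hp _ _ h1))

/-- Normalize `x * a * y` so that `v * star v = x`. Minimality of `y` gives `star v * v = μ • y`,
and evaluating `v * star v * v * star v` in two ways gives `μ = 1`. -/
theorem IsMinProj.exists_isPartialIso [FiniteDimensional ℝ R] (hp : IsProper R) {x y a : R}
    (hx : IsMinProj x) (hy : IsMinProj y) (h : x * a * y ≠ 0) : ∃ v, IsPartialIso x y v := by
  obtain ⟨r, hr, hrw⟩ := hx.mul_star_self hp (w := x * a * y)
    (by simp only [← mul_assoc, hx.mul_self]) h
  set w := x * a * y with hw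
  have hs : 0 < √r := Real.sqrt_pos.2 hr
  have hxw : x * w = w := by rw [hw]; simp only [← mul_assoc, hx.mul_self]
  have hwy : w * y = w := by rw [hw, mul_assoc, hy.mul_self]
  set v := (√r)⁻¹ • w with hv
  have hxv : x * v = v := by rw [hv, mul_smul_comm, hxw]
  have hvy : v * y = v := by rw [hv, smul_mul_assoc, hwy]
  have hvv : v * star v = x := by
    rw [hv, star_smul, star_trivial, smul_mul_smul_comm, hrw, smul_smul, ← mul_inv,
      Real.mul_self_sqrt hr.le, inv_mul_cancel₀ hr.ne', one_smul]
  have hyv : y * star v = star v := by simpa [hy.star_eq] using congrArg star hvy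
  obtain ⟨μ, hμ⟩ := hy.exists_eq_smul hp (s := star v * v) (by simp)
    (by rw [← mul_assoc, hyv])
  have h1 : μ • x = x := by
    calc μ • x = v * (μ • y) * star v := by
          rw [mul_smul_comm, hvy, smul_mul_assoc, hvv]
      _ = v * (star v * v) * star v := by rw [hμ]
      _ = (v * star v) * (v * star v) := by simp only [mul_assoc]
      _ = x := by rw [hvv, hx.mul_self]
  have h2 : μ = 1 := by
    have : (μ - 1) • x = 0 := by rw [sub_smul, h1, one_smul, sub_self]
    rcases smul_eq_zero.1 this with h | h
    · linarith
    · exact absurd h hx.ne_zero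
  exact ⟨v, hxv, hvy, hvv, by rw [hμ, h2, one_smul]⟩

end MinimalProjections

/-! ### When the skew elements generate the algebra. -/

section SkewGeneration

variable {R : Type*} [Ring R] [StarRing R] [Algebra ℝ R]

/-- `(e₁ + e₂) R` is a direct summand of `R` isomorphic to the real `2 × 2` matrices, with matrix
units `e₁, v, v*, e₂`. -/
structure IsMatrixTwoBlock (e₁ e₂ v : R) : Prop where
  proj₁ : IsProj e₁
  proj₂ : IsProj e₂
  ne_zero : e₁ ≠ 0
  orth : e₁ * e₂ = 0
  iso : IsPartialIso e₁ e₂ v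
  comm : ∀ a, (e₁ + e₂) * a = a * (e₁ + e₂)
  span : ∀ a, ∃ α β γ δ : ℝ, (e₁ + e₂) * a = α • e₁ + β • v + γ • star v + δ • e₂

/-- `e R` is a direct summand of `R` isomorphic to the reals. -/
structure IsRealBlock (e : R) : Prop where
  proj : IsProj e
  ne_zero : e ≠ 0
  comm : ∀ a, e * a = a * e
  span : ∀ a, ∃ α : ℝ, e * a = α • e

variable {S : Finset R} {B : Subalgebra ℝ R}

omit [Algebra ℝ R] in
theorem IsMinResolution.sum_mul {e : R} (hS : IsMinResolution S e) (a : R) :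
    ∑ x ∈ S, x * a = e * a := by rw [← Finset.sum_mul, hS.sum_eq]

omit [Algebra ℝ R] in
theorem IsMinResolution.mul_sum {e : R} (hS : IsMinResolution S e) (a : R) :
    ∑ x ∈ S, a * x = a * e := by rw [← Finset.mul_sum, hS.sum_eq]

/-- In matrix units, `(E_xk - E_kx)(E_ky - E_yk) = E_xy`: with a third index available, off-diagonal
elements are products of two skew ones. -/
theorem offDiag_mem_of_third (hB : ∀ a : R, star a = -a → a ∈ B) {x y k v : R}
    (hx : IsProj x) (hy : IsProj y) (hk : IsProj k) (hxy : x * y = 0) (hxk : x * k = 0)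
    (hky : k * y = 0) (hv : IsPartialIso k y v) (a : R) : x * a * y ∈ B := by
  have hkx : k * x = 0 := by simpa [hx.star_eq, hk.star_eq] using congrArg star hxk
  have hyx : y * x = 0 := by simpa [hx.star_eq, hy.star_eq] using congrArg star hxy
  have hyk : y * k = 0 := by simpa [hk.star_eq, hy.star_eq] using congrArg star hky
  have hsv := hv.symm hk hy
  set c := x * a * y * star v with hc
  have hcs : star c = v * (y * (star a * x)) := by
    simp [hc, hx.star_eq, hy.star_eq, mul_assoc]
  have h1 : c - star c ∈ B := hB _ (by simp)
  have h2 : v - star v ∈ B := hB _ (by simp)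
  have h3 : (c - star c) * (v - star v) = x * a * y := by
    have e1 : c * v = x * a * y := by
      rw [hc, mul_assoc, hv.star_mul, mul_assoc, hy.mul_self]
    have e2 : c * star v = 0 := by
      have : star v * star v = 0 := by
        calc star v * star v = (star v * k) * (y * star v) := by rw [hsv.left, hsv.right]
          _ = 0 := by rw [mul_assoc, ← mul_assoc k, hky]; simp
      rw [hc, mul_assoc, this, mul_zero]
    have e3 : star c * v = 0 := by
      rw [hcs, ← hv.left]; simp only [mul_assoc]; rw [← mul_assoc x, hxk]; simp
    have e4 : star c * star v = 0 := by
      rw [hcs, ← hsv.left]; simp only [mul_assoc]; rw [← mul_assoc x, hxy]; simp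
    rw [sub_mul, mul_sub, mul_sub, e1, e2, e3, e4]; simp
  rw [← h3]; exact B.mul_mem h1 h2

/-- Since `v * star v = x`, a diagonal element factors through the corner of `y` into two
off-diagonal ones. -/
theorem diag_mem_of_offDiag {x y v : R} (hy : IsProj y) (hx : IsProj x) (hv : IsPartialIso x y v)
    (h1 : ∀ a, x * a * y ∈ B) (h2 : ∀ a, y * a * x ∈ B) (a : R) : x * a * x ∈ B := by
  have hsv := hv.symm hx hy
  have e1 : x * a * x = (x * (a * v) * y) * (y * star v * x) := by
    rw [← hv.mul_star]
    conv_rhs => rw [hv.mul_star, hsv.left, hsv.right, mul_assoc x, mul_assoc a, hv.right]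
    rw [hv.mul_star]
    simp only [mul_assoc, hv.mul_star]
  rw [e1]; exact B.mul_mem (h1 _) (h2 _)

variable [StarModule ℝ R] [FiniteDimensional ℝ R]

/-- A nonzero skew element of the corner multiplied by its adjoint, which is again skew, is a
positive multiple of `x`. -/
theorem IsMinProj.mem_of_skew (hp : IsProper R) (hB : ∀ a : R, star a = -a → a ∈ B) {x j : R}
    (hx : IsMinProj x) (hj : x * j * x ≠ 0) (hs : star (x * j * x) = -(x * j * x)) : x ∈ B := by
  obtain ⟨r, hr, h⟩ := hx.mul_star_self hp (w := x * j * x)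
    (by simp only [← mul_assoc, hx.mul_self]) hj
  have h1 : x * j * x * star (x * j * x) ∈ B := by
    rw [hs]
    exact B.mul_mem (hB _ hs) (B.neg_mem (hB _ hs))
  have h2 : x = r⁻¹ • (x * j * x * star (x * j * x)) := by
    rw [h, smul_smul, inv_mul_cancel₀ hr.ne', one_smul]
  rw [h2]; exact B.smul_mem h1 _

theorem IsMinProj.corner_eq_skew_add_smul (hp : IsProper R) {x : R} (hx : IsMinProj x) (a : R) :
    ∃ r : ℝ, x * a * x = (1 / 2 : ℝ) • (x * (a - star a) * x) + r • x := by
  obtain ⟨r, hr⟩ := hx.exists_eq_smul hp (s := x * (a + star a) * x)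
    (by simp [hx.star_eq, mul_assoc, add_comm])
    (by simp only [← mul_assoc, hx.mul_self])
  refine ⟨r / 2, ?_⟩
  rw [show r / 2 = 2⁻¹ * r by ring, mul_smul, ← hr, one_div, ← smul_add, ← add_mul, ← mul_add]
  have : a - star a + (a + star a) = (2 : ℝ) • a := by rw [two_smul]; abel
  rw [this, mul_smul_comm, smul_mul_assoc, smul_smul, inv_mul_cancel₀ two_ne_zero, one_smul]

omit [Algebra ℝ R] [StarModule ℝ R] [FiniteDimensional ℝ R] in
theorem star_corner_sub {x : R} (hx : IsProj x) (a : R) :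
    star (x * (a - star a) * x) = -(x * (a - star a) * x) := by
  simp only [star_mul, star_sub, star_star, hx.star_eq, mul_assoc]
  rw [← mul_neg, ← neg_mul, neg_sub]

theorem IsMinProj.corner_mem (hp : IsProper R) (hB : ∀ a : R, star a = -a → a ∈ B) {x : R}
    (hx : IsMinProj x) (hxB : x ∈ B) (a : R) : x * a * x ∈ B := by
  obtain ⟨r, hr⟩ := hx.corner_eq_skew_add_smul hp a
  rw [hr]
  exact B.add_mem (B.smul_mem (hB _ (star_corner_sub hx.toIsProj a)) _) (B.smul_mem hxB _)

/-- The corner of a minimal projection is real if it has no nonzero skew elements. -/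
def RealCorner (x : R) : Prop := ∀ j : R, star (x * j * x) = -(x * j * x) → x * j * x = 0

theorem IsMinProj.corner_eq_smul (hp : IsProper R) {x : R} (hx : IsMinProj x)
    (hr : RealCorner x) (a : R) : ∃ r : ℝ, x * a * x = r • x := by
  obtain ⟨r, h⟩ := hx.corner_eq_skew_add_smul hp a
  exact ⟨r, by rw [h, hr _ (star_corner_sub hx.toIsProj a)]; simp⟩

omit [StarModule ℝ R] [FiniteDimensional ℝ R] in
-- Left multiplication by `x` kills the adjoint term in the skew element `x a y - (x a y)*`, because
-- `x * y = 0`.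
theorem offDiag_mem_of_mem (hB : ∀ a : R, star a = -a → a ∈ B) {x y : R} (hx : IsProj x)
    (hy : IsProj y) (hxy : x * y = 0) (hxB : x ∈ B) (a : R) :
    x * a * y ∈ B ∧ y * a * x ∈ B := by
  have key : ∀ a, x * a * y ∈ B ∧ star (x * a * y) ∈ B := by
    intro a
    have h1 : x * a * y - star (x * a * y) ∈ B := hB _ (by simp)
    have h2 : x * a * y = x * (x * a * y - star (x * a * y)) := by
      simp only [star_mul, hx.star_eq, hy.star_eq, mul_sub, ← mul_assoc, hx.mul_self, hxy]
      simp
    have h3 : x * a * y ∈ B := by rw [h2]; exact B.mul_mem hxB h1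
    exact ⟨h3, by simpa using B.sub_mem h3 h1⟩
  refine ⟨(key a).1, ?_⟩
  have := (key (star a)).2
  simpa [hx.star_eq, hy.star_eq, mul_assoc] using this

/-- A subalgebra containing all skew elements is everything, unless there is a summand of real
`2 × 2` matrices or there are two summands `ℝ`. -/
theorem eq_top_or_exists_block (hp : IsProper R) (hB : ∀ a : R, star a = -a → a ∈ B) :
    B = ⊤ ∨ (∃ e₁ e₂ v : R, IsMatrixTwoBlock e₁ e₂ v) ∨
      ∃ e f : R, IsRealBlock e ∧ IsRealBlock f ∧ e * f = 0 := by
  classical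
  by_cases hno2 : ∃ e₁ e₂ v : R, IsMatrixTwoBlock e₁ e₂ v
  · exact Or.inr (Or.inl hno2)
  by_cases hno1 : ∃ e f : R, IsRealBlock e ∧ IsRealBlock f ∧ e * f = 0
  · exact Or.inr (Or.inr hno1)
  left
  obtain ⟨S, hS⟩ := exists_isMinResolution (e := (1 : R)) ⟨star_one R, mul_one 1⟩
  have hsum : ∀ a : R, a = ∑ x ∈ S, ∑ y ∈ S, x * a * y := by
    intro a
    simp_rw [hS.mul_sum, mul_one, hS.sum_mul, one_mul]
  have hmin := hS.minProj
  have horth := hS.orth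
  have hskew : ∀ x ∈ S, ¬ RealCorner x → x ∈ B := by
    intro x hx h
    unfold RealCorner at h
    push Not at h
    obtain ⟨j, hj, hj0⟩ := h
    exact (hmin x hx).mem_of_skew hp hB hj0 hj
  -- For linked `x` and `y` there are three cases: the corner of `x` contains skew elements and so
  -- `x ∈ B`; a third projection is linked to `y`; or `x` and `y` form an isolated real pair, which
  -- is the excluded `2 × 2` block.
  have hiso : ∀ x ∈ S, ∀ y ∈ S, x ≠ y → (∃ a, x * a * y ≠ 0) → (∀ a, x * a * y ∈ B) := by
    rintro x hx y hy hxy ⟨a₀, ha₀⟩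
    obtain ⟨v, hv⟩ := (hmin x hx).exists_isPartialIso hp (hmin y hy) ha₀
    by_cases hrx : RealCorner x
    swap
    · exact fun a => (offDiag_mem_of_mem hB (hmin x hx).toIsProj (hmin y hy).toIsProj
        (horth x hx y hy hxy) (hskew x hx hrx) a).1
    by_cases hthird : ∃ k ∈ S, k ≠ x ∧ k ≠ y ∧ ∃ a, k * a * y ≠ 0
    · obtain ⟨k, hk, hkx, hky, b, hb⟩ := hthird
      obtain ⟨u, hu⟩ := (hmin k hk).exists_isPartialIso hp (hmin y hy) hb
      exact offDiag_mem_of_third hB (hmin x hx).toIsProj (hmin y hy).toIsProj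
        (hmin k hk).toIsProj (horth x hx y hy hxy) (horth x hx k hk hkx.symm)
        (horth k hk y hy hky) hu
    -- If no third projection is linked to `y`, then via `v` none is linked to `x` either, so `x +
    -- y` is central.
    exfalso
    push Not at hthird
    apply hno2
    have hx' := (hmin x hx).toIsProj
    have hy' := (hmin y hy).toIsProj
    have hyk : ∀ k ∈ S, k ≠ x → k ≠ y → ∀ a, y * a * k = 0 := by
      intro k hk hkx hky a
      have := congrArg star (hthird k hk hkx hky (star a))
      simpa [hy'.star_eq, (hmin k hk).star_eq, mul_assoc] using this
    have hxk : ∀ k ∈ S, k ≠ x → k ≠ y → ∀ a, x * a * k = 0 := by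
      intro k hk hkx hky a
      have := hyk k hk hkx hky (star v * a)
      rw [← mul_assoc, (hv.symm hx' hy').left] at this
      rw [← hv.mul_star, mul_assoc v, mul_assoc v, this, mul_zero]
    have hkx : ∀ k ∈ S, k ≠ x → k ≠ y → ∀ a, k * a * x = 0 := by
      intro k hk hkx hky a
      have := congrArg star (hxk k hk hkx hky (star a))
      simpa [hx'.star_eq, (hmin k hk).star_eq, mul_assoc] using this
    have hrow : ∀ z, (∀ k ∈ S, k ≠ x → k ≠ y → ∀ a, z * a * k = 0) →
        ∀ a, z * a = z * a * x + z * a * y := by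
      intro z hz a
      conv_lhs => rw [← mul_one (z * a), ← hS.sum_eq, Finset.mul_sum]
      rw [← Finset.sum_pair hxy]
      symm
      apply Finset.sum_subset
      · intro k hk
        rcases Finset.mem_insert.1 hk with rfl | h
        · exact hx
        · rw [Finset.mem_singleton.1 h]; exact hy
      · intro k hk hk'
        simp only [Finset.mem_insert, Finset.mem_singleton, not_or] at hk'
        exact hz k hk hk'.1 hk'.2 a
    have hcol : ∀ z, (∀ k ∈ S, k ≠ x → k ≠ y → ∀ a, k * a * z = 0) →
        ∀ a, a * z = x * a * z + y * a * z := by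
      intro z hz a
      conv_lhs => rw [← one_mul (a * z), ← hS.sum_eq, Finset.sum_mul]
      simp only [mul_assoc]
      rw [← Finset.sum_pair (f := fun k => k * (a * z)) hxy]
      symm
      apply Finset.sum_subset
      · intro k hk
        rcases Finset.mem_insert.1 hk with rfl | h
        · exact hx
        · rw [Finset.mem_singleton.1 h]; exact hy
      · intro k hk hk'
        simp only [Finset.mem_insert, Finset.mem_singleton, not_or] at hk'
        rw [← mul_assoc]
        exact hz k hk hk'.1 hk'.2 a
    have hsv := hv.symm hx' hy'
    refine ⟨x, y, v, hx', hy', (hmin x hx).ne_zero, horth x hx y hy hxy, hv, fun a => ?_,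
      fun a => ?_⟩
    · rw [add_mul, mul_add, hrow x hxk a, hrow y hyk a, hcol x hkx a, hcol y hthird a]
      abel
    -- Multiplication by `v` and `star v` carries all four corners into `x R x`, whose elements are
    -- real multiples of `x`; hence four real coefficients.
    · obtain ⟨α, hα⟩ := (hmin x hx).corner_eq_smul hp hrx a
      obtain ⟨β, hβ⟩ := (hmin x hx).corner_eq_smul hp hrx (a * star v)
      obtain ⟨γ, hγ⟩ := (hmin x hx).corner_eq_smul hp hrx (v * a)
      obtain ⟨δ, hδ⟩ := (hmin x hx).corner_eq_smul hp hrx (v * a * star v)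
      refine ⟨α, β, γ, δ, ?_⟩
      have e1 : x * a * y = β • v := by
        have : x * a * y = x * (a * star v) * x * v := by
          simp only [mul_assoc]
          rw [hv.left, hv.star_mul]
        rw [this, hβ, smul_mul_assoc, hv.left]
      have e2 : y * a * x = γ • star v := by
        have : y * a * x = star v * (x * (v * a) * x) := by
          simp only [← mul_assoc]
          rw [hsv.right, hv.star_mul]
        rw [this, hγ, mul_smul_comm, hsv.right]
      have e3 : y * a * y = δ • y := by
        have : y * a * y = star v * (x * (v * a * star v) * x) * v := by
          simp only [← mul_assoc]
          rw [hsv.right, hv.star_mul]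
          simp only [mul_assoc]
          rw [hv.left, hv.star_mul]
        rw [this, hδ, mul_smul_comm, hsv.right, smul_mul_assoc, hv.star_mul]
      rw [add_mul, hrow x hxk, hrow y hyk, hα, e1, e2, e3]
      abel
  have hoff : ∀ x ∈ S, ∀ y ∈ S, x ≠ y → (∀ a, x * a * y ∈ B) := by
    intro x hx y hy hxy a
    by_cases h : x * a * y = 0
    · rw [h]; exact B.zero_mem
    · exact hiso x hx y hy hxy ⟨a, h⟩ a
  have hdiag : ∀ x ∈ S, ((∃ y ∈ S, y ≠ x ∧ ∃ a, x * a * y ≠ 0) ∨ ¬ RealCorner x) →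
      ∀ a, x * a * x ∈ B := by
    rintro x hx (⟨y, hy, hyx, a₀, ha₀⟩ | h) a
    · obtain ⟨v, hv⟩ := (hmin x hx).exists_isPartialIso hp (hmin y hy) ha₀
      exact diag_mem_of_offDiag (hmin y hy).toIsProj (hmin x hx).toIsProj hv
        (hoff x hx y hy hyx.symm) (hoff y hy x hx hyx) a
    · exact (hmin x hx).corner_mem hp hB (hskew x hx h) a
  -- What remains is a projection linked to no other, with real corner: a summand `ℝ`.
  have hblock : ∀ x ∈ S, ¬ ((∃ y ∈ S, y ≠ x ∧ ∃ a, x * a * y ≠ 0) ∨ ¬ RealCorner x) →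
      IsRealBlock x := by
    intro x hx h
    push Not at h
    obtain ⟨h1, h2⟩ := h
    have hx' := (hmin x hx).toIsProj
    have hrow : ∀ a, x * a = x * a * x := by
      intro a
      conv_lhs => rw [← mul_one (x * a), ← hS.sum_eq, Finset.mul_sum]
      exact Finset.sum_eq_single x (fun k hk hkx => h1 k hk hkx a) (fun h => absurd hx h)
    refine ⟨hx', (hmin x hx).ne_zero, fun a => ?_, fun a => ?_⟩
    · have h3 := congrArg star (hrow (star a))
      simp only [star_mul, star_star, hx'.star_eq] at h3
      rw [hrow, h3, mul_assoc]
    · rw [hrow]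
      exact (hmin x hx).corner_eq_smul hp h2 a
  have hdiag' : ∀ x ∈ S, ∀ a, x * a * x ∈ B := by
    intro x hx a
    by_cases h : ((∃ y ∈ S, y ≠ x ∧ ∃ a, x * a * y ≠ 0) ∨ ¬ RealCorner x)
    · exact hdiag x hx h a
    have hxb := hblock x hx h
    have hxB : x ∈ B := by
      -- There is at most one summand `ℝ`. All other projections of the resolution lie in `B`, and
      -- the unit supplies the last one as a difference.
      have hrest : ∑ y ∈ S.erase x, y ∈ B := by
        refine B.sum_mem fun y hy => ?_
        obtain ⟨hyx, hy⟩ := Finset.mem_erase.1 hy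
        by_cases h' : ((∃ z ∈ S, z ≠ y ∧ ∃ a, y * a * z ≠ 0) ∨ ¬ RealCorner y)
        · have := hdiag y hy h' y
          rwa [(hmin y hy).mul_self, (hmin y hy).mul_self] at this
        · exact absurd ⟨x, y, hxb, hblock y hy h', horth x hx y hy hyx.symm⟩ hno1
      have : x = 1 - ∑ y ∈ S.erase x, y := by
        rw [eq_sub_iff_add_eq, Finset.add_sum_erase S (fun y => y) hx, hS.sum_eq]
      rw [this]
      exact B.sub_mem B.one_mem hrest
    exact (hmin x hx).corner_mem hp hB hxB a
  rw [eq_top_iff]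
  intro a _
  rw [hsum a]
  refine B.sum_mem fun x hx => B.sum_mem fun y hy => ?_
  by_cases hxy : x = y
  · subst hxy; exact hdiag' x hx a
  · exact hoff x hx y hy hxy a

end SkewGeneration

/-! ### Linear algebra over the scalars `ℝ` and `ℍ`: properness and orthonormal frames. -/

/-- The properties of `ℝ` and `ℍ` used below: finite-dimensional real algebras with an isometric
involution such that `a* a` is the real number `‖a‖ ^ 2`. -/
class HermitianScalars (𝕂 : Type*) [NormedRing 𝕂] [StarRing 𝕂] [NormedAlgebra ℝ 𝕂] : Prop where
  nontrivial : Nontrivial 𝕂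
  finiteDimensional : FiniteDimensional ℝ 𝕂
  starModule : StarModule ℝ 𝕂
  normedStarGroup : NormedStarGroup 𝕂
  star_mul_self : ∀ a : 𝕂, star a * a = algebraMap ℝ 𝕂 (‖a‖ ^ 2)

attribute [instance] HermitianScalars.nontrivial HermitianScalars.finiteDimensional
  HermitianScalars.starModule HermitianScalars.normedStarGroup

instance : HermitianScalars ℝ where
  nontrivial := inferInstance
  finiteDimensional := inferInstance
  starModule := inferInstance
  normedStarGroup := inferInstance
  star_mul_self a := by simp [pow_two]

instance : HermitianScalars ℍ[ℝ] where
  nontrivial := inferInstance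
  finiteDimensional := inferInstance
  starModule := ⟨fun r a => by ext <;> simp⟩
  normedStarGroup := inferInstance
  star_mul_self a := by
    rw [Quaternion.star_mul_self, Quaternion.normSq_eq_norm_mul_self, pow_two]
    rfl

section Frames

variable {𝕂 : Type*} [NormedRing 𝕂] [StarRing 𝕂] [NormedAlgebra ℝ 𝕂] [HermitianScalars 𝕂]
  {m ι κ : Type*} [Fintype m] [Fintype ι] [Fintype κ] [DecidableEq m] [DecidableEq ι]
  [DecidableEq κ]

omit [DecidableEq m] [Fintype ι] [DecidableEq ι] in
theorem conjTranspose_mul_self_diag (A : Matrix m ι 𝕂) (j : ι) :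
    (Aᴴ * A) j j = algebraMap ℝ 𝕂 (∑ i, ‖A i j‖ ^ 2) := by
  simp [Matrix.mul_apply, HermitianScalars.star_mul_self]

/-- The diagonal entries of `Aᴴ * A + Bᴴ * B` are sums of squared norms. -/
theorem isProper_matrix : IsProper (Matrix m m 𝕂) := by
  intro A B h
  ext i j
  have h1 := congrFun (congrFun h j) j
  rw [Matrix.add_apply, Matrix.star_eq_conjTranspose, Matrix.star_eq_conjTranspose,
    conjTranspose_mul_self_diag, conjTranspose_mul_self_diag, ← map_add, Matrix.zero_apply,
    FaithfulSMul.algebraMap_eq_zero_iff] at h1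
  have h2 : ∑ i, ‖A i j‖ ^ 2 = 0 := by
    have ha : 0 ≤ ∑ i, ‖A i j‖ ^ 2 := by positivity
    have hb : 0 ≤ ∑ i, ‖B i j‖ ^ 2 := by positivity
    linarith
  have h3 := (Finset.sum_eq_zero_iff_of_nonneg (fun i _ => by positivity)).1 h2 i
    (Finset.mem_univ i)
  simpa using h3

omit [StarRing 𝕂] [DecidableEq m] [HermitianScalars 𝕂] in
-- Comparing real dimensions avoids rank theory over the noncommutative `𝕂`.
theorem card_le_of_mul_eq_one [Nontrivial 𝕂] [FiniteDimensional ℝ 𝕂] {u : Matrix m ι 𝕂}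
    {v : Matrix ι m 𝕂} (h : v * u = 1) : Fintype.card ι ≤ Fintype.card m := by
  let f : (ι → 𝕂) →ₗ[ℝ] (m → 𝕂) :=
    { toFun := fun x => u *ᵥ x
      map_add' := Matrix.mulVec_add u
      map_smul' := fun r x => by simp [Matrix.mulVec_smul] }
  have hf : Function.Injective f := by
    intro x y hxy
    have : v *ᵥ (u *ᵥ x) = v *ᵥ (u *ᵥ y) := congrArg _ hxy
    simpa [Matrix.mulVec_mulVec, h] using this
  have h1 := LinearMap.finrank_le_finrank_of_injective hf
  have hpos : 0 < Module.finrank ℝ 𝕂 := Module.finrank_pos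
  simp only [Module.finrank_pi_fintype, Finset.sum_const, Finset.card_univ, smul_eq_mul] at h1
  exact Nat.le_of_mul_le_mul_right h1 hpos

/-- Determinants are not at hand over `ℍ`; instead, left multiplication by `B` is an injective
real-linear endomorphism of a finite-dimensional space, hence surjective. -/
theorem mul_conjTranspose_eq_one_comm {A B : Matrix m m 𝕂} (h : A * B = 1) : B * A = 1 := by
  let f : Matrix m m 𝕂 →ₗ[ℝ] Matrix m m 𝕂 := LinearMap.mulLeft ℝ B
  have hf : Function.Injective f := by
    intro x y hxy
    have : A * (B * x) = A * (B * y) := congrArg _ hxy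
    simpa [← mul_assoc, h] using this
  obtain ⟨C, hC⟩ := (LinearMap.injective_iff_surjective.1 hf) 1
  have hC' : B * C = 1 := hC
  have : A = C := by
    calc A = A * (B * C) := by rw [hC', mul_one]
      _ = C := by rw [← mul_assoc, h, one_mul]
  rw [this, hC']

theorem exists_minimal_nat {p : ℕ → Prop} (h : ∃ j, p j) : ∃ j, p j ∧ ∀ i < j, ¬ p i := by
  classical
  exact ⟨Nat.find h, Nat.find_spec h, fun _ h' => Nat.find_min h h'⟩

/-- Orthonormal frames of the image of a projection can be enlarged until they span. -/
theorem exists_frame {e : Matrix m m 𝕂} (he : IsProj e) :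
    ∃ (k : ℕ) (u : Matrix m (Fin k) 𝕂), uᴴ * u = 1 ∧ u * uᴴ = e := by
  classical
  -- `j` is the number of columns by which the frame falls short of the maximal conceivable size, so
  -- the least `j` belongs to a largest frame inside the image of `e`.
  have hex : ∃ j : ℕ, j ≤ Fintype.card m ∧
      ∃ u : Matrix m (Fin (Fintype.card m - j)) 𝕂, uᴴ * u = 1 ∧ e * u = u :=
    ⟨Fintype.card m, le_rfl, 0, by
      ext i; exact absurd i.2 (by simp), by simp⟩
  obtain ⟨j, ⟨hle, u, hu, heu⟩, hmin⟩ :=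
    exists_minimal_nat hex
  refine ⟨_, u, hu, ?_⟩
  by_contra hne
  set f := e - u * uᴴ with hf
  have hf0 : f ≠ 0 := fun h => hne (sub_eq_zero.1 h).symm
  have heu' : uᴴ * e = uᴴ := by
    have := congrArg Matrix.conjTranspose heu
    rwa [Matrix.conjTranspose_mul, ← Matrix.star_eq_conjTranspose e, he.star_eq] at this
  have huf : uᴴ * f = 0 := by
    rw [hf, Matrix.mul_sub, heu', ← Matrix.mul_assoc, hu, Matrix.one_mul, sub_self]
  have hef : e * f = f := by
    rw [hf, Matrix.mul_sub, he.mul_self, ← Matrix.mul_assoc, heu]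
  obtain ⟨i₀, j₀, hij⟩ : ∃ i j, f i j ≠ 0 := by
    by_contra hcon
    push Not at hcon
    exact hf0 (by ext i j; simpa using hcon i j)
  set s : ℝ := ∑ i, ‖f i j₀‖ ^ 2 with hs
  have hspos : 0 < s :=
    Finset.sum_pos' (fun i _ => by positivity) ⟨i₀, Finset.mem_univ _, by positivity⟩
  -- If the frame does not span, a nonzero column of `e - u * uᴴ`, normalized, lies in the image of
  -- `e` and is orthogonal to the frame.
  set w : Matrix m (Fin 1) 𝕂 := Matrix.of fun i _ => (√s)⁻¹ • f i j₀ with hw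
  have hww : wᴴ * w = 1 := by
    ext a b
    have hab : a = b := Subsingleton.elim _ _
    subst hab
    rw [conjTranspose_mul_self_diag, Matrix.one_apply_eq]
    have : ∑ i, ‖w i a‖ ^ 2 = 1 := by
      simp only [hw, Matrix.of_apply, norm_smul, mul_pow, ← Finset.mul_sum, ← hs]
      rw [norm_inv, inv_pow, Real.norm_of_nonneg (Real.sqrt_nonneg s), Real.sq_sqrt hspos.le,
        inv_mul_cancel₀ hspos.ne']
    rw [this, map_one]
  have huw : uᴴ * w = 0 := by
    ext i j
    have : (uᴴ * w) i j = (√s)⁻¹ • (uᴴ * f) i j₀ := by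
      simp [hw, Matrix.mul_apply, Finset.smul_sum]
    rw [this, huf]; simp
  have hwu : wᴴ * u = 0 := by
    have := congrArg Matrix.conjTranspose huw
    simpa using this
  have hew : e * w = w := by
    ext i j
    have : (e * w) i j = (√s)⁻¹ • (e * f) i j₀ := by
      simp [hw, Matrix.mul_apply, Finset.smul_sum]
    rw [this, hef]; simp [hw]
  have h1 : (Matrix.fromCols u w)ᴴ * Matrix.fromCols u w = 1 := by
    rw [Matrix.conjTranspose_fromCols_eq_fromRows_conjTranspose, Matrix.fromRows_mul_fromCols,
      hu, huw, hwu, hww, Matrix.fromBlocks_one]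
  -- The enlarged frame still has at most `card m` columns, which excludes `j = 0` and so makes `j -
  -- 1` smaller than `j`.
  have hcard := card_le_of_mul_eq_one h1
  simp only [Fintype.card_sum, Fintype.card_fin] at hcard
  have hj1 : j - 1 < j := by omega
  apply hmin (j - 1) hj1
  have hk : Fintype.card m - j + 1 = Fintype.card m - (j - 1) := by omega
  let E : Fin (Fintype.card m - (j - 1)) ≃ Fin (Fintype.card m - j) ⊕ Fin 1 :=
    (finCongr hk.symm).trans finSumFinEquiv.symm
  refine ⟨by omega, (Matrix.fromCols u w).submatrix id E, ?_, ?_⟩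
  · rw [Matrix.conjTranspose_submatrix, ← Matrix.submatrix_mul _ _ _ _ _ Function.bijective_id, h1,
      Matrix.submatrix_one_equiv]
  · have : e * Matrix.fromCols u w = Matrix.fromCols u w := by
      rw [Matrix.mul_fromCols, heu, hew]
    conv_rhs => rw [← this]
    rw [Matrix.submatrix_mul _ _ id id _ Function.bijective_id, Matrix.submatrix_id_id]

end Frames

/-! ### The algebra of a Howe subgroup, and splitting off direct factors. -/

section DirectFactor

variable {𝕂 : Type*} [NormedRing 𝕂] [StarRing 𝕂] [NormedAlgebra ℝ 𝕂] [HermitianScalars 𝕂]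
  {n : ℕ}

/-- The real `*`-algebra of all matrices commuting with the centralizer of `H`. -/
def doubleCommutant (H : Subgroup (IsoGroup 𝕂 (Fin n))) :
    StarSubalgebra ℝ (Matrix (Fin n) (Fin n) 𝕂) :=
  StarSubalgebra.centralizer ℝ
    ((↑) '' (Subgroup.centralizer (H : Set (IsoGroup 𝕂 (Fin n))) : Set (IsoGroup 𝕂 (Fin n))))

omit [NormedAlgebra ℝ 𝕂] [HermitianScalars 𝕂] in
theorem isoGroup_coe_inv (g : IsoGroup 𝕂 (Fin n)) : (g⁻¹ : IsoGroup 𝕂 (Fin n)).1 = g.1ᴴ := rfl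

/-- The condition on adjoints is automatic, because the adjoint of a unitary `z` is its inverse,
again in the centralizer. -/
theorem mem_doubleCommutant_iff {H : Subgroup (IsoGroup 𝕂 (Fin n))}
    {a : Matrix (Fin n) (Fin n) 𝕂} :
    a ∈ doubleCommutant H ↔ ∀ z ∈ Subgroup.centralizer (H : Set (IsoGroup 𝕂 (Fin n))),
      z.1 * a = a * z := by
  rw [doubleCommutant, StarSubalgebra.mem_centralizer_iff]
  constructor
  · intro h z hz
    exact (h z ⟨z, hz, rfl⟩).1
  · rintro h _ ⟨z, hz, rfl⟩
    refine ⟨h z hz, ?_⟩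
    have := h z⁻¹ (inv_mem hz)
    exact this

theorem IsHowe.mem_iff {H : Subgroup (IsoGroup 𝕂 (Fin n))} (hH : IsHowe H)
    (g : IsoGroup 𝕂 (Fin n)) : g ∈ H ↔ (g : Matrix (Fin n) (Fin n) 𝕂) ∈ doubleCommutant H := by
  conv_lhs => rw [← hH]
  rw [mem_doubleCommutant_iff, Subgroup.mem_centralizer_iff]
  refine forall₂_congr fun z _ => ?_
  rw [Subtype.ext_iff]
  rfl

/-- A central projection of the double commutant, together with an orthonormal frame of its image,
splits off a direct factor. -/
theorem hasDirectFactor_of_frame {H : Subgroup (IsoGroup 𝕂 (Fin n))} (hH : IsHowe H)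
    {ι : Type*} [Fintype ι] [DecidableEq ι] {S : Set (Matrix ι ι 𝕂)}
    {q : Matrix (Fin n) (Fin n) 𝕂} (hq : IsProj q) (hqH : q ∈ doubleCommutant H)
    (hcomm : ∀ a ∈ doubleCommutant H, q * a = a * q) {u : Matrix (Fin n) ι 𝕂}
    (huu : uᴴ * u = 1) (huq : u * uᴴ = q)
    (hS : ∀ a : Matrix ι ι 𝕂, a ∈ S ↔ aᴴ * a = 1 ∧ u * a * uᴴ ∈ doubleCommutant H) :
    HasDirectFactor H S := by
  obtain ⟨r, w, hww, hwq⟩ := exists_frame (e := 1 - q)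
    ⟨by simp [hq.star_eq], by rw [sub_mul, mul_sub, mul_sub, hq.mul_self]; simp⟩
  have hq' : qᴴ = q := hq.star_eq
  have hqu : q * u = u := by rw [← huq, Matrix.mul_assoc, huu, Matrix.mul_one]
  have huq' : uᴴ * q = uᴴ := by rw [← huq, ← Matrix.mul_assoc, huu, Matrix.one_mul]
  have hqw : q * w = 0 := by
    have : (1 - q) * w = w := by rw [← hwq, Matrix.mul_assoc, hww, Matrix.mul_one]
    rw [Matrix.sub_mul, Matrix.one_mul] at this
    simpa using this
  have hwq' : wᴴ * q = 0 := by
    have := congrArg Matrix.conjTranspose hqw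
    rwa [Matrix.conjTranspose_mul, hq', Matrix.conjTranspose_zero] at this
  have huw : uᴴ * w = 0 := by rw [← huq', Matrix.mul_assoc, hqw, Matrix.mul_zero]
  have hwu : wᴴ * u = 0 := by rw [← hqu, ← Matrix.mul_assoc, hwq', Matrix.zero_mul]
  have hsum : u * uᴴ + w * wᴴ = 1 := by rw [huq, hwq]; abel
  have h1 : (Matrix.fromCols u w)ᴴ * Matrix.fromCols u w = 1 := by
    rw [Matrix.conjTranspose_fromCols_eq_fromRows_conjTranspose, Matrix.fromRows_mul_fromCols,
      huu, huw, hwu, hww, Matrix.fromBlocks_one]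
  have h2 : Matrix.fromCols u w * (Matrix.fromCols u w)ᴴ = 1 := by
    rw [Matrix.conjTranspose_fromCols_eq_fromRows_conjTranspose, Matrix.fromCols_mul_fromRows,
      hsum]
  have hcard : Fintype.card (ι ⊕ Fin r) = Fintype.card (Fin n) :=
    le_antisymm (card_le_of_mul_eq_one h1) (card_le_of_mul_eq_one h2)
  -- Any bijection serves: `g` consists of the columns of `(u | w)` labelled by the same `e`, so the
  -- choice cancels in `hg`.
  let e : ι ⊕ Fin r ≃ Fin n := Fintype.equivOfCardEq hcard
  have hadd : ∀ (a : Matrix ι ι 𝕂) (b : Matrix (Fin r) (Fin r) 𝕂),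
      Matrix.fromCols u w * Matrix.fromBlocks a 0 0 b * (Matrix.fromCols u w)ᴴ =
        u * a * uᴴ + w * b * wᴴ := by
    intro a b
    rw [Matrix.conjTranspose_fromCols_eq_fromRows_conjTranspose, Matrix.fromCols_mul_fromBlocks,
      Matrix.fromCols_mul_fromRows]
    simp
  let g : IsoGroup 𝕂 (Fin n) := ⟨(Matrix.fromCols u w).submatrix id e.symm, by
    rw [Unitary.mem_iff, Matrix.star_eq_conjTranspose, Matrix.conjTranspose_submatrix]
    constructor
    · rw [← Matrix.submatrix_mul _ _ _ _ _ Function.bijective_id, h1, Matrix.submatrix_one_equiv]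
    · rw [Matrix.submatrix_mul_equiv, h2, Matrix.submatrix_id_id]⟩
  have hg : ∀ (a : Matrix ι ι 𝕂) (b : Matrix (Fin r) (Fin r) 𝕂),
      (g : Matrix (Fin n) (Fin n) 𝕂) * Matrix.reindex e e (Matrix.fromBlocks a 0 0 b) *
        (g⁻¹ : IsoGroup 𝕂 (Fin n)).1 = u * a * uᴴ + w * b * wᴴ := by
    intro a b
    rw [← hadd, isoGroup_coe_inv, Matrix.reindex_apply]
    simp only [g]
    rw [Matrix.conjTranspose_submatrix]
    rw [Matrix.submatrix_mul_equiv, Matrix.submatrix_mul_equiv, Matrix.submatrix_id_id]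
  have hmulw : ∀ x y : Matrix (Fin r) (Fin r) 𝕂, w * x * wᴴ * (w * y * wᴴ) = w * (x * y) * wᴴ := by
    intro x y
    rw [show w * x * wᴴ * (w * y * wᴴ) = w * x * (wᴴ * w) * y * wᴴ by
      simp only [Matrix.mul_assoc], hww]
    simp only [Matrix.mul_assoc, Matrix.mul_one]
  have hmulu : ∀ x y : Matrix ι ι 𝕂, u * x * uᴴ * (u * y * uᴴ) = u * (x * y) * uᴴ := by
    intro x y
    rw [show u * x * uᴴ * (u * y * uᴴ) = u * x * (uᴴ * u) * y * uᴴ by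
      simp only [Matrix.mul_assoc], huu]
    simp only [Matrix.mul_assoc, Matrix.mul_one]
  have hmul : ∀ (a a' : Matrix ι ι 𝕂) (b b' : Matrix (Fin r) (Fin r) 𝕂),
      (u * a * uᴴ + w * b * wᴴ) * (u * a' * uᴴ + w * b' * wᴴ) =
        u * (a * a') * uᴴ + w * (b * b') * wᴴ := by
    intro a a' b b'
    have c1 : u * a * uᴴ * (w * b' * wᴴ) = 0 := by
      rw [show u * a * uᴴ * (w * b' * wᴴ) = u * a * (uᴴ * w) * b' * wᴴ by
        simp only [Matrix.mul_assoc], huw]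
      simp
    have c2 : w * b * wᴴ * (u * a' * uᴴ) = 0 := by
      rw [show w * b * wᴴ * (u * a' * uᴴ) = w * b * (wᴴ * u) * a' * uᴴ by
        simp only [Matrix.mul_assoc], hwu]
      simp
    rw [Matrix.add_mul, Matrix.mul_add, Matrix.mul_add, c1, c2, hmulu, hmulw]
    simp
  have hunit : ∀ (a : Matrix ι ι 𝕂) (b : Matrix (Fin r) (Fin r) 𝕂), aᴴ * a = 1 → bᴴ * b = 1 →
      u * a * uᴴ + w * b * wᴴ ∈ unitary (Matrix (Fin n) (Fin n) 𝕂) := by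
    intro a b ha hb
    have hs : star (u * a * uᴴ + w * b * wᴴ) = u * aᴴ * uᴴ + w * bᴴ * wᴴ := by
      simp [Matrix.star_eq_conjTranspose, Matrix.mul_assoc]
    rw [Unitary.mem_iff, hs, hmul, hmul, ha, hb, mul_conjTranspose_eq_one_comm ha,
      mul_conjTranspose_eq_one_comm hb]
    simp [hsum]
  -- The complementary factor is the preimage of `H` under extension by the identity on the image of
  -- `q`.
  let φ : IsoGroup 𝕂 (Fin r) → IsoGroup 𝕂 (Fin n) := fun b =>
    ⟨u * (1 : Matrix ι ι 𝕂) * uᴴ + w * b.1 * wᴴ,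
      hunit 1 b (by simp) (Unitary.coe_star_mul_self b)⟩
  let Φ : IsoGroup 𝕂 (Fin r) →* IsoGroup 𝕂 (Fin n) :=
    { toFun := φ
      map_one' := Subtype.ext (by simp [φ, hsum])
      map_mul' := fun a b => Subtype.ext (by
        have := hmul (1 : Matrix ι ι 𝕂) 1 a.1 b.1
        rw [Matrix.one_mul] at this
        exact this.symm) }
  have hΦ : ∀ b, (Φ b : Matrix (Fin n) (Fin n) 𝕂) =
      q + w * b.1 * wᴴ := by
    intro b
    change u * (1 : Matrix ι ι 𝕂) * uᴴ + w * b.1 * wᴴ = _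
    rw [Matrix.mul_one, huq]
  have hzq : ∀ z ∈ Subgroup.centralizer (H : Set (IsoGroup 𝕂 (Fin n))),
      z.1 * q = q * z :=
    fun z hz => mem_doubleCommutant_iff.1 hqH z hz
  -- the compression to the complement of `q`
  have hcompr : ∀ z : Matrix (Fin n) (Fin n) 𝕂, z * q = q * z →
      z = q * z * q + w * (wᴴ * z * w) * wᴴ := by
    intro z hz
    have : w * (wᴴ * z * w) * wᴴ = (w * wᴴ) * z * (w * wᴴ) := by simp only [Matrix.mul_assoc]
    rw [this, hwq, Matrix.mul_assoc, hz, sub_mul, sub_mul, mul_sub, mul_sub, mul_assoc q z q, hz,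
      ← mul_assoc, hq.mul_self]
    rw [← hz]
    simp
  have hcu : ∀ z : Matrix (Fin n) (Fin n) 𝕂, z * q = q * z → zᴴ * z = 1 →
      (wᴴ * z * w)ᴴ * (wᴴ * z * w) = 1 := by
    intro z hz hzz
    have : (wᴴ * z * w)ᴴ * (wᴴ * z * w) = wᴴ * zᴴ * (w * wᴴ) * z * w := by
      simp [Matrix.mul_assoc]
    rw [this, hwq, Matrix.mul_sub, Matrix.sub_mul, Matrix.sub_mul, Matrix.mul_one,
      show wᴴ * zᴴ * q * z * w = wᴴ * zᴴ * (q * z) * w by simp only [Matrix.mul_assoc], ← hz,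
      show wᴴ * zᴴ * (z * q) * w = wᴴ * zᴴ * z * (q * w) by simp only [Matrix.mul_assoc], hqw,
      Matrix.mul_zero, sub_zero, Matrix.mul_assoc wᴴ, hzz, Matrix.mul_one, hww]
  refine ⟨r, e, g, H.comap Φ, ?_, ?_⟩
  -- The complementary factor is Howe: each `z` centralizing `H` commutes with `q`, and its
  -- compression to the complement is unitary and centralizes the factor. Commuting with all these
  -- compressions makes `Φ b` commute with every `z`.
  · refine le_antisymm (fun b hb => ?_) (Subgroup.le_centralizer_iff.1 le_rfl)
    rw [Subgroup.mem_comap, hH.mem_iff, mem_doubleCommutant_iff]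
    intro z hz
    have hzq' := hzq z hz
    have hzz := Unitary.coe_star_mul_self z
    have hz2 := hcu z hzq' hzz
    let z2 : IsoGroup 𝕂 (Fin r) := ⟨wᴴ * z.1 * w,
      Unitary.mem_iff.2 ⟨hz2, mul_conjTranspose_eq_one_comm hz2⟩⟩
    have hmem : z2 ∈ Subgroup.centralizer (H.comap Φ : Set (IsoGroup 𝕂 (Fin r))) := by
      rw [Subgroup.mem_centralizer_iff]
      intro b' hb'
      have h3 : z.1 * Φ b' = Φ b' * z :=
        mem_doubleCommutant_iff.1 ((hH.mem_iff _).1 hb') z hz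
      rw [hΦ] at h3
      apply Subtype.ext
      have h4 := congrArg (fun x => wᴴ * x * w) h3
      simp only [Matrix.mul_add, Matrix.add_mul, hzq'] at h4
      have h5 : wᴴ * (q * z.1) * w = 0 := by
        rw [← Matrix.mul_assoc, hwq', Matrix.zero_mul, Matrix.zero_mul]
      rw [h5, zero_add, zero_add] at h4
      have h6 : wᴴ * (z.1 *
          (w * b'.1 * wᴴ)) * w =
          wᴴ * z.1 * w * b'.1 * (wᴴ * w) := by
        simp only [Matrix.mul_assoc]
      have h7 : wᴴ * (w * b'.1 * wᴴ *
          z.1) * w =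
          (wᴴ * w) * b'.1 * (wᴴ * z.1 * w) := by
        simp only [Matrix.mul_assoc]
      rw [h6, h7, hww, Matrix.mul_one, Matrix.one_mul] at h4
      exact h4.symm
    have h3 : (z2 : Matrix (Fin r) (Fin r) 𝕂) * b = b * z2 :=
      congrArg Subtype.val (Subgroup.mem_centralizer_iff.1 hb z2 hmem)
    rw [hΦ, Matrix.mul_add, Matrix.add_mul, hzq']
    congr 1
    conv_lhs => rw [hcompr z hzq']
    conv_rhs => rw [hcompr z hzq']
    have h8 : q * z.1 * q *
        (w * b.1 * wᴴ) = 0 := by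
      rw [show q * z.1 * q *
        (w * b.1 * wᴴ) = q * z.1 * (q * w) * b.1 * wᴴ by
          simp only [Matrix.mul_assoc], hqw]
      simp
    have h9 : (w * b.1 * wᴴ) *
        (q * z.1 * q) = 0 := by
      rw [show (w * b.1 * wᴴ) *
        (q * z.1 * q) = w * b.1 * (wᴴ * q) * z.1 * q by
          simp only [Matrix.mul_assoc], hwq']
      simp
    rw [Matrix.add_mul, Matrix.mul_add, h8, h9, hmulw, hmulw]
    congr 3
  · intro h
    simp only [hg]
    constructor
    · intro hh
      have hA := (hH.mem_iff h).1 hh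
      have hqh := (hcomm _ hA).symm
      have hh1 : h.1ᴴ * h = 1 := Unitary.coe_star_mul_self h
      have hb := hcu _ hqh hh1
      have hqhq : u * (uᴴ * h.1 * u) * uᴴ = q * h.1 * q := by
        rw [← huq]; simp only [Matrix.mul_assoc]
      have hdecomp : h.1 =
          u * (uᴴ * h.1 * u) * uᴴ +
            w * (wᴴ * h.1 * w) * wᴴ := by
        rw [hqhq]; exact hcompr _ hqh
      have hqhqA : q * h.1 * q ∈ doubleCommutant H :=
        mul_mem (mul_mem hqH hA) hqH
      refine ⟨uᴴ * h.1 * u, (hS _).2 ⟨?_, by rwa [hqhq]⟩,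
        ⟨_, Unitary.mem_iff.2 ⟨hb, mul_conjTranspose_eq_one_comm hb⟩⟩, ?_, hdecomp⟩
      · have : (uᴴ * h.1 * u)ᴴ *
            (uᴴ * h.1 * u) =
            uᴴ * h.1ᴴ * ((u * uᴴ) * h.1) * u := by
          simp [Matrix.mul_assoc]
        rw [this, huq, ← hqh]
        rw [show uᴴ * h.1ᴴ * (h.1 * q) * u =
          uᴴ * (h.1ᴴ * h.1) * (q * u) by
            simp only [Matrix.mul_assoc], hh1, hqu, Matrix.mul_one, huu]
      · rw [Subgroup.mem_comap, hH.mem_iff, hΦ]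
        refine add_mem hqH ?_
        change w * (wᴴ * h.1 * w) * wᴴ ∈ doubleCommutant H
        have : w * (wᴴ * h.1 * w) * wᴴ = h.1 - q * h.1 * q :=
          eq_sub_of_add_eq' (hcompr _ hqh).symm
        rw [this]
        exact sub_mem hA hqhqA
    · rintro ⟨a, ha, b, hb, hh⟩
      obtain ⟨ha1, ha2⟩ := (hS a).1 ha
      rw [hH.mem_iff, hh]
      refine add_mem ha2 ?_
      have hb' := (hH.mem_iff _).1 (Subgroup.mem_comap.1 hb)
      rw [hΦ] at hb'
      simpa using sub_mem hb' hqH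

end DirectFactor

/-! ### From summands of the algebra to forbidden factors of the group. -/

section ForbiddenFactors

variable {𝕂 : Type*} [NormedRing 𝕂] [StarRing 𝕂] [NormedAlgebra ℝ 𝕂] [HermitianScalars 𝕂]
  {n : ℕ}

omit [HermitianScalars 𝕂] [StarRing 𝕂] in
theorem mem_orthFactor_one_iff {k : ℕ} (A : Matrix (Fin 1 × Fin k) (Fin 1 × Fin k) 𝕂) :
    A ∈ orthFactor 𝕂 1 k ↔ ∃ x : ℝ, x * x = 1 ∧ A = x • 1 := by
  have hkey : ∀ x : ℝ, (Matrix.of fun _ _ => x : Matrix (Fin 1) (Fin 1) ℝ).map (algebraMap ℝ 𝕂) ⊗ₖ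
      (1 : Matrix (Fin k) (Fin k) 𝕂) = x • 1 := by
    intro x
    ext ⟨i, p⟩ ⟨j, q⟩
    have : i = j := Subsingleton.elim _ _
    subst this
    by_cases hpq : p = q
    · subst hpq; simp [Matrix.kroneckerMap_apply, Algebra.algebraMap_eq_smul_one]
    · simp [Matrix.kroneckerMap_apply, hpq]
  constructor
  · rintro ⟨a, rfl⟩
    refine ⟨a.1 0 0, ?_, ?_⟩
    · have := congrFun (congrFun (Unitary.coe_star_mul_self a) 0) 0
      simpa [Matrix.mul_apply] using this
    · rw [← hkey]
      congr 2
      ext i j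
      rw [Subsingleton.elim i 0, Subsingleton.elim j 0]
      rfl
  · rintro ⟨x, hx, rfl⟩
    refine ⟨⟨Matrix.of fun _ _ => x, ?_⟩, (hkey x).symm⟩
    rw [Unitary.mem_iff]
    constructor <;> ext i j <;> rw [Subsingleton.elim i 0, Subsingleton.elim j 0] <;>
      simpa [Matrix.mul_apply] using hx

theorem exists_frame_prod {e : Matrix (Fin n) (Fin n) 𝕂} (he : IsProj e) (he0 : e ≠ 0) :
    ∃ k : ℕ, 1 ≤ k ∧ ∃ u : Matrix (Fin n) (Fin k) 𝕂, uᴴ * u = 1 ∧ u * uᴴ = e := by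
  obtain ⟨k, u, hu, hue⟩ := exists_frame he
  refine ⟨k, ?_, u, hu, hue⟩
  rw [Nat.one_le_iff_ne_zero]
  rintro rfl
  apply he0
  rw [← hue]
  ext i j
  simp [Matrix.mul_apply]

omit [HermitianScalars 𝕂] [StarRing 𝕂] in
theorem real_smul_one_injective [Nontrivial 𝕂] {ι : Type*} [DecidableEq ι] [Nonempty ι] {x y : ℝ}
    (h : x • (1 : Matrix ι ι 𝕂) = y • 1) : x = y := by
  obtain ⟨i⟩ := ‹Nonempty ι›
  have := congrFun (congrFun h i) i
  simpa using this

theorem IsProj.coe {A : StarSubalgebra ℝ (Matrix (Fin n) (Fin n) 𝕂)} {e : A} (he : IsProj e) :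
    IsProj (e : Matrix (Fin n) (Fin n) 𝕂) :=
  ⟨congrArg Subtype.val he.star_eq, congrArg Subtype.val he.mul_self⟩

/-- In frames of `e` and `f` side by side, the part of the algebra under the central projection `e +
f` consists of the matrices `diag (x, y)` with real scalars `x`, `y`; the unitary ones have `x² = y²
= 1`. -/
theorem hasDoubleFactorO1_of_blocks {H : Subgroup (IsoGroup 𝕂 (Fin n))} (hH : IsHowe H)
    {e f : doubleCommutant H} (he : IsRealBlock e) (hf : IsRealBlock f) (hef : e * f = 0) :
    HasDoubleFactorO1 H := by
  have hfe : f * e = 0 := by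
    simpa [he.proj.star_eq, hf.proj.star_eq] using congrArg star hef
  obtain ⟨k, hk, u', hu', hue'⟩ := exists_frame_prod he.proj.coe
    (fun h => he.ne_zero (Subtype.ext h))
  obtain ⟨l, hl, w', hw', hwf'⟩ := exists_frame_prod hf.proj.coe
    (fun h => hf.ne_zero (Subtype.ext h))
  have hre : ∀ (k : ℕ) (u' : Matrix (Fin n) (Fin k) 𝕂), u'ᴴ * u' = 1 →
      ∃ u : Matrix (Fin n) (Fin 1 × Fin k) 𝕂, uᴴ * u = 1 ∧ u * uᴴ = u' * u'ᴴ := by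
    intro k u' hu'
    refine ⟨u'.submatrix id (Equiv.uniqueProd (Fin k) (Fin 1)), ?_, ?_⟩
    · rw [Matrix.conjTranspose_submatrix, ← Matrix.submatrix_mul _ _ _ _ _ Function.bijective_id,
        hu', Matrix.submatrix_one_equiv]
    · rw [Matrix.conjTranspose_submatrix, Matrix.submatrix_mul_equiv, Matrix.submatrix_id_id]
  obtain ⟨u, hu, hue⟩ := hre k u' hu'
  obtain ⟨w, hw, hwf⟩ := hre l w' hw'
  rw [hue'] at hue
  rw [hwf'] at hwf
  have hef' : (e : Matrix (Fin n) (Fin n) 𝕂) * f = 0 := congrArg Subtype.val hef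
  have heu : (e : Matrix (Fin n) (Fin n) 𝕂) * u = u := by
    rw [← hue, Matrix.mul_assoc, hu, Matrix.mul_one]
  have hue2 : uᴴ * (e : Matrix (Fin n) (Fin n) 𝕂) = uᴴ := by
    rw [← hue, ← Matrix.mul_assoc, hu, Matrix.one_mul]
  have hfw : (f : Matrix (Fin n) (Fin n) 𝕂) * w = w := by
    rw [← hwf, Matrix.mul_assoc, hw, Matrix.mul_one]
  have huw : uᴴ * w = 0 := by
    rw [← hue2, ← hfw, Matrix.mul_assoc, ← Matrix.mul_assoc e.1, hef']
    simp
  have hwu : wᴴ * u = 0 := by simpa using congrArg Matrix.conjTranspose huw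
  refine ⟨k, l, hk, hl, ?_⟩
  have hU : (Matrix.fromCols u w)ᴴ * Matrix.fromCols u w = 1 := by
    rw [Matrix.conjTranspose_fromCols_eq_fromRows_conjTranspose, Matrix.fromRows_mul_fromCols,
      hu, huw, hwu, hw, Matrix.fromBlocks_one]
  have hU' : Matrix.fromCols u w * (Matrix.fromCols u w)ᴴ = (e + f : doubleCommutant H).1 := by
    rw [Matrix.conjTranspose_fromCols_eq_fromRows_conjTranspose, Matrix.fromCols_mul_fromRows,
      hue, hwf]
    rfl
  have hadd : ∀ x y : ℝ, Matrix.fromCols u w * (Matrix.fromBlocks (x • 1) 0 0 (y • 1) :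
        Matrix ((Fin 1 × Fin k) ⊕ (Fin 1 × Fin l)) ((Fin 1 × Fin k) ⊕ (Fin 1 × Fin l)) 𝕂) *
      (Matrix.fromCols u w)ᴴ = (x • e + y • f : doubleCommutant H).1 := by
    intro x y
    rw [Matrix.conjTranspose_fromCols_eq_fromRows_conjTranspose, Matrix.fromCols_mul_fromBlocks,
      Matrix.fromCols_mul_fromRows]
    simp [hue, hwf]
  have : Nonempty (Fin 1 × Fin k) := ⟨(0, ⟨0, hk⟩)⟩
  have : Nonempty (Fin 1 × Fin l) := ⟨(0, ⟨0, hl⟩)⟩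
  have hproj : IsProj (e + f) :=
    ⟨by simp [he.proj.star_eq, hf.proj.star_eq], by
      rw [add_mul, mul_add, mul_add, hef, hfe, he.proj.mul_self, hf.proj.mul_self]; simp⟩
  refine hasDirectFactor_of_frame hH (q := (e + f : doubleCommutant H).1) hproj.coe
    (e + f : doubleCommutant H).2 (fun a ha => ?_) hU hU' (fun a => ?_)
  · have := congrArg₂ (· + ·) (he.comm ⟨a, ha⟩) (hf.comm ⟨a, ha⟩)
    simp only [← add_mul, ← mul_add] at this
    exact congrArg Subtype.val this
  · have hone : ∀ x y : ℝ, (Matrix.fromBlocks (x • 1) 0 0 (y • 1) :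
        Matrix ((Fin 1 × Fin k) ⊕ (Fin 1 × Fin l)) ((Fin 1 × Fin k) ⊕ (Fin 1 × Fin l)) 𝕂)ᴴ *
        Matrix.fromBlocks (x • 1) 0 0 (y • 1) =
        Matrix.fromBlocks ((x * x) • 1) 0 0 ((y * y) • 1) := by
      intro x y
      rw [Matrix.fromBlocks_conjTranspose, Matrix.fromBlocks_multiply]
      simp [Matrix.conjTranspose_smul, smul_smul]
    constructor
    · rintro ⟨a, ha, b, hb, rfl⟩
      obtain ⟨x, hx, rfl⟩ := (mem_orthFactor_one_iff a).1 ha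
      obtain ⟨y, hy, rfl⟩ := (mem_orthFactor_one_iff b).1 hb
      refine ⟨?_, ?_⟩
      · rw [hone, hx, hy, one_smul, one_smul, Matrix.fromBlocks_one]
      · rw [hadd]; exact SetLike.coe_mem _
    · rintro ⟨ha, haA⟩
      obtain ⟨x, hx⟩ := he.span ⟨_, haA⟩
      obtain ⟨y, hy⟩ := hf.span ⟨_, haA⟩
      have h1 : Matrix.fromCols u w * a * (Matrix.fromCols u w)ᴴ =
          (x • e + y • f : doubleCommutant H).1 := by
        rw [← hx, ← hy, ← add_mul]
        change _ = (e + f : doubleCommutant H).1 * _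
        rw [← hU']
        simp only [← Matrix.mul_assoc]
        rw [Matrix.mul_assoc (Matrix.fromCols u w) _ (Matrix.fromCols u w), hU, Matrix.mul_one]
      have h2 : a = Matrix.fromBlocks (x • 1) 0 0 (y • 1) := by
        rw [← hadd] at h1
        have h3 := congrArg (fun t => (Matrix.fromCols u w)ᴴ * t * Matrix.fromCols u w) h1
        simp only [Matrix.mul_assoc, hU, Matrix.mul_one] at h3
        simpa only [← Matrix.mul_assoc, hU, Matrix.one_mul] using h3
      rw [h2, hone, ← Matrix.fromBlocks_one, Matrix.fromBlocks_inj] at ha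
      refine ⟨x • 1, (mem_orthFactor_one_iff _).2 ⟨x, ?_, rfl⟩, y • 1,
        (mem_orthFactor_one_iff _).2 ⟨y, ?_, rfl⟩, h2⟩
      · exact real_smul_one_injective (𝕂 := 𝕂) (ha.1.trans (one_smul ℝ _).symm)
      · exact real_smul_one_injective (𝕂 := 𝕂) (ha.2.2.2.trans (one_smul ℝ _).symm)

/-- Two frames of equal size, side by side. -/
def pairFrame {k : ℕ} (u w : Matrix (Fin n) (Fin k) 𝕂) : Matrix (Fin n) (Fin 2 × Fin k) 𝕂 :=
  Matrix.of fun i p => if p.1 = 0 then u i p.2 else w i p.2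

omit [HermitianScalars 𝕂] in
-- In the paired frame, `M ⊗ 1` is the combination of the four matrix units `u uᴴ`, `u wᴴ`, `w uᴴ`,
-- `w wᴴ` with the entries of `M` as coefficients.
theorem pairFrame_mul_kronecker {k : ℕ} (u w : Matrix (Fin n) (Fin k) 𝕂)
    (M : Matrix (Fin 2) (Fin 2) ℝ) :
    pairFrame u w * (M.map (algebraMap ℝ 𝕂) ⊗ₖ (1 : Matrix (Fin k) (Fin k) 𝕂)) *
      (pairFrame u w)ᴴ =
      M 0 0 • (u * uᴴ) + M 0 1 • (u * wᴴ) + M 1 0 • (w * uᴴ) + M 1 1 • (w * wᴴ) := by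
  have h1 : pairFrame u w * (M.map (algebraMap ℝ 𝕂) ⊗ₖ (1 : Matrix (Fin k) (Fin k) 𝕂)) =
      pairFrame (M 0 0 • u + M 1 0 • w) (M 0 1 • u + M 1 1 • w) := by
    ext i ⟨b, q⟩
    fin_cases b <;>
    simp [pairFrame, Matrix.mul_apply, Fintype.sum_prod_type, Fin.sum_univ_two, Matrix.one_apply,
      Algebra.smul_def, Algebra.commutes]
  have h2 : ∀ u' w' : Matrix (Fin n) (Fin k) 𝕂, pairFrame u' w' * (pairFrame u w)ᴴ =
      u' * uᴴ + w' * wᴴ := by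
    intro u' w'
    ext i j
    simp [pairFrame, Matrix.mul_apply, Fintype.sum_prod_type, Fin.sum_univ_two]
  rw [h1, h2]
  simp only [Matrix.add_mul, Matrix.smul_mul]
  abel

omit [HermitianScalars 𝕂] [NormedAlgebra ℝ 𝕂] in
theorem pairFrame_conjTranspose_mul {k : ℕ} {u w : Matrix (Fin n) (Fin k) 𝕂} (hu : uᴴ * u = 1)
    (hw : wᴴ * w = 1) (huw : uᴴ * w = 0) (hwu : wᴴ * u = 0) :
    (pairFrame u w)ᴴ * pairFrame u w = 1 := by
  ext ⟨a, p⟩ ⟨b, q⟩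
  have e1 := congrFun (congrFun hu p) q
  have e2 := congrFun (congrFun hw p) q
  have e3 := congrFun (congrFun huw p) q
  have e4 := congrFun (congrFun hwu p) q
  simp only [Matrix.mul_apply, Matrix.conjTranspose_apply, Matrix.zero_apply] at e1 e2 e3 e4
  fin_cases a <;> fin_cases b <;>
    simp [pairFrame, Matrix.mul_apply, e1, e2, e3, e4, Matrix.one_apply]

/-- The frame of `f` is not chosen freely but transported from the frame `u` of `e` by `v*`. Then
`e`, `v`, `v*`, `f` become the matrix units of the paired frame, and the summand becomes all `M ⊗
1_k` with `M` real. -/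
theorem hasFactorO2_of_block {H : Subgroup (IsoGroup 𝕂 (Fin n))} (hH : IsHowe H)
    {e f v : doubleCommutant H} (hb : IsMatrixTwoBlock e f v) : HasFactorO2 H := by
  have hfe : f * e = 0 := by
    simpa [hb.proj₁.star_eq, hb.proj₂.star_eq] using congrArg star hb.orth
  obtain ⟨k, hk, u, hu, hue⟩ := exists_frame_prod hb.proj₁.coe
    (fun h => hb.ne_zero (Subtype.ext h))
  have hvs := hb.iso.symm hb.proj₁ hb.proj₂
  have hv1 : e.1 * v.1 = v.1 := congrArg Subtype.val hb.iso.left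
  have hv2 : v.1 * v.1ᴴ = e.1 := congrArg Subtype.val hb.iso.mul_star
  have hv3 : v.1ᴴ * v.1 = f.1 := congrArg Subtype.val hb.iso.star_mul
  have hv4 : v.1ᴴ * e.1 = v.1ᴴ := congrArg Subtype.val hvs.right
  have hv5 : v.1 * f.1 = v.1 := congrArg Subtype.val hb.iso.right
  have hef : e.1 * f.1 = 0 := congrArg Subtype.val hb.orth
  have heu : e.1 * u = u := by rw [← hue, Matrix.mul_assoc, hu, Matrix.mul_one]
  have hue2 : uᴴ * e.1 = uᴴ := by rw [← hue, ← Matrix.mul_assoc, hu, Matrix.one_mul]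
  set w := v.1ᴴ * u with hw
  have hws : wᴴ = uᴴ * v.1 := by simp [hw]
  have hww : wᴴ * w = 1 := by
    rw [hws, hw, Matrix.mul_assoc, ← Matrix.mul_assoc v.1, hv2, heu, hu]
  have hfw : f.1 * w = w := by
    rw [hw, ← Matrix.mul_assoc, ← hv3, Matrix.mul_assoc v.1ᴴ, hv2, hv4]
  have huw : uᴴ * w = 0 := by
    rw [← hue2, ← hfw, Matrix.mul_assoc, ← Matrix.mul_assoc e.1, hef]
    simp
  have hwu : wᴴ * u = 0 := by simpa using congrArg Matrix.conjTranspose huw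
  have h12 : u * wᴴ = v.1 := by rw [hws, ← Matrix.mul_assoc, hue, hv1]
  have h21 : w * uᴴ = v.1ᴴ := by rw [hw, Matrix.mul_assoc, hue, hv4]
  have h22 : w * wᴴ = f.1 := by rw [hws, ← Matrix.mul_assoc, h21, hv3]
  set U := pairFrame u w with hUdef
  have hU : Uᴴ * U = 1 := pairFrame_conjTranspose_mul hu hww huw hwu
  have hform : ∀ M : Matrix (Fin 2) (Fin 2) ℝ,
      U * (M.map (algebraMap ℝ 𝕂) ⊗ₖ (1 : Matrix (Fin k) (Fin k) 𝕂)) * Uᴴ =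
        (M 0 0 • e + M 0 1 • v + M 1 0 • star v + M 1 1 • f : doubleCommutant H).1 := by
    intro M
    rw [hUdef, pairFrame_mul_kronecker, hue, h12, h21, h22]
    rfl
  have hU' : U * Uᴴ = (e + f : doubleCommutant H).1 := by
    have := hform 1
    simpa using this
  have hkron : ∀ M N : Matrix (Fin 2) (Fin 2) ℝ,
      (M.map (algebraMap ℝ 𝕂) ⊗ₖ (1 : Matrix (Fin k) (Fin k) 𝕂))ᴴ *
        (N.map (algebraMap ℝ 𝕂) ⊗ₖ (1 : Matrix (Fin k) (Fin k) 𝕂)) =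
        ((Mᴴ * N).map (algebraMap ℝ 𝕂) ⊗ₖ (1 : Matrix (Fin k) (Fin k) 𝕂)) := by
    intro M N
    have hc : (M.map (algebraMap ℝ 𝕂) ⊗ₖ (1 : Matrix (Fin k) (Fin k) 𝕂))ᴴ =
        Mᴴ.map (algebraMap ℝ 𝕂) ⊗ₖ (1 : Matrix (Fin k) (Fin k) 𝕂) := by
      ext ⟨a, p⟩ ⟨b, q⟩
      by_cases hpq : p = q
      · subst hpq
        simp [Matrix.kroneckerMap_apply, ← algebraMap_star_comm]
      · simp [Matrix.kroneckerMap_apply, hpq, Ne.symm hpq]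
    rw [hc]
    ext ⟨a, p⟩ ⟨b, q⟩
    simp [Matrix.mul_apply, Matrix.kroneckerMap_apply, Fintype.sum_prod_type, Matrix.one_apply]
  have hproj : IsProj (e + f) :=
    ⟨by simp [hb.proj₁.star_eq, hb.proj₂.star_eq], by
      rw [add_mul, mul_add, mul_add, hb.orth, hfe, hb.proj₁.mul_self, hb.proj₂.mul_self]; simp⟩
  refine ⟨k, hk, hasDirectFactor_of_frame hH (q := (e + f : doubleCommutant H).1) hproj.coe
    (e + f : doubleCommutant H).2 (fun a ha => congrArg Subtype.val (hb.comm ⟨a, ha⟩)) hU hU'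
    (fun a => ?_)⟩
  constructor
  · rintro ⟨M, rfl⟩
    refine ⟨?_, ?_⟩
    · rw [hkron, ← Matrix.star_eq_conjTranspose, Unitary.coe_star_mul_self]
      simp
    · rw [hform]; exact SetLike.coe_mem _
  · rintro ⟨ha, haA⟩
    obtain ⟨α, β, γ, δ, hspan⟩ := hb.span ⟨_, haA⟩
    set M : Matrix (Fin 2) (Fin 2) ℝ := !![α, β; γ, δ] with hM
    have h1 : U * a * Uᴴ = U * (M.map (algebraMap ℝ 𝕂) ⊗ₖ (1 : Matrix (Fin k) (Fin k) 𝕂)) * Uᴴ := by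
      rw [hform]
      have : (M 0 0 • e + M 0 1 • v + M 1 0 • star v + M 1 1 • f : doubleCommutant H) =
          (e + f) * ⟨_, haA⟩ := by rw [hspan]; simp [hM]
      rw [this]
      change _ = (e + f : doubleCommutant H).1 * _
      rw [← hU']
      simp only [← Matrix.mul_assoc]
      rw [Matrix.mul_assoc U _ U, hU, Matrix.mul_one]
    have h2 : a = M.map (algebraMap ℝ 𝕂) ⊗ₖ (1 : Matrix (Fin k) (Fin k) 𝕂) := by
      have h3 := congrArg (fun t => Uᴴ * t * U) h1
      simp only [Matrix.mul_assoc, hU, Matrix.mul_one] at h3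
      simpa only [← Matrix.mul_assoc, hU, Matrix.one_mul] using h3
    have h4 : Mᴴ * M = 1 := by
      rw [h2, hkron] at ha
      ext i j
      have := congrFun (congrFun ha (i, ⟨0, hk⟩)) (j, ⟨0, hk⟩)
      rw [Matrix.kroneckerMap_apply, Matrix.one_apply_eq, mul_one, Matrix.map_apply] at this
      apply FaithfulSMul.algebraMap_injective ℝ 𝕂
      rw [this]
      by_cases hij : i = j <;> simp [Matrix.one_apply, hij]
    exact ⟨⟨M, Unitary.mem_iff.2 ⟨h4, mul_conjTranspose_eq_one_comm h4⟩⟩, h2⟩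

/-- If `H` has none of the forbidden factors, then its double commutant is generated by its Lie
algebra. -/
theorem commute_of_commute_skew {H : Subgroup (IsoGroup 𝕂 (Fin n))} (hH : IsHowe H)
    (h₂ : ¬ HasFactorO2 H) (h₁ : ¬ HasDoubleFactorO1 H) {z : Matrix (Fin n) (Fin n) 𝕂}
    (hz : ∀ X ∈ doubleCommutant H, star X = -X → z * X = X * z) :
    ∀ X ∈ doubleCommutant H, z * X = X * z := by
  -- The elements commuting with `z` form a subalgebra containing the skew elements, so the
  -- generation theorem applies to it.
  let B : Subalgebra ℝ (doubleCommutant H) :=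
    (Subalgebra.centralizer ℝ {z}).comap (doubleCommutant H).subtype.toAlgHom
  have hmem : ∀ X : doubleCommutant H, X ∈ B ↔ z * X.1 = X.1 * z := by
    intro X
    rw [Subalgebra.mem_comap, Subalgebra.mem_centralizer_iff]
    simp
  have hp : IsProper (doubleCommutant H) := fun a b h =>
    Subtype.ext (isProper_matrix a.1 b.1 (congrArg Subtype.val h))
  have : FiniteDimensional ℝ (doubleCommutant H) :=
    FiniteDimensional.finiteDimensional_submodule
      (Subalgebra.toSubmodule (doubleCommutant H).toSubalgebra)
  rcases eq_top_or_exists_block (B := B) hp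
    (fun a ha => (hmem a).2 (hz a.1 a.2 (congrArg Subtype.val ha))) with h | h | h
  · intro X hX
    exact (hmem ⟨X, hX⟩).1 (h ▸ Algebra.mem_top)
  · obtain ⟨e, f, v, hb⟩ := h
    exact absurd (hasFactorO2_of_block hH hb) h₂
  · obtain ⟨e, f, he, hf, hef⟩ := h
    exact absurd (hasDoubleFactorO1_of_blocks hH he hf hef) h₁

end ForbiddenFactors

/-! ### Forbidden factors give finite nontrivial conjugation orbits. -/

section FiniteOrbits

variable {𝕂 : Type*} [NormedRing 𝕂] [StarRing 𝕂] [NormedAlgebra ℝ 𝕂] [HermitianScalars 𝕂]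
  {n : ℕ}

/-- The conjugates of `J` under `H`. -/
def conjOrbit (H : Subgroup (IsoGroup 𝕂 (Fin n))) (J : IsoGroup 𝕂 (Fin n)) :
    Set (IsoGroup 𝕂 (Fin n)) :=
  {x | ∃ h ∈ H, x = h * J * h⁻¹}

omit [HermitianScalars 𝕂] [NormedAlgebra ℝ 𝕂] in
-- Take `J` to be `j` on the factor and the identity on the complement, conjugated by `g`. The part
-- of `h` in `H'` does not affect `J`, so the orbit has at most two elements, and `a₀` extended by
-- the identity moves `J`.
theorem HasDirectFactor.exists_finite_conjOrbit {H : Subgroup (IsoGroup 𝕂 (Fin n))} {ι : Type*}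
    [Fintype ι] [DecidableEq ι] {S : Set (Matrix ι ι 𝕂)} (hS : HasDirectFactor H S)
    {j j' a₀ : Matrix ι ι 𝕂} (hj : j ∈ unitary (Matrix ι ι 𝕂))
    (ha₀ : a₀ ∈ unitary (Matrix ι ι 𝕂)) (ha₀S : a₀ ∈ S) (hne : a₀ * j ≠ j * a₀)
    (hjj : ∀ a ∈ S, a * j = j * a ∨ a * j = j' * a) :
    ∃ J : IsoGroup 𝕂 (Fin n), (conjOrbit H J).Finite ∧ ∃ h ∈ H, h * J ≠ J * h := by
  obtain ⟨r, e, g, H', -, hH⟩ := hS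
  let R : Matrix ι ι 𝕂 → Matrix (Fin r) (Fin r) 𝕂 → Matrix (Fin n) (Fin n) 𝕂 :=
    fun a b => Matrix.reindex e e (Matrix.fromBlocks a 0 0 b)
  have hRmul : ∀ a a' b b', R a b * R a' b' = R (a * a') (b * b') := by
    intro a a' b b'
    simp [R, Matrix.submatrix_mul_equiv, Matrix.fromBlocks_multiply]
  have hRone : R 1 1 = 1 := by simp [R]
  have hRstar : ∀ a b, (R a b)ᴴ = R aᴴ bᴴ := by
    intro a b
    simp [R, Matrix.fromBlocks_conjTranspose]
  have hRu : ∀ a ∈ unitary (Matrix ι ι 𝕂), R a 1 ∈ unitary (Matrix (Fin n) (Fin n) 𝕂) := by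
    intro a ha
    rw [Unitary.mem_iff] at ha ⊢
    rw [Matrix.star_eq_conjTranspose, hRstar, hRmul, hRmul]
    rw [Matrix.star_eq_conjTranspose] at ha
    rw [ha.1, ha.2]
    simp [hRone]
  have hgg : (g⁻¹ : IsoGroup 𝕂 (Fin n)).1 * g.1 = 1 := congrArg Subtype.val (inv_mul_cancel g)
  let C : Matrix ι ι 𝕂 → Matrix (Fin r) (Fin r) 𝕂 → Matrix (Fin n) (Fin n) 𝕂 :=
    fun a b => g.1 * R a b * (g⁻¹ : IsoGroup 𝕂 (Fin n)).1
  have hCmul : ∀ a a' b b', C a b * C a' b' = C (a * a') (b * b') := by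
    intro a a' b b'
    simp only [C]
    rw [← hRmul, show g.1 * R a b * (g⁻¹ : IsoGroup 𝕂 (Fin n)).1 *
      (g.1 * R a' b' * (g⁻¹ : IsoGroup 𝕂 (Fin n)).1) =
      g.1 * R a b * ((g⁻¹ : IsoGroup 𝕂 (Fin n)).1 * g.1) * R a' b' *
        (g⁻¹ : IsoGroup 𝕂 (Fin n)).1 by simp only [mul_assoc], hgg]
    simp only [mul_assoc, one_mul]
  have hCinj : ∀ a a' b b', C a b = C a' b' → a = a' := by
    intro a a' b b' h
    have h1 := congrArg (fun t => (g⁻¹ : IsoGroup 𝕂 (Fin n)).1 * t * g.1) h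
    simp only [C, mul_assoc, hgg, mul_one] at h1
    simp only [← mul_assoc, hgg, one_mul] at h1
    have h2 := (Matrix.reindex e e).injective h1
    rw [Matrix.fromBlocks_inj] at h2
    exact h2.1
  let E : ∀ a ∈ unitary (Matrix ι ι 𝕂), IsoGroup 𝕂 (Fin n) := fun a ha => g * ⟨R a 1, hRu a ha⟩ * g⁻¹
  have hE : ∀ a ha, (E a ha).1 = C a 1 := fun a ha => rfl
  refine ⟨E j hj, ?_, E a₀ ha₀, ?_, ?_⟩
  · refine Set.Finite.subset (Set.Finite.preimage Subtype.val_injective.injOn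
      (s := {C j 1, C j' 1}) (by simp)) ?_
    rintro _ ⟨h, hh, rfl⟩
    obtain ⟨a, ha, b, hb, hab⟩ := (hH h).1 hh
    have hab' : h.1 = C a b := hab
    have hinv : h.1 * (h⁻¹ : IsoGroup 𝕂 (Fin n)).1 = 1 := congrArg Subtype.val (mul_inv_cancel h)
    have hval : (h * E j hj * h⁻¹ : IsoGroup 𝕂 (Fin n)).1 =
        h.1 * C j 1 * (h⁻¹ : IsoGroup 𝕂 (Fin n)).1 := rfl
    have hkey : ∀ i, a * j = i * a → h.1 * C j 1 = C i 1 * h.1 := by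
      intro i hi
      rw [hab', hCmul, hCmul, hi, mul_one, one_mul]
    rw [Set.mem_preimage, hval]
    rcases hjj a ha with h1 | h1
    · left; rw [hkey _ h1, mul_assoc, hinv, mul_one]
    · right; rw [Set.mem_singleton_iff, hkey _ h1, mul_assoc, hinv, mul_one]
  · exact (hH _).2 ⟨a₀, ha₀S, 1, one_mem _, rfl⟩
  · intro h
    have h1 : C a₀ 1 * C j 1 = C j 1 * C a₀ 1 := congrArg Subtype.val h
    rw [hCmul, hCmul] at h1
    exact hne (hCinj _ _ _ _ h1)

omit [HermitianScalars 𝕂] [StarRing 𝕂] in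
theorem map_kronecker_one_mul {m k : ℕ} (M N : Matrix (Fin m) (Fin m) ℝ) :
    (M.map (algebraMap ℝ 𝕂) ⊗ₖ (1 : Matrix (Fin k) (Fin k) 𝕂)) *
      (N.map (algebraMap ℝ 𝕂) ⊗ₖ (1 : Matrix (Fin k) (Fin k) 𝕂)) =
      ((M * N).map (algebraMap ℝ 𝕂) ⊗ₖ (1 : Matrix (Fin k) (Fin k) 𝕂)) := by
  ext ⟨a, p⟩ ⟨b, q⟩
  simp [Matrix.mul_apply, Matrix.kroneckerMap_apply, Fintype.sum_prod_type, Matrix.one_apply]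

theorem conjTranspose_map_kronecker_one {m k : ℕ} (M : Matrix (Fin m) (Fin m) ℝ) :
    (M.map (algebraMap ℝ 𝕂) ⊗ₖ (1 : Matrix (Fin k) (Fin k) 𝕂))ᴴ =
      Mᴴ.map (algebraMap ℝ 𝕂) ⊗ₖ (1 : Matrix (Fin k) (Fin k) 𝕂) := by
  ext ⟨a, p⟩ ⟨b, q⟩
  by_cases hpq : p = q
  · subst hpq
    simp [Matrix.kroneckerMap_apply, ← algebraMap_star_comm]
  · simp [Matrix.kroneckerMap_apply, hpq, Ne.symm hpq]

theorem map_kronecker_one_mem_unitary {m k : ℕ} {M : Matrix (Fin m) (Fin m) ℝ}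
    (hM : M ∈ unitary (Matrix (Fin m) (Fin m) ℝ)) :
    (M.map (algebraMap ℝ 𝕂) ⊗ₖ (1 : Matrix (Fin k) (Fin k) 𝕂)) ∈
      unitary (Matrix (Fin m × Fin k) (Fin m × Fin k) 𝕂) := by
  rw [Unitary.mem_iff, Matrix.star_eq_conjTranspose] at hM ⊢
  rw [conjTranspose_map_kronecker_one, map_kronecker_one_mul, map_kronecker_one_mul, hM.1, hM.2]
  simp

/-- Conjugation by an orthogonal `M` multiplies the quarter turn by `det M = ±1`. -/
theorem orthogonal_two_mul_rotation {M : Matrix (Fin 2) (Fin 2) ℝ} (hM : Mᴴ * M = 1) :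
    M * !![0, -1; 1, 0] = !![0, -1; 1, 0] * M ∨ M * !![0, -1; 1, 0] = -!![0, -1; 1, 0] * M := by
  have hdet : M.det = 1 ∨ M.det = -1 := by
    have := congrArg Matrix.det hM
    rw [Matrix.det_mul, Matrix.det_conjTranspose, Matrix.det_one] at this
    exact mul_self_eq_one_iff.1 (by simpa using this)
  have h1 : M * !![0, -1; 1, 0] * Mᴴ = M.det • !![0, -1; 1, 0] := by
    ext i j
    fin_cases i <;> fin_cases j <;>
      simp [Matrix.mul_apply, Fin.sum_univ_two, Matrix.det_fin_two] <;> ring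
  have h2 : M * !![0, -1; 1, 0] = M.det • (!![0, -1; 1, 0] * M) := by
    rw [← Matrix.smul_mul, ← h1, Matrix.mul_assoc, hM, Matrix.mul_one]
  rcases hdet with h | h
  · left; rw [h2, h, one_smul]
  · right; rw [h2, h, neg_smul, one_smul, Matrix.neg_mul]

/-- The witness is the quarter turn; reflections reverse it. -/
theorem HasFactorO2.exists_finite_conjOrbit {H : Subgroup (IsoGroup 𝕂 (Fin n))}
    (h : HasFactorO2 H) :
    ∃ J : IsoGroup 𝕂 (Fin n), (conjOrbit H J).Finite ∧ ∃ h ∈ H, h * J ≠ J * h := by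
  obtain ⟨k, hk, hf⟩ := h
  have hrot : !![0, -1; 1, 0] ∈ unitary (Matrix (Fin 2) (Fin 2) ℝ) := by
    rw [Unitary.mem_iff]
    constructor <;> ext i j <;> fin_cases i <;> fin_cases j <;>
      simp [Matrix.mul_apply, Fin.sum_univ_two]
  have hrefl : !![1, 0; 0, -1] ∈ unitary (Matrix (Fin 2) (Fin 2) ℝ) := by
    rw [Unitary.mem_iff]
    constructor <;> ext i j <;> fin_cases i <;> fin_cases j <;>
      simp [Matrix.mul_apply, Fin.sum_univ_two]
  refine hf.exists_finite_conjOrbit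
    (j' := (-!![0, -1; 1, 0] : Matrix (Fin 2) (Fin 2) ℝ).map (algebraMap ℝ 𝕂) ⊗ₖ
      (1 : Matrix (Fin k) (Fin k) 𝕂))
    (map_kronecker_one_mem_unitary hrot) (map_kronecker_one_mem_unitary hrefl)
    ⟨⟨_, hrefl⟩, rfl⟩ ?_ ?_
  · rw [map_kronecker_one_mul, map_kronecker_one_mul]
    intro h
    have := congrFun (congrFun h (0, ⟨0, hk⟩)) (1, ⟨0, hk⟩)
    simp only [Matrix.kroneckerMap_apply, Matrix.map_apply, Matrix.one_apply_eq, mul_one] at this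
    have := FaithfulSMul.algebraMap_injective ℝ 𝕂 this
    simp [Matrix.mul_apply, Fin.sum_univ_two] at this
    norm_num at this
  · rintro _ ⟨M, rfl⟩
    rw [map_kronecker_one_mul, map_kronecker_one_mul, map_kronecker_one_mul]
    exact (orthogonal_two_mul_rotation (Unitary.coe_star_mul_self M)).imp
      (fun h => by rw [h]) (fun h => by rw [h])

/-- The witness swaps one basis vector of the first block with one of the second and fixes the
others. Conjugation by `(x, y)` multiplies its off-diagonal entries by `x y = ±1`, so `j 1` and `j
(-1)` are its only conjugates. -/
theorem HasDoubleFactorO1.exists_finite_conjOrbit {H : Subgroup (IsoGroup 𝕂 (Fin n))}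
    (h : HasDoubleFactorO1 H) :
    ∃ J : IsoGroup 𝕂 (Fin n), (conjOrbit H J).Finite ∧ ∃ h ∈ H, h * J ≠ J * h := by
  obtain ⟨k, l, hk, hl, hf⟩ := h
  let p : Fin 1 × Fin k := (0, ⟨0, hk⟩)
  let q : Fin 1 × Fin l := (0, ⟨0, hl⟩)
  let j : ℝ → Matrix ((Fin 1 × Fin k) ⊕ (Fin 1 × Fin l)) ((Fin 1 × Fin k) ⊕ (Fin 1 × Fin l)) 𝕂 :=
    fun t => Matrix.fromBlocks (1 - Matrix.single p p 1) (t • Matrix.single p q 1)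
      (t • Matrix.single q p 1) (1 - Matrix.single q q 1)
  have hjs : (j 1)ᴴ = j 1 := by
    simp [j, Matrix.fromBlocks_conjTranspose, Matrix.conjTranspose_single]
  have hjj : j 1 * j 1 = 1 := by
    simp only [j, one_smul]
    rw [Matrix.fromBlocks_multiply]
    simp [sub_mul, mul_sub, Matrix.sub_mul, Matrix.mul_sub]
  have hcomm : ∀ x y t : ℝ, (Matrix.fromBlocks (x • 1) 0 0 (y • 1) :
      Matrix ((Fin 1 × Fin k) ⊕ (Fin 1 × Fin l)) ((Fin 1 × Fin k) ⊕ (Fin 1 × Fin l)) 𝕂) * j t =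
      Matrix.fromBlocks (x • (1 - Matrix.single p p 1)) ((x * t) • Matrix.single p q 1)
        ((y * t) • Matrix.single q p 1) (y • (1 - Matrix.single q q 1)) := by
    intro x y t
    simp only [j]
    rw [Matrix.fromBlocks_multiply]
    simp [smul_smul]
  have hcomm' : ∀ x y t : ℝ, j t * (Matrix.fromBlocks (x • 1) 0 0 (y • 1) :
      Matrix ((Fin 1 × Fin k) ⊕ (Fin 1 × Fin l)) ((Fin 1 × Fin k) ⊕ (Fin 1 × Fin l)) 𝕂) =
      Matrix.fromBlocks (x • (1 - Matrix.single p p 1)) ((y * t) • Matrix.single p q 1)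
        ((x * t) • Matrix.single q p 1) (y • (1 - Matrix.single q q 1)) := by
    intro x y t
    simp only [j]
    rw [Matrix.fromBlocks_multiply]
    simp [smul_smul]
  refine hf.exists_finite_conjOrbit (j := j 1) (j' := j (-1))
    (a₀ := Matrix.fromBlocks ((1 : ℝ) • 1) 0 0 ((-1 : ℝ) • 1)) ?_ ?_ ?_ ?_ ?_
  · rw [Unitary.mem_iff, Matrix.star_eq_conjTranspose, hjs]
    exact ⟨hjj, hjj⟩
  · rw [Unitary.mem_iff, Matrix.star_eq_conjTranspose, Matrix.fromBlocks_conjTranspose]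
    simp [Matrix.fromBlocks_multiply]
  · exact ⟨_, (mem_orthFactor_one_iff _).2 ⟨1, by norm_num, rfl⟩, _,
      (mem_orthFactor_one_iff _).2 ⟨-1, by norm_num, rfl⟩, rfl⟩
  · rw [hcomm, hcomm', ne_eq, Matrix.fromBlocks_inj]
    rintro ⟨-, h, -⟩
    have := congrFun (congrFun h p) q
    simp only [Matrix.smul_apply, Matrix.single_apply_same] at this
    rw [← sub_eq_zero, ← sub_smul, smul_eq_zero] at this
    norm_num at this
  · rintro _ ⟨a, ha, b, hb, rfl⟩
    obtain ⟨x, hx, rfl⟩ := (mem_orthFactor_one_iff a).1 ha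
    obtain ⟨y, hy, rfl⟩ := (mem_orthFactor_one_iff b).1 hb
    rw [hcomm, hcomm', hcomm']
    rcases mul_self_eq_one_iff.1 hx with rfl | rfl <;>
      rcases mul_self_eq_one_iff.1 hy with rfl | rfl <;> simp

end FiniteOrbits

noncomputable section

/-! ### Calculus of smooth matrix-valued functions on manifolds. -/

section SmoothMatrixFunctions

variable {𝕂 : Type*} [NormedRing 𝕂] [StarRing 𝕂] [NormedAlgebra ℝ 𝕂] [HermitianScalars 𝕂]
  {n : ℕ}
  {E : Type*} [NormedAddCommGroup E] [NormedSpace ℝ E] {H : Type*} [TopologicalSpace H]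
  {I : ModelWithCorners ℝ E H} {N : Type*} [TopologicalSpace N] [ChartedSpace H N]

/-- The involution as a continuous real linear map. -/
def starCLM (𝕂 : Type*) [NormedRing 𝕂] [StarRing 𝕂] [NormedAlgebra ℝ 𝕂] [HermitianScalars 𝕂] :
    𝕂 →L[ℝ] 𝕂 :=
  ((starL' ℝ : 𝕂 ≃L[ℝ] 𝕂) : 𝕂 →L[ℝ] 𝕂)

/-- A matrix-valued function is smooth on `W` if its entries are. -/
def MatSmoothOn (I : ModelWithCorners ℝ E H) (F : N → Matrix (Fin n) (Fin n) 𝕂) (W : Set N) :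
    Prop :=
  ∀ i j, ContMDiffOn I 𝓘(ℝ, 𝕂) ∞ (fun x => F x i j) W

variable {F G : N → Matrix (Fin n) (Fin n) 𝕂} {W : Set N}

omit [StarRing 𝕂] [HermitianScalars 𝕂] in
theorem MatSmoothOn.sub (hF : MatSmoothOn I F W) (hG : MatSmoothOn I G W) :
    MatSmoothOn I (fun x => F x - G x) W :=
  fun i j => (hF i j).sub (hG i j)

omit [StarRing 𝕂] [HermitianScalars 𝕂] in
theorem MatSmoothOn.sum {ι : Type*} {s : Finset ι} {F : ι → N → Matrix (Fin n) (Fin n) 𝕂}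
    (hF : ∀ i ∈ s, MatSmoothOn I (F i) W) : MatSmoothOn I (fun x => ∑ i ∈ s, F i x) W := by
  intro i j
  simp only [Matrix.sum_apply]
  exact contMDiffOn_finsetSum fun k hk => hF k hk i j

omit [StarRing 𝕂] [HermitianScalars 𝕂] in
theorem MatSmoothOn.mul (hF : MatSmoothOn I F W) (hG : MatSmoothOn I G W) :
    MatSmoothOn I (fun x => F x * G x) W := by
  intro i j
  simp only [Matrix.mul_apply]
  refine contMDiffOn_finsetSum fun k _ => ?_
  exact (contDiff_mul (𝕜 := ℝ) (𝔸 := 𝕂)).contMDiff.comp_contMDiffOn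
    ((hF i k).prodMk_space (hG k j))

theorem MatSmoothOn.star (hF : MatSmoothOn I F W) : MatSmoothOn I (fun x => (F x)ᴴ) W :=
  fun i j => (starCLM 𝕂).contMDiff.comp_contMDiffOn (hF j i)

omit [StarRing 𝕂] [HermitianScalars 𝕂] in
theorem MatSmoothOn.smul {f : N → ℝ} (hf : ContMDiffOn I 𝓘(ℝ, ℝ) ∞ f W)
    (hF : MatSmoothOn I F W) : MatSmoothOn I (fun x => f x • F x) W :=
  fun i j => hf.smul (hF i j)

omit [StarRing 𝕂] [HermitianScalars 𝕂] in
theorem matSmoothOn_const (a : Matrix (Fin n) (Fin n) 𝕂) : MatSmoothOn I (fun _ : N => a) W :=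
  fun _ _ => contMDiffOn_const

omit [StarRing 𝕂] [HermitianScalars 𝕂] in
theorem MatSmoothOn.mono {V : Set N} (hF : MatSmoothOn I F W) (h : V ⊆ W) : MatSmoothOn I F V :=
  fun i j => (hF i j).mono h

omit [StarRing 𝕂] [HermitianScalars 𝕂] in
theorem MatSmoothOn.congr (hF : MatSmoothOn I F W) (h : ∀ x ∈ W, G x = F x) :
    MatSmoothOn I G W :=
  fun i j => (hF i j).congr fun x hx => by rw [h x hx]

omit [StarRing 𝕂] [HermitianScalars 𝕂] in
theorem matSmoothOn_of_locally
    (h : ∀ x ∈ W, ∃ U, IsOpen U ∧ x ∈ U ∧ MatSmoothOn I F (W ∩ U)) : MatSmoothOn I F W :=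
  fun i j => contMDiffOn_of_locally_contMDiffOn fun x hx => by
    obtain ⟨U, hU, hxU, hs⟩ := h x hx
    exact ⟨U, hU, hxU, hs i j⟩

/-- All entries of `F` are differentiable at `x`. -/
def MatDiffAt (I : ModelWithCorners ℝ E H) (F : N → Matrix (Fin n) (Fin n) 𝕂) (x : N) : Prop :=
  ∀ i j, MDifferentiableAt I 𝓘(ℝ, 𝕂) (fun y => F y i j) x

omit [StarRing 𝕂] [HermitianScalars 𝕂] in
theorem MatSmoothOn.matDiffAt (hF : MatSmoothOn I F W) (hW : IsOpen W) {x : N} (hx : x ∈ W) :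
    MatDiffAt I F x :=
  fun i j => ((hF i j).contMDiffAt (hW.mem_nhds hx)).mdifferentiableAt (by simp)

/-- The differential of a `𝕂`-valued function, evaluated on a tangent vector. -/
def dEntry (I : ModelWithCorners ℝ E H) (f : N → 𝕂) (x : N) (v : TangentSpace I x) : 𝕂 :=
  mfderiv I 𝓘(ℝ, 𝕂) f x v

omit [StarRing 𝕂] [HermitianScalars 𝕂] in
theorem dEntry_eq {f : N → 𝕂} {x : N} {L : E →L[ℝ] 𝕂} (h : HasMFDerivAt I 𝓘(ℝ, 𝕂) f x L)
    (v : TangentSpace I x) : dEntry I f x v = L v :=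
  congrArg (fun L => L v) h.mfderiv

/-- The entrywise differential of a matrix-valued function. -/
def dMat (I : ModelWithCorners ℝ E H) (F : N → Matrix (Fin n) (Fin n) 𝕂) (x : N)
    (v : TangentSpace I x) : Matrix (Fin n) (Fin n) 𝕂 :=
  Matrix.of fun i j => dEntry I (fun y => F y i j) x v

omit [StarRing 𝕂] [HermitianScalars 𝕂] in
theorem dMat_const (a : Matrix (Fin n) (Fin n) 𝕂) (x : N) (v : TangentSpace I x) :
    dMat I (fun _ => a) x v = 0 := by
  ext i j
  exact dEntry_eq (hasMFDerivAt_const (a i j) x) v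

omit [StarRing 𝕂] [HermitianScalars 𝕂] in
theorem dMat_congr {x : N} (h : F =ᶠ[nhds x] G) (v : TangentSpace I x) :
    dMat I F x v = dMat I G x v := by
  ext i j
  have : (fun y => F y i j) =ᶠ[nhds x] fun y => G y i j := h.mono fun y hy => by
    simp only [hy]
  exact congrArg (fun L : E →L[ℝ] 𝕂 => L v) (this.mfderiv_eq (I := I) (I' := 𝓘(ℝ, 𝕂)))

omit [StarRing 𝕂] [HermitianScalars 𝕂] in
theorem dMat_mul {x : N} (hF : MatDiffAt I F x) (hG : MatDiffAt I G x) (v : TangentSpace I x) :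
    dMat I (fun y => F y * G y) x v = dMat I F x v * G x + F x * dMat I G x v := by
  ext i j
  simp only [dMat, Matrix.of_apply, Matrix.add_apply, Matrix.mul_apply]
  have h := HasMFDerivAt.sum (t := Finset.univ) (I := I) (z := x)
    (f := fun k : Fin n => (fun y => F y i k) * fun y => G y k j)
    (fun k _ => (hF i k).hasMFDerivAt.mul' (hG k j).hasMFDerivAt)
  have h2 : (∑ k : Fin n, (fun y => F y i k) * fun y => G y k j) =
      fun y => ∑ k, F y i k * G y k j := by
    ext y; simp
  rw [h2] at h
  let A : Fin n → E →L[ℝ] 𝕂 := fun k => mfderiv I 𝓘(ℝ, 𝕂) (fun y => F y i k) x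
  let B : Fin n → E →L[ℝ] 𝕂 := fun k => mfderiv I 𝓘(ℝ, 𝕂) (fun y => G y k j) x
  have h3 : dEntry I (fun y => ∑ k, F y i k * G y k j) x v =
      (∑ k, (F x i k • B k + MulOpposite.op (G x k j) • A k)) v := dEntry_eq h v
  let w : E := v
  refine h3.trans ((map_sum (ContinuousLinearMap.apply ℝ 𝕂 w) _ _).trans ?_)
  rw [← Finset.sum_add_distrib]
  exact Finset.sum_congr rfl fun k _ => add_comm _ _

theorem dMat_star {x : N} (hF : MatDiffAt I F x) (v : TangentSpace I x) :
    dMat I (fun y => (F y)ᴴ) x v = (dMat I F x v)ᴴ := by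
  ext i j
  exact dEntry_eq (((starCLM 𝕂).hasMFDerivAt (x := F x j i)).comp x (hF j i).hasMFDerivAt) v

omit [StarRing 𝕂] [HermitianScalars 𝕂] in
theorem dMat_add_vec {x : N} (v w : TangentSpace I x) :
    dMat I F x (v + w) = dMat I F x v + dMat I F x w := by
  ext i j
  exact (mfderiv I 𝓘(ℝ, 𝕂) (fun y => F y i j) x).map_add v w

omit [StarRing 𝕂] [HermitianScalars 𝕂] in
theorem dMat_smul_vec {x : N} (c : ℝ) (v : TangentSpace I x) :
    dMat I F x (c • v) = c • dMat I F x v := by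
  ext i j
  exact (mfderiv I 𝓘(ℝ, 𝕂) (fun y => F y i j) x).map_smul c v

omit [StarRing 𝕂] [HermitianScalars 𝕂] in
/-- The differential of a smooth function is smooth on the tangent bundle. -/
theorem contMDiffOn_dEntry_tangent [IsManifold I ∞ N] {f : N → 𝕂}
    (hf : ContMDiffOn I 𝓘(ℝ, 𝕂) ∞ f W) (hW : IsOpen W) :
    ContMDiffOn I.tangent 𝓘(ℝ, 𝕂) ∞ (fun v : TangentBundle I N => dEntry I f v.proj v.snd)
      {v | v.proj ∈ W} := by
  have : IsManifold I 1 N := IsManifold.of_le (n := ∞) (by simp)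
  have h := hf.contMDiffOn_tangentMapWithin (m := ∞) (by simp) hW.uniqueMDiffOn
  have h2 := (contMDiff_snd_tangentBundle_modelSpace (n := ∞) 𝕂 𝓘(ℝ, 𝕂)).comp_contMDiffOn h
  refine h2.congr fun v hv => ?_
  exact congrArg (fun L : E →L[ℝ] 𝕂 => L v.snd)
    (mfderivWithin_of_isOpen (I := I) (I' := 𝓘(ℝ, 𝕂)) (f := f) hW hv).symm

omit [StarRing 𝕂] [HermitianScalars 𝕂] in
theorem MatSmoothOn.dMat_tangent [IsManifold I ∞ N] (hF : MatSmoothOn I F W) (hW : IsOpen W) :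
    MatSmoothOn I.tangent (fun v : TangentBundle I N => dMat I F v.proj v.snd)
      {v | v.proj ∈ W} :=
  fun i j => contMDiffOn_dEntry_tangent (hF i j) hW

end SmoothMatrixFunctions

/-! ### Calculus of matrix-valued curves. -/

section MatrixCurves

variable {𝕂 : Type*} [NormedRing 𝕂] [StarRing 𝕂] [NormedAlgebra ℝ 𝕂] [HermitianScalars 𝕂]
  {n : ℕ}

/-- Entrywise derivative of a curve of matrices. -/
def HasMatDerivWithin (k : ℝ → Matrix (Fin n) (Fin n) 𝕂) (k' : Matrix (Fin n) (Fin n) 𝕂)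
    (s : Set ℝ) (τ : ℝ) : Prop :=
  ∀ i j, HasDerivWithinAt (fun σ => k σ i j) (k' i j) s τ

variable {k l : ℝ → Matrix (Fin n) (Fin n) 𝕂} {k' l' : Matrix (Fin n) (Fin n) 𝕂} {s : Set ℝ}
  {τ : ℝ}

omit [StarRing 𝕂] [HermitianScalars 𝕂] in
theorem HasMatDerivWithin.mul (hk : HasMatDerivWithin k k' s τ) (hl : HasMatDerivWithin l l' s τ) :
    HasMatDerivWithin (fun σ => k σ * l σ) (k' * l τ + k τ * l') s τ := by
  intro i j
  simp only [Matrix.mul_apply, Matrix.add_apply, ← Finset.sum_add_distrib]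
  exact HasDerivWithinAt.fun_sum fun m _ => (hk i m).mul (hl m j)

omit [StarRing 𝕂] [HermitianScalars 𝕂] in
theorem hasMatDerivWithin_const (a : Matrix (Fin n) (Fin n) 𝕂) :
    HasMatDerivWithin (fun _ => a) 0 s τ :=
  fun i j => hasDerivWithinAt_const τ s (a i j)

theorem HasMatDerivWithin.star (hk : HasMatDerivWithin k k' s τ) :
    HasMatDerivWithin (fun σ => (k σ)ᴴ) k'ᴴ s τ :=
  fun i j => (starCLM 𝕂).hasFDerivAt.comp_hasDerivWithinAt τ (hk j i)

omit [StarRing 𝕂] [HermitianScalars 𝕂] in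
theorem HasMatDerivWithin.congr (hk : HasMatDerivWithin k k' s τ)
    (h : ∀ᶠ σ in nhdsWithin τ s, l σ = k σ) (hτ : l τ = k τ) : HasMatDerivWithin l k' s τ :=
  fun i j => (hk i j).congr_of_eventuallyEq (h.mono fun σ hσ => by simp only [hσ]) (by rw [hτ])

omit [StarRing 𝕂] [HermitianScalars 𝕂] in
/-- A curve of matrices with vanishing derivative on an interval is constant. -/
theorem eq_of_hasMatDerivWithin_zero {S : Set ℝ} (hS : Convex ℝ S)
    (h : ∀ σ ∈ S, HasMatDerivWithin k 0 S σ) {a b : ℝ} (ha : a ∈ S) (hb : b ∈ S) : k a = k b := by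
  ext i j
  have hd : ∀ x ∈ S, HasDerivWithinAt (fun σ => k σ i j) 0 S x := fun x hx => h x hx i j
  have := hS.norm_image_sub_le_of_norm_hasDerivWithin_le (C := 0) hd (by simp) hb ha
  rw [zero_mul, norm_le_zero_iff, sub_eq_zero] at this
  exact this

variable {E : Type*} [NormedAddCommGroup E] [NormedSpace ℝ E] {H : Type*} [TopologicalSpace H]
  {I : ModelWithCorners ℝ E H} {N : Type*} [TopologicalSpace N] [ChartedSpace H N]

omit [StarRing 𝕂] [HermitianScalars 𝕂] in
theorem MatDiffAt.hasMatDerivWithin_comp {F : N → Matrix (Fin n) (Fin n) 𝕂} {γ : ℝ → N}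
    (hγ : MDifferentiableWithinAt 𝓘(ℝ, ℝ) I γ s τ) (hF : MatDiffAt I F (γ τ)) :
    HasMatDerivWithin (fun σ => F (γ σ))
      (dMat I F (γ τ) (mfderivWithin 𝓘(ℝ, ℝ) I γ s τ (1 : ℝ))) s τ := by
  intro i j
  have h := (hF i j).hasMFDerivAt.comp_hasMFDerivWithinAt τ hγ.hasMFDerivWithinAt
  obtain ⟨L, hL, hL'⟩ : ∃ L : ℝ →L[ℝ] 𝕂,
      HasMFDerivWithinAt 𝓘(ℝ, ℝ) 𝓘(ℝ, 𝕂) (fun σ => F (γ σ) i j) s τ L ∧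
        L 1 = dMat I F (γ τ) (mfderivWithin 𝓘(ℝ, ℝ) I γ s τ (1 : ℝ)) i j := ⟨_, h, rfl⟩
  rw [← hL']
  have hL2 : HasFDerivWithinAt (fun σ => F (γ σ) i j) L s τ :=
    hasMFDerivWithinAt_iff_hasFDerivWithinAt.1 hL
  exact hL2.hasDerivWithinAt

end MatrixCurves

/-! ### Changes of gauge, the maximal atlas, and horizontality in a single gauge. -/

section Gauge

variable {𝕂 : Type*} [NormedRing 𝕂] [StarRing 𝕂] [NormedAlgebra ℝ 𝕂] [HermitianScalars 𝕂]
  {n d : ℕ}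
  {M : Type*} [TopologicalSpace M] [ChartedSpace (EuclideanSpace ℝ (Fin d)) M]
  {P : Type*} (B : PrincipalBundle 𝕂 n d M P)

namespace PrincipalBundle

open Classical in
/-- The group element carrying `p` to `q`, for `p` and `q` in the same fibre. -/
def trans (p q : P) : IsoGroup 𝕂 (Fin n) :=
  if h : B.proj p = B.proj q then (B.simply_transitive p q h).choose else 1

variable {B}

omit [HermitianScalars 𝕂] in
theorem act_trans {p q : P} (h : B.proj p = B.proj q) : B.act p (B.trans p q) = q := by
  unfold trans
  rw [dif_pos h]
  exact (B.simply_transitive p q h).choose_spec.1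

omit [HermitianScalars 𝕂] in
theorem act_injective {p : P} {g h : IsoGroup 𝕂 (Fin n)} (e : B.act p g = B.act p h) : g = h :=
  (B.simply_transitive p (B.act p h) (B.proj_act p h).symm).unique e rfl

omit [HermitianScalars 𝕂] in
theorem trans_act (p : P) (g : IsoGroup 𝕂 (Fin n)) : B.trans p (B.act p g) = g :=
  act_injective (act_trans (B.proj_act p g).symm)

omit [HermitianScalars 𝕂] in
theorem trans_eq {p q : P} {g : IsoGroup 𝕂 (Fin n)} (h : q = B.act p g) : B.trans p q = g := by
  rw [h, trans_act (B := B)]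

omit [HermitianScalars 𝕂] in
theorem trans_mul {p q r : P} (h : B.proj p = B.proj q) (h' : B.proj q = B.proj r) :
    B.trans p q * B.trans q r = B.trans p r := by
  apply act_injective (B := B) (p := p)
  rw [B.act_mul, act_trans h, act_trans h', act_trans (h.trans h')]

omit [HermitianScalars 𝕂] in
theorem trans_self (p : P) : B.trans p p = 1 := trans_eq (B.act_one p).symm

omit [HermitianScalars 𝕂] in
theorem trans_inv {p q : P} (h : B.proj p = B.proj q) : (B.trans p q)⁻¹ = B.trans q p := by
  rw [inv_eq_iff_mul_eq_one, trans_mul h h.symm, trans_self]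

omit [HermitianScalars 𝕂] in
theorem trans_act_right {p q : P} (h : B.proj p = B.proj q) (g : IsoGroup 𝕂 (Fin n)) :
    B.trans p (B.act q g) = B.trans p q * g := by
  apply act_injective (B := B) (p := p)
  rw [B.act_mul, act_trans h, act_trans (h.trans (B.proj_act q g).symm)]

omit [HermitianScalars 𝕂] in
theorem isSmoothSectionOn_of_mem_atlas {s : LocalSection M P} (hs : s ∈ B.atlas) :
    B.IsSmoothSectionOn s.sec s.dom :=
  ⟨B.isOpen_dom s hs, B.proj_sec s hs, fun t ht => B.smooth_transition t ht s hs⟩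

omit [HermitianScalars 𝕂] in
theorem IsSmoothSectionOn.proj_eq_proj {s t : M → P} {U V : Set M} (hs : B.IsSmoothSectionOn s U)
    (ht : B.IsSmoothSectionOn t V) {x : M} (hx : x ∈ U ∩ V) : B.proj (s x) = B.proj (t x) := by
  rw [hs.proj_eq x hx.1, ht.proj_eq x hx.2]

/-- Near each point both sections are compared with an atlas section, by functions `a` and `b`; the
transition is then `a⁻¹ b`. -/
theorem IsSmoothSectionOn.smooth_trans {s t : M → P} {U V : Set M} (hs : B.IsSmoothSectionOn s U)
    (ht : B.IsSmoothSectionOn t V) :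
    SmoothMatrixOn (d := d) (fun x => B.trans (s x) (t x)) (U ∩ V) := by
  change MatSmoothOn (𝓡 d) (fun x => (B.trans (s x) (t x)).1) (U ∩ V)
  refine matSmoothOn_of_locally fun x hx => ?_
  obtain ⟨u, hu, hxu⟩ := B.covers x
  obtain ⟨a, ha, has⟩ := hs.smooth u hu
  obtain ⟨b, hb, hbs⟩ := ht.smooth u hu
  refine ⟨u.dom, B.isOpen_dom u hu, hxu, ?_⟩
  have h1 : MatSmoothOn (𝓡 d) (fun x => (a x).1ᴴ * (b x).1) (U ∩ V ∩ u.dom) :=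
    (MatSmoothOn.star (MatSmoothOn.mono has fun y hy => ⟨hy.2, hy.1.1⟩)).mul
      (MatSmoothOn.mono hbs fun y hy => ⟨hy.2, hy.1.2⟩)
  refine h1.congr fun y hy => ?_
  have hpy : B.proj (u.sec y) = y := B.proj_sec u hu y hy.2
  have : B.trans (s y) (t y) = (a y)⁻¹ * b y := by
    refine trans_eq ?_
    rw [ha y ⟨hy.2, hy.1.1⟩, hb y ⟨hy.2, hy.1.2⟩, ← B.act_mul, mul_inv_cancel_left]
  rw [this]
  rfl

variable (B) in
/-- The same bundle, equipped with the maximal atlas of all smooth local sections. -/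
def max : PrincipalBundle 𝕂 n d M P where
  proj := B.proj
  act := B.act
  act_one := B.act_one
  act_mul := B.act_mul
  proj_act := B.proj_act
  simply_transitive := B.simply_transitive
  atlas := {s | B.IsSmoothSectionOn s.sec s.dom}
  isOpen_dom _ hs := hs.isOpen
  proj_sec _ hs := hs.proj_eq
  covers x := by
    obtain ⟨s, hs, hx⟩ := B.covers x
    exact ⟨s, isSmoothSectionOn_of_mem_atlas hs, hx⟩
  smooth_transition s hs t ht :=
    ⟨fun x => B.trans (s.sec x) (t.sec x),
      fun _ hx => (act_trans (hs.proj_eq_proj ht hx)).symm, hs.smooth_trans ht⟩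

theorem atlas_subset_max : B.atlas ⊆ B.max.atlas :=
  fun _ hs => isSmoothSectionOn_of_mem_atlas hs

theorem smooth_trans_of_mem {s t : LocalSection M P} (hs : s ∈ B.atlas) (ht : t ∈ B.atlas) :
    MatSmoothOn (𝓡 d) (fun x => (B.trans (s.sec x) (t.sec x)).1) (s.dom ∩ t.dom) :=
  (isSmoothSectionOn_of_mem_atlas hs).smooth_trans (isSmoothSectionOn_of_mem_atlas ht)

variable [IsManifold (𝓡 d) ∞ M]

/-- Restriction of a connection from the maximal atlas. -/
def Connection.ofMax (A : B.max.Connection) : B.Connection where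
  form := A.form
  skew s hs := A.skew s (atlas_subset_max hs)
  smooth s hs := A.smooth s (atlas_subset_max hs)
  transform s hs t ht := A.transform s (atlas_subset_max hs) t (atlas_subset_max ht)

/-- The horizontality equation at parameter `τ` in the gauge `s`. -/
def Connection.HorizontalAt (A : B.Connection) (s : LocalSection M P) (c : ℝ → P) (τ : ℝ) : Prop :=
  HasMatDerivWithin (fun σ => (B.trans (s.sec (B.proj (c σ))) (c σ)).1)
    (-(A.form s (B.proj (c τ))
      (mfderivWithin 𝓘(ℝ, ℝ) (𝓡 d) (fun σ => B.proj (c σ)) (Set.Icc 0 1) τ (1 : ℝ)) *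
      (B.trans (s.sec (B.proj (c τ))) (c τ)).1)) (Set.Icc 0 1) τ

variable {A : B.Connection} {c : ℝ → P}

omit [HermitianScalars 𝕂] [IsManifold (𝓡 d) ∞ M] in
theorem eventually_mem_dom {W : Set M} (hW : IsOpen W)
    (hc : ContMDiffOn 𝓘(ℝ, ℝ) (𝓡 d) 1 (fun τ => B.proj (c τ)) (Set.Icc 0 1)) {τ : ℝ}
    (hτ : τ ∈ Set.Icc (0 : ℝ) 1) (hx : B.proj (c τ) ∈ W) :
    ∀ᶠ σ in nhdsWithin τ (Set.Icc 0 1), B.proj (c σ) ∈ W :=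
  (hc.continuousOn τ hτ).eventually (hW.mem_nhds hx)

omit [HermitianScalars 𝕂] in
theorem Connection.IsHorizontal.horizontalAt (h : A.IsHorizontal c) {s : LocalSection M P}
    (hs : s ∈ B.atlas) {τ : ℝ} (hτ : τ ∈ Set.Icc (0 : ℝ) 1) (hx : B.proj (c τ) ∈ s.dom) :
    A.HorizontalAt s c τ := by
  obtain ⟨g, hg⟩ := h.horizontal s hs
  have htr : ∀ σ ∈ Set.Icc (0 : ℝ) 1, B.proj (c σ) ∈ s.dom →
      B.trans (s.sec (B.proj (c σ))) (c σ) = g σ := fun σ hσ hσ' => trans_eq (hg σ hσ hσ').1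
  have h1 : HasMatDerivWithin (fun σ => (g σ).1) _ (Set.Icc 0 1) τ := (hg τ hτ hx).2
  rw [Connection.HorizontalAt, htr τ hτ hx]
  refine h1.congr ?_ (by rw [htr τ hτ hx])
  filter_upwards [eventually_mem_dom (B.isOpen_dom s hs) h.base_contMDiffOn hτ hx,
    self_mem_nhdsWithin] with σ hσ hσ'
  rw [htr σ hσ' hσ]

/-- The new transport is `g⁻¹` times the old one. The derivative of `g⁻¹` along the curve matches
the inhomogeneous term `g⁻¹ dg` of the transformation law. -/
theorem Connection.HorizontalAt.change_gauge
    (hc : ContMDiffOn 𝓘(ℝ, ℝ) (𝓡 d) 1 (fun τ => B.proj (c τ)) (Set.Icc 0 1))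
    {s t : LocalSection M P} (hs : s ∈ B.atlas) (ht : t ∈ B.atlas) {τ : ℝ}
    (hτ : τ ∈ Set.Icc (0 : ℝ) 1) (hxs : B.proj (c τ) ∈ s.dom) (hxt : B.proj (c τ) ∈ t.dom)
    (h : A.HorizontalAt s c τ) : A.HorizontalAt t c τ := by
  set x := B.proj (c τ) with hx
  set v := mfderivWithin 𝓘(ℝ, ℝ) (𝓡 d) (fun σ => B.proj (c σ)) (Set.Icc 0 1) τ (1 : ℝ) with hv
  let g : M → IsoGroup 𝕂 (Fin n) := fun y => B.trans (s.sec y) (t.sec y)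
  have hopen : IsOpen (s.dom ∩ t.dom) := (B.isOpen_dom s hs).inter (B.isOpen_dom t ht)
  have hproj : ∀ y ∈ s.dom ∩ t.dom, B.proj (s.sec y) = B.proj (t.sec y) := fun y hy => by
    rw [B.proj_sec s hs y hy.1, B.proj_sec t ht y hy.2]
  have hA := A.transform s hs t ht g (fun y hy => (act_trans (hproj y hy)).symm) x ⟨hxs, hxt⟩ v
  have hgd : MatDiffAt (𝓡 d) (fun y => (g y).1) x :=
    (smooth_trans_of_mem hs ht).matDiffAt hopen ⟨hxs, hxt⟩
  have hG := MatDiffAt.hasMatDerivWithin_comp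
    ((hc τ hτ).mdifferentiableWithinAt (by simp)) hgd
  have hunit : ∀ y, (g y).1ᴴ * (g y).1 = 1 := fun y => Unitary.coe_star_mul_self (g y)
  have hunit' : ∀ y, (g y).1 * (g y).1ᴴ = 1 := fun y => Unitary.coe_mul_star_self (g y)
  -- the derivative of the inverse
  have hdstar : (dMat (𝓡 d) (fun y => (g y).1) x v)ᴴ =
      -((g x).1ᴴ * dMat (𝓡 d) (fun y => (g y).1) x v * (g x).1ᴴ) := by
    have h1 := dMat_mul (I := 𝓡 d) (F := fun y => (g y).1ᴴ) (G := fun y => (g y).1) (x := x)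
      (fun i j => ((starCLM 𝕂).hasMFDerivAt.comp x (hgd j i).hasMFDerivAt).mdifferentiableAt) hgd v
    rw [dMat_star hgd] at h1
    simp only [hunit] at h1
    rw [dMat_const] at h1
    have h2 := congrArg (fun X => X * (g x).1ᴴ) h1
    simp only [Matrix.zero_mul, Matrix.add_mul, Matrix.mul_assoc, hunit', Matrix.mul_one] at h2
    rw [Matrix.mul_assoc]
    exact eq_neg_of_add_eq_zero_left h2.symm
  have hprod := hG.star.mul h
  have htr : ∀ σ, B.proj (c σ) ∈ s.dom ∩ t.dom → B.trans (t.sec (B.proj (c σ))) (c σ) =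
      (g (B.proj (c σ)))⁻¹ * B.trans (s.sec (B.proj (c σ))) (c σ) := by
    intro σ hσ
    have e1 : B.proj (t.sec (B.proj (c σ))) = B.proj (c σ) := B.proj_sec t ht _ hσ.2
    rw [trans_inv (hproj _ hσ), trans_mul (hproj _ hσ).symm ((hproj _ hσ).trans e1)]
  have hkey : (fun σ => (B.trans (t.sec (B.proj (c σ))) (c σ)).1) τ =
      (g x).1ᴴ * (B.trans (s.sec x) (c τ)).1 := by
    change (B.trans (t.sec (B.proj (c τ))) (c τ)).1 = _
    rw [htr τ ⟨hxs, hxt⟩]; rfl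
  rw [Connection.HorizontalAt]
  have hder : -(A.form t x v * (B.trans (t.sec x) (c τ)).1) =
      (dMat (𝓡 d) (fun y => (g y).1) x v)ᴴ * (B.trans (s.sec x) (c τ)).1 +
        (g x).1ᴴ * -(A.form s x v * (B.trans (s.sec x) (c τ)).1) := by
    have h3 : (B.trans (t.sec x) (c τ)).1 = (g x).1ᴴ * (B.trans (s.sec x) (c τ)).1 := hkey
    have h4 : A.form t x v = (g x).1ᴴ * A.form s x v * (g x).1 +
        (g x).1ᴴ * dMat (𝓡 d) (fun y => (g y).1) x v := hA
    rw [h3, h4, hdstar, Matrix.add_mul, neg_add, Matrix.neg_mul, Matrix.mul_neg, add_comm]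
    congr 2
    · simp only [Matrix.mul_assoc]
    · rw [show (g x).1ᴴ * A.form s x v * (g x).1 * ((g x).1ᴴ * (B.trans (s.sec x) (c τ)).1) =
        (g x).1ᴴ * A.form s x v * ((g x).1 * (g x).1ᴴ) * (B.trans (s.sec x) (c τ)).1 by
          simp only [Matrix.mul_assoc], hunit', Matrix.mul_one, Matrix.mul_assoc]
  rw [← hx, ← hv, hder]
  refine hprod.congr ?_ hkey
  filter_upwards [eventually_mem_dom hopen hc hτ ⟨hxs, hxt⟩] with σ hσ
  rw [htr σ hσ]; rfl

/-- By gauge covariance, one gauge at each parameter suffices. -/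
theorem Connection.isHorizontal_of_horizontalAt
    (hc : ContMDiffOn 𝓘(ℝ, ℝ) (𝓡 d) 1 (fun τ => B.proj (c τ)) (Set.Icc 0 1))
    (h : ∀ τ ∈ Set.Icc (0 : ℝ) 1, ∃ s ∈ B.atlas, B.proj (c τ) ∈ s.dom ∧ A.HorizontalAt s c τ) :
    A.IsHorizontal c := by
  refine ⟨hc, fun t ht => ⟨fun σ => B.trans (t.sec (B.proj (c σ))) (c σ), fun τ hτ hxt => ⟨?_, ?_⟩⟩⟩
  · rw [act_trans (B.proj_sec t ht _ hxt)]
  · obtain ⟨s, hs, hxs, hor⟩ := h τ hτ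
    exact hor.change_gauge hc hs ht hτ hxs hxt

theorem Connection.isHorizontal_ofMax_iff {A : B.max.Connection} :
    A.ofMax.IsHorizontal c ↔ A.IsHorizontal c := by
  constructor
  · intro h
    refine Connection.isHorizontal_of_horizontalAt h.base_contMDiffOn fun τ hτ => ?_
    obtain ⟨s, hs, hx⟩ := B.covers (B.proj (c τ))
    exact ⟨s, atlas_subset_max hs, hx, h.horizontalAt hs hτ hx⟩
  · intro h
    exact ⟨h.base_contMDiffOn, fun s hs => h.horizontal s (atlas_subset_max hs)⟩

/-- Allows the existence proof to work in the maximal atlas, where every smooth section of the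
reduction is a gauge. -/
theorem Connection.holonomyBundle_ofMax {A : B.max.Connection} (p₀ : P) :
    A.ofMax.holonomyBundle p₀ = A.holonomyBundle p₀ := by
  simp only [Connection.holonomyBundle, Connection.isHorizontal_ofMax_iff]

end PrincipalBundle

end Gauge

/-! ### The covering by a finite orbit, and the reduction to a stabilizer. -/

section OrbitCovering

variable {𝕂 : Type*} [NormedRing 𝕂] [StarRing 𝕂] [NormedAlgebra ℝ 𝕂] [HermitianScalars 𝕂]
  {n d : ℕ}
  {M : Type*} [TopologicalSpace M] [ChartedSpace (EuclideanSpace ℝ (Fin d)) M]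
  {P : Type*} {B : PrincipalBundle 𝕂 n d M P} {H : Subgroup (IsoGroup 𝕂 (Fin n))} {Q : Set P}
  {J : IsoGroup 𝕂 (Fin n)}

omit [HermitianScalars 𝕂] [NormedAlgebra ℝ 𝕂] in
theorem conj_mem_conjOrbit {h x : IsoGroup 𝕂 (Fin n)} (hh : h ∈ H) (hx : x ∈ conjOrbit H J) :
    h⁻¹ * x * h ∈ conjOrbit H J := by
  obtain ⟨k, hk, rfl⟩ := hx
  exact ⟨h⁻¹ * k, H.mul_mem (H.inv_mem hh) hk, by simp [mul_assoc]⟩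

omit [StarRing 𝕂] [HermitianScalars 𝕂] in
theorem MatSmoothOn.continuousOn {E : Type*} [NormedAddCommGroup E] [NormedSpace ℝ E]
    {H : Type*} [TopologicalSpace H] {I : ModelWithCorners ℝ E H} {N : Type*} [TopologicalSpace N]
    [ChartedSpace H N] {F : N → Matrix (Fin n) (Fin n) 𝕂} {W : Set N} (hF : MatSmoothOn I F W) :
    ContinuousOn F W :=
  continuousOn_pi.2 fun i => continuousOn_pi.2 fun j => (hF i j).continuousOn

omit [HermitianScalars 𝕂] in
theorem SmoothMatrixOn.continuousOn {g : M → IsoGroup 𝕂 (Fin n)} {W : Set M}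
    (hg : SmoothMatrixOn (d := d) g W) : ContinuousOn g W :=
  Topology.IsInducing.subtypeVal.continuousOn_iff.2 (MatSmoothOn.continuousOn hg)

namespace PrincipalBundle

variable (B Q) in
/-- The smooth local sections with values in `Q`. -/
def SectionIn : Type _ :=
  {s : LocalSection M P // B.IsSmoothSectionOn s.sec s.dom ∧ ∀ y ∈ s.dom, s.sec y ∈ Q}

omit [HermitianScalars 𝕂] in
theorem IsReduction.trans_mem (hQ : B.IsReduction Q H) {p q : P} (hp : p ∈ Q) (hq : q ∈ Q)
    (h : B.proj p = B.proj q) : B.trans p q ∈ H :=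
  (hQ.act_mem_iff p hp _).1 (by rwa [act_trans h])

omit [HermitianScalars 𝕂] in
theorem IsReduction.exists_sectionIn (hQ : B.IsReduction Q H) (x : M) :
    ∃ s : SectionIn B Q, x ∈ s.1.dom := by
  obtain ⟨W, s, hx, hs, hsQ⟩ := hQ.exists_section x
  exact ⟨⟨⟨W, s⟩, hs, hsQ⟩, hx⟩

omit [HermitianScalars 𝕂] in
theorem SectionIn.proj_eq (s : SectionIn B Q) {x : M} (hx : x ∈ s.1.dom) :
    B.proj (s.1.sec x) = x :=
  s.2.1.proj_eq x hx

omit [HermitianScalars 𝕂] in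
theorem SectionIn.proj_eq_proj (s t : SectionIn B Q) {x : M} (hs : x ∈ s.1.dom)
    (ht : x ∈ t.1.dom) : B.proj (s.1.sec x) = B.proj (t.1.sec x) := by
  rw [s.proj_eq hs, t.proj_eq ht]

open Classical in
/-- Change of gauge on the orbit of `J`. -/
def orbitChange (hQ : B.IsReduction Q H) (J : IsoGroup 𝕂 (Fin n)) (s t : SectionIn B Q) (x : M)
    (v : conjOrbit H J) : conjOrbit H J :=
  if hx : x ∈ s.1.dom ∧ x ∈ t.1.dom then
    ⟨(B.trans (s.1.sec x) (t.1.sec x))⁻¹ * v.1 * B.trans (s.1.sec x) (t.1.sec x),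
      conj_mem_conjOrbit (hQ.trans_mem (s.2.2 x hx.1) (t.2.2 x hx.2)
        (s.proj_eq_proj t hx.1 hx.2)) v.2⟩
  else v

omit [HermitianScalars 𝕂] in
theorem orbitChange_coe (hQ : B.IsReduction Q H) {s t : SectionIn B Q} {x : M}
    (hs : x ∈ s.1.dom) (ht : x ∈ t.1.dom) (v : conjOrbit H J) :
    (orbitChange hQ J s t x v).1 =
      (B.trans (s.1.sec x) (t.1.sec x))⁻¹ * v.1 * B.trans (s.1.sec x) (t.1.sec x) := by
  rw [orbitChange, dif_pos ⟨hs, ht⟩]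

variable (J) in
/-- The bundle over `M` associated with `Q` whose fibre is the orbit of `J`. -/
def orbitBundleCore (hQ : B.IsReduction Q H) : FiberBundleCore (SectionIn B Q) M (conjOrbit H J) where
  baseSet s := s.1.dom
  isOpen_baseSet s := s.2.1.isOpen
  indexAt x := (hQ.exists_sectionIn x).choose
  mem_baseSet_at x := (hQ.exists_sectionIn x).choose_spec
  coordChange := orbitChange hQ J
  coordChange_self s x hx v := Subtype.ext (by
    rw [orbitChange_coe hQ hx hx, trans_self]; simp)
  continuousOn_coordChange s t := by
    rw [Topology.IsInducing.subtypeVal.continuousOn_iff]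
    have hg := (s.2.1.smooth_trans t.2.1).continuousOn
    have h1 : ContinuousOn (fun p : M × conjOrbit H J => B.trans (s.1.sec p.1) (t.1.sec p.1))
        ((s.1.dom ∩ t.1.dom) ×ˢ Set.univ) :=
      hg.comp continuousOn_fst fun p hp => hp.1
    have h2 : ContinuousOn (fun p : M × conjOrbit H J => p.2.1)
        ((s.1.dom ∩ t.1.dom) ×ˢ Set.univ) :=
      (continuous_subtype_val.comp continuous_snd).continuousOn
    refine ((h1.inv.mul h2).mul h1).congr fun p hp => ?_
    exact orbitChange_coe hQ hp.1.1 hp.1.2 p.2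
  coordChange_comp s t u x hx v := by
    obtain ⟨⟨hs, ht⟩, hu⟩ := hx
    apply Subtype.ext
    rw [orbitChange_coe hQ ht hu, orbitChange_coe hQ hs ht, orbitChange_coe hQ hs hu,
      ← trans_mul (s.proj_eq_proj t hs ht) (t.proj_eq_proj u ht hu)]
    simp [mul_assoc]

/-- Since `M` is simply connected, the bundle of orbits has a section through every point; as an
equivariant map on `Q`, it is a locally constant map into the orbit. -/
theorem IsReduction.exists_orbit_map [SimplyConnectedSpace M] (hQ : B.IsReduction Q H)
    (hfin : (conjOrbit H J).Finite)
    {p₀ : P} (hp₀ : p₀ ∈ Q) :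
    ∃ Φ : P → IsoGroup 𝕂 (Fin n), Φ p₀ = J ∧ (∀ q ∈ Q, Φ q ∈ conjOrbit H J) ∧
      (∀ q ∈ Q, ∀ h ∈ H, Φ (B.act q h) = h⁻¹ * Φ q * h) ∧
      ∀ s : SectionIn B Q, ContinuousOn (fun x => Φ (s.1.sec x)) s.1.dom := by
  have : LocallyPathConnectedSpace M :=
    ChartedSpace.locallyPathConnectedSpace (EuclideanSpace ℝ (Fin d)) M
  have : Finite (conjOrbit H J) := hfin
  let Z := orbitBundleCore J hQ
  -- The finite orbit is discrete, so the fibre bundle is a covering.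
  have hcov : IsCoveringMap Z.proj := IsFiberBundle.isCoveringMap fun x =>
    ⟨Z.localTriv (Z.indexAt x), Z.mem_baseSet_at x⟩
  set x₀ := B.proj p₀ with hx₀
  let i : M → SectionIn B Q := Z.indexAt
  have hi : ∀ x, x ∈ (i x).1.dom := Z.mem_baseSet_at
  have hproj : ∀ x, B.proj ((i x).1.sec x) = x := fun x => (i x).proj_eq (hi x)
  have htr : ∀ q ∈ Q, B.trans ((i (B.proj q)).1.sec (B.proj q)) q ∈ H := fun q hq =>
    hQ.trans_mem ((i _).2.2 _ (hi _)) hq (hproj _)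
  have hJ : J ∈ conjOrbit H J := ⟨1, H.one_mem, by simp⟩
  let t₀ := B.trans ((i x₀).1.sec x₀) p₀
  -- `J` read in the frame `p₀`, expressed in the gauge chosen at `x₀`; this makes `Φ p₀ = J`.
  let e₀ : Z.TotalSpace := ⟨x₀, (⟨t₀ * J * t₀⁻¹, t₀, htr p₀ hp₀, rfl⟩ : conjOrbit H J)⟩
  -- A lift of the identity of `M` through the covering is a global section. It exists because `M`
  -- is simply connected.
  obtain ⟨σ, ⟨hσ₀, hσ⟩, -⟩ := hcov.existsUnique_continuousMap_lifts (ContinuousMap.id M) x₀ e₀ rfl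
  have hσ' : ∀ x, (σ x).proj = x := fun x => congrFun hσ x
  let φ : M → IsoGroup 𝕂 (Fin n) := fun x => ((σ x).snd : conjOrbit H J).1
  have hφ : ∀ x, φ x ∈ conjOrbit H J := fun x => ((σ x).snd : conjOrbit H J).2
  refine ⟨fun q => (B.trans ((i (B.proj q)).1.sec (B.proj q)) q)⁻¹ * φ (B.proj q) *
    B.trans ((i (B.proj q)).1.sec (B.proj q)) q, ?_, fun q hq => ?_, fun q hq h hh => ?_,
    fun s => ?_⟩
  · have hval : ∀ y : Z.TotalSpace, σ x₀ = y → φ x₀ = (y.snd : conjOrbit H J).1 := by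
      rintro _ rfl; rfl
    have : φ x₀ = t₀ * J * t₀⁻¹ := hval _ hσ₀
    change t₀⁻¹ * φ x₀ * t₀ = J
    rw [this]; simp [mul_assoc]
  · exact conj_mem_conjOrbit (htr q hq) (hφ _)
  · simp only [B.proj_act]
    rw [trans_act_right (hproj _)]
    simp [mul_assoc]
  · have hcont : ContinuousOn (fun x => ((Z.localTriv s (σ x)).2 : conjOrbit H J).1) s.1.dom := by
      refine continuous_subtype_val.comp_continuousOn (continuous_snd.comp_continuousOn ?_)
      refine (Z.localTriv s).continuousOn_toFun.comp σ.continuous.continuousOn fun x hx => ?_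
      refine (Z.mem_localTriv_source s (σ x)).2 ?_
      rw [hσ' x]
      exact hx
    refine hcont.congr fun x hx => ?_
    have hps : B.proj (s.1.sec x) = x := s.proj_eq hx
    simp only [hps]
    have h1 : (Z.localTriv s (σ x)).2 = Z.coordChange (i (σ x).proj) s (σ x).proj (σ x).snd := by
      rw [Z.localTriv_apply]
    rw [h1, hσ' x]
    exact (orbitChange_coe hQ (hi x) hx _).symm

omit [HermitianScalars 𝕂] in
/-- The points of a reduction at which an equivariant locally constant map into a finite orbit has
the value `J` form a reduction to the stabilizer of `J`. -/
theorem IsReduction.isReduction_stabilizer (hQ : B.IsReduction Q H) (hfin : (conjOrbit H J).Finite)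
    {Φ : P → IsoGroup 𝕂 (Fin n)} (hΦ : ∀ q ∈ Q, Φ q ∈ conjOrbit H J)
    (hact : ∀ q ∈ Q, ∀ h ∈ H, Φ (B.act q h) = h⁻¹ * Φ q * h)
    (hcont : ∀ s : SectionIn B Q, ContinuousOn (fun x => Φ (s.1.sec x)) s.1.dom) :
    B.IsReduction {q ∈ Q | Φ q = J} (H ⊓ Subgroup.centralizer {J}) := by
  refine ⟨fun p hp g => ?_, fun x => ?_⟩
  · simp only [Set.mem_ofPred_eq, Subgroup.mem_inf, hQ.act_mem_iff p hp.1]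
    refine and_congr_right fun hg => ?_
    rw [hact p hp.1 g hg, hp.2, Subgroup.mem_centralizer_singleton_iff]
    rw [mul_assoc, inv_mul_eq_iff_eq_mul, eq_comm]
  · obtain ⟨s, hx⟩ := hQ.exists_sectionIn x
    have hxQ := s.2.2 x hx
    obtain ⟨h, hh, hJ⟩ := hΦ _ hxQ
    -- The values lie in a finite set, whose remaining points form a closed set; hence `Φ` along `s`
    -- is constant near `x`. Translating `s` by the fixed `h` then makes the value `J` throughout.
    have hnear : ∀ᶠ y in nhds x, y ∈ s.1.dom ∧ Φ (s.1.sec y) = Φ (s.1.sec x) := by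
      have h1 := (hcont s).continuousAt (s.2.1.isOpen.mem_nhds hx)
      have hfin' : ((conjOrbit H J) \ {Φ (s.1.sec x)}).Finite := hfin.subset Set.sdiff_subset
      have h2 := h1.eventually (hfin'.isClosed.isOpen_compl.mem_nhds (by simp))
      filter_upwards [h2, s.2.1.isOpen.mem_nhds hx] with y hy hy'
      refine ⟨hy', ?_⟩
      by_contra hne
      exact hy ⟨hΦ _ (s.2.2 y hy'), hne⟩
    obtain ⟨W, hW, hWo, hxW⟩ := eventually_nhds_iff.1 hnear
    refine ⟨W, fun y => B.act (s.1.sec y) h, hxW, ⟨hWo, fun y hy => ?_, fun t ht => ?_⟩,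
      fun y hy => ⟨?_, ?_⟩⟩
    · rw [B.proj_act, s.proj_eq (hW y hy).1]
    · obtain ⟨g, hg, hgs⟩ := s.2.1.smooth t ht
      refine ⟨fun y => g y * h, fun y hy => ?_, ?_⟩
      · rw [B.act_mul, hg y ⟨hy.1, (hW y hy.2).1⟩]
      · exact (MatSmoothOn.mono hgs fun y hy => ⟨hy.1, (hW y hy.2).1⟩).mul (matSmoothOn_const h.1)
    · exact (hQ.act_mem_iff _ (s.2.2 y (hW y hy).1) h).2 hh
    · rw [hact _ (s.2.2 y (hW y hy).1) h hh, (hW y hy).2, hJ]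
      simp [mul_assoc]

end PrincipalBundle

end OrbitCovering

/-! ### A finite nontrivial orbit excludes holonomy-induced reductions. -/

section NotHolonomyInduced

variable {𝕂 : Type*} [NormedRing 𝕂] [StarRing 𝕂] [NormedAlgebra ℝ 𝕂] [HermitianScalars 𝕂]
  {n d : ℕ}
  {M : Type*} [TopologicalSpace M] [ChartedSpace (EuclideanSpace ℝ (Fin d)) M]
  {P : Type*} {B : PrincipalBundle 𝕂 n d M P} {H : Subgroup (IsoGroup 𝕂 (Fin n))} {Q : Set P}
  {J : IsoGroup 𝕂 (Fin n)}

theorem isHowe_centralizer {G : Type*} [Group G] (S : Set G) : IsHowe (Subgroup.centralizer S) := by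
  refine le_antisymm ?_ (Subgroup.le_centralizer_iff.1 le_rfl)
  exact Subgroup.centralizer_le fun s hs => Subgroup.mem_centralizer_iff.2 fun g hg =>
    (Subgroup.mem_centralizer_iff.1 hg s hs).symm

/-- An intersection of centralizers is the centralizer of the union, and every centralizer is Howe.
-/
theorem IsHowe.inf_centralizer {G : Type*} [Group G] {H : Subgroup G} (hH : IsHowe H) (S : Set G) :
    IsHowe (H ⊓ Subgroup.centralizer S) := by
  have : H ⊓ Subgroup.centralizer S =
      Subgroup.centralizer ((Subgroup.centralizer (H : Set G) : Set G) ∪ S) := by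
    ext g
    conv_lhs => rw [← hH]
    simp only [Subgroup.mem_inf, Subgroup.mem_centralizer_iff, Set.mem_union, or_imp, forall_and]
  rw [this]
  exact isHowe_centralizer _

namespace PrincipalBundle

variable [IsManifold (𝓡 d) ∞ M] {A : B.Connection} {c : ℝ → P}

/-- Initial segments of horizontal curves are horizontal. -/
theorem Connection.IsHorizontal.segment (h : A.IsHorizontal c) {a : ℝ}
    (ha : a ∈ Set.Icc (0 : ℝ) 1) : A.IsHorizontal fun σ => c (a * σ) := by
  have hmaps : Set.MapsTo (fun σ => a * σ) (Set.Icc (0 : ℝ) 1) (Set.Icc 0 1) := fun σ hσ =>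
    ⟨mul_nonneg ha.1 hσ.1, mul_le_one₀ ha.2 hσ.1 hσ.2⟩
  have hm : ContMDiff 𝓘(ℝ, ℝ) 𝓘(ℝ, ℝ) 1 (fun σ : ℝ => a * σ) :=
    (contDiff_const.mul contDiff_id).contMDiff
  have hbase : ContMDiffOn 𝓘(ℝ, ℝ) (𝓡 d) 1 (fun σ => B.proj (c (a * σ))) (Set.Icc 0 1) :=
    h.base_contMDiffOn.comp hm.contMDiffOn hmaps
  refine Connection.isHorizontal_of_horizontalAt hbase fun τ hτ => ?_
  obtain ⟨s, hs, hx⟩ := B.covers (B.proj (c (a * τ)))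
  refine ⟨s, hs, hx, ?_⟩
  have hor := h.horizontalAt hs (hmaps hτ) hx
  have hvel : mfderivWithin 𝓘(ℝ, ℝ) (𝓡 d) (fun σ => B.proj (c (a * σ))) (Set.Icc 0 1) τ (1 : ℝ) =
      a • mfderivWithin 𝓘(ℝ, ℝ) (𝓡 d) (fun σ => B.proj (c σ)) (Set.Icc 0 1) (a * τ) (1 : ℝ) := by
    have h1 := ((h.base_contMDiffOn (a * τ) (hmaps hτ)).mdifferentiableWithinAt
      (by simp)).hasMFDerivWithinAt
    have h2 : HasMFDerivWithinAt 𝓘(ℝ, ℝ) 𝓘(ℝ, ℝ) (fun σ : ℝ => a * σ) (Set.Icc 0 1) τ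
        (ContinuousLinearMap.toSpanSingleton ℝ a) := by
      have h2' : HasFDerivWithinAt (fun σ : ℝ => a * σ) (ContinuousLinearMap.toSpanSingleton ℝ a)
          (Set.Icc 0 1) τ := by
        simpa using ((hasDerivAt_id τ).const_mul a).hasDerivWithinAt.hasFDerivWithinAt
      exact hasMFDerivWithinAt_iff_hasFDerivWithinAt.2 h2'
    have h3 := HasMFDerivWithinAt.comp τ h1 h2 hmaps
    have h4 := h3.mfderivWithin (uniqueMDiffWithinAt_iff_uniqueDiffWithinAt.2
      (uniqueDiffOn_Icc_zero_one τ hτ))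
    have h5 := congrArg (fun L : ℝ →L[ℝ] EuclideanSpace ℝ (Fin d) => L (1 : ℝ)) h4
    refine h5.trans ?_
    let L : ℝ →L[ℝ] EuclideanSpace ℝ (Fin d) :=
      mfderivWithin 𝓘(ℝ, ℝ) (𝓡 d) (fun σ => B.proj (c σ)) (Set.Icc 0 1) (a * τ)
    change L ((1 : ℝ) • a) = a • L 1
    rw [← L.map_smul, one_smul, smul_eq_mul, mul_one]
  rw [Connection.HorizontalAt, hvel, map_smul, Matrix.smul_mul, ← smul_neg]
  intro i j
  exact (hor i j).scomp τ ((hasDerivAt_id τ).const_mul a).hasDerivWithinAt hmaps |>.congr_deriv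
    (by simp)

/-- Puts the whole curve, not only its end point, inside `Q`, where the orbit map is controlled. -/
theorem Connection.IsHorizontal.mem_holonomyBundle (h : A.IsHorizontal c) {p₀ : P}
    (h0 : c 0 ∈ A.holonomyBundle p₀) {a : ℝ} (ha : a ∈ Set.Icc (0 : ℝ) 1) :
    c a ∈ A.holonomyBundle p₀ :=
  Relation.ReflTransGen.tail h0 ⟨fun σ => c (a * σ), h.segment ha, by simp, by simp⟩

omit [HermitianScalars 𝕂] in
theorem Connection.HorizontalAt.continuousWithinAt {s : LocalSection M P} {τ : ℝ}
    (h : A.HorizontalAt s c τ) :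
    ContinuousWithinAt (fun σ => B.trans (s.sec (B.proj (c σ))) (c σ)) (Set.Icc 0 1) τ :=
  Topology.IsInducing.subtypeVal.continuousWithinAt_iff.2
    (continuousWithinAt_pi.2 fun i => continuousWithinAt_pi.2 fun j => (h i j).continuousWithinAt)

/-- A locally constant equivariant map on a reduction is constant along horizontal curves. -/
theorem Connection.IsHorizontal.orbit_map_eq (h : A.IsHorizontal c) (hQ : B.IsReduction Q H)
    (hcQ : ∀ τ ∈ Set.Icc (0 : ℝ) 1, c τ ∈ Q) (hfin : (conjOrbit H J).Finite)
    {Φ : P → IsoGroup 𝕂 (Fin n)} (hΦ : ∀ q ∈ Q, Φ q ∈ conjOrbit H J)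
    (hact : ∀ q ∈ Q, ∀ h ∈ H, Φ (B.act q h) = h⁻¹ * Φ q * h)
    (hcont : ∀ s : SectionIn B Q, ContinuousOn (fun x => Φ (s.1.sec x)) s.1.dom) :
    Φ (c 0) = Φ (c 1) := by
  -- A continuous map from an interval to a finite, hence discrete, set is constant.
  refine IsPreconnected.constant_of_mapsTo (isPreconnected_Icc (a := (0 : ℝ)) (b := 1))
    (T := conjOrbit H J) (f := fun τ => Φ (c τ)) hfin.isDiscrete (fun τ hτ => ?_)
    (fun τ hτ => hΦ _ (hcQ τ hτ)) (by simp) (by simp)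
  obtain ⟨s, hxs⟩ := hQ.exists_sectionIn (B.proj (c τ))
  obtain ⟨t, ht, hxt⟩ := B.covers (B.proj (c τ))
  have hopen : IsOpen (s.1.dom ∩ t.dom) := s.2.1.isOpen.inter (B.isOpen_dom t ht)
  have hev := eventually_mem_dom hopen h.base_contMDiffOn hτ ⟨hxs, hxt⟩
  have hγ : ContinuousWithinAt (fun σ => B.proj (c σ)) (Set.Icc 0 1) τ :=
    h.base_contMDiffOn.continuousOn τ hτ
  have h1 : ContinuousWithinAt (fun σ => B.trans (s.1.sec (B.proj (c σ))) (t.sec (B.proj (c σ))))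
      (Set.Icc 0 1) τ :=
    ((s.2.1.smooth_trans (isSmoothSectionOn_of_mem_atlas ht)).continuousOn.continuousAt
      (hopen.mem_nhds ⟨hxs, hxt⟩)).comp_continuousWithinAt (f := fun σ => B.proj (c σ)) hγ
  have h2 := (h.horizontalAt ht hτ hxt).continuousWithinAt
  have h3 : ContinuousWithinAt (fun σ => Φ (s.1.sec (B.proj (c σ)))) (Set.Icc 0 1) τ :=
    ((hcont s).continuousAt (s.2.1.isOpen.mem_nhds hxs)).comp_continuousWithinAt
      (f := fun σ => B.proj (c σ)) hγ
  have h4 := h1.mul h2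
  -- The passage from the section `s` of `Q` to the curve is factored through the atlas section `t`,
  -- since horizontality is available only in gauges of the atlas.
  have hval : ∀ σ ∈ Set.Icc (0 : ℝ) 1, B.proj (c σ) ∈ s.1.dom ∩ t.dom → Φ (c σ) =
      (B.trans (s.1.sec (B.proj (c σ))) (t.sec (B.proj (c σ))) *
        B.trans (t.sec (B.proj (c σ))) (c σ))⁻¹ * Φ (s.1.sec (B.proj (c σ))) *
      (B.trans (s.1.sec (B.proj (c σ))) (t.sec (B.proj (c σ))) *
        B.trans (t.sec (B.proj (c σ))) (c σ)) := by
    intro σ hσ hσ'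
    have e1 : B.proj (s.1.sec (B.proj (c σ))) = B.proj (c σ) := s.proj_eq hσ'.1
    have e2 : B.proj (t.sec (B.proj (c σ))) = B.proj (c σ) := B.proj_sec t ht _ hσ'.2
    rw [trans_mul (e1.trans e2.symm) e2,
      ← hact _ (s.2.2 _ hσ'.1) _ (hQ.trans_mem (s.2.2 _ hσ'.1) (hcQ σ hσ) e1), act_trans e1]
  refine ((h4.inv.mul h3).mul h4).congr_of_eventuallyEq ?_ (hval τ hτ ⟨hxs, hxt⟩)
  filter_upwards [hev, self_mem_nhdsWithin] with σ hσ hσ'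
  exact hval σ hσ' hσ

/-- If some group element has a finite nontrivial orbit under conjugation by `H`, then no reduction
to `H` is holonomy-induced. -/
theorem not_isHolonomyInduced_of_finite_conjOrbit [SimplyConnectedSpace M] (hH : IsHowe H)
    (hQ : B.IsReduction Q H) (hfin : (conjOrbit H J).Finite) (hne : ∃ h ∈ H, h * J ≠ J * h) :
    ¬ B.IsHolonomyInduced Q := by
  rintro ⟨A, p₀, ⟨-, hRQ⟩, hleast⟩
  have hp₀ : p₀ ∈ Q := hRQ Relation.ReflTransGen.refl
  obtain ⟨Φ, hΦ₀, hΦ, hact, hcont⟩ := hQ.exists_orbit_map hfin hp₀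
  have hred := hQ.isReduction_stabilizer hfin hΦ hact hcont
  have hsub : A.holonomyBundle p₀ ⊆ {q ∈ Q | Φ q = J} := by
    intro p hp
    refine ⟨hRQ hp, ?_⟩
    induction hp with
    | refl => exact hΦ₀
    | @tail q q' hq hstep ih =>
      obtain ⟨c, hc, rfl, rfl⟩ := hstep
      rw [← ih]
      exact (hc.orbit_map_eq hQ (fun τ hτ => hRQ (hc.mem_holonomyBundle hq hτ)) hfin hΦ hact
        hcont).symm
  have hle : Q ⊆ {q ∈ Q | Φ q = J} := hleast ⟨⟨_, hH.inf_centralizer _, hred⟩, hsub⟩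
  -- Minimality would put `p₀ h` into the level set of `J`, forcing `h` to commute with `J`.
  obtain ⟨h, hh, hhJ⟩ := hne
  have h1 : Φ (B.act p₀ h) = J := (hle ((hQ.act_mem_iff p₀ hp₀ h).2 hh)).2
  rw [hact p₀ hp₀ h hh, hΦ₀, mul_assoc, inv_mul_eq_iff_eq_mul] at h1
  exact hhJ h1.symm

theorem IsHolonomyInduced.not_hasFactor [SimplyConnectedSpace M] (hH : IsHowe H)
    (hQ : B.IsReduction Q H) (h : B.IsHolonomyInduced Q) :
    ¬ HasFactorO2 H ∧ ¬ HasDoubleFactorO1 H := by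
  constructor
  · intro hf
    obtain ⟨J, hfin, hne⟩ := hf.exists_finite_conjOrbit
    exact not_isHolonomyInduced_of_finite_conjOrbit hH hQ hfin hne h
  · intro hf
    obtain ⟨J, hfin, hne⟩ := hf.exists_finite_conjOrbit
    exact not_isHolonomyInduced_of_finite_conjOrbit hH hQ hfin hne h

end PrincipalBundle

end NotHolonomyInduced

/-! ### Gluing local one-forms to a connection. -/

section GluedConnection

variable {𝕂 : Type*} [NormedRing 𝕂] [StarRing 𝕂] [NormedAlgebra ℝ 𝕂] [HermitianScalars 𝕂]
  {n d : ℕ}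
  {M : Type*} [TopologicalSpace M] [ChartedSpace (EuclideanSpace ℝ (Fin d)) M]
  {P : Type*} {B : PrincipalBundle 𝕂 n d M P} {H : Subgroup (IsoGroup 𝕂 (Fin n))} {Q : Set P}

theorem MatDiffAt.star {F : M → Matrix (Fin n) (Fin n) 𝕂} {x : M} (hF : MatDiffAt (𝓡 d) F x) :
    MatDiffAt (𝓡 d) (fun y => (F y)ᴴ) x := fun i j =>
  ((starCLM 𝕂).hasMFDerivAt.comp x (hF j i).hasMFDerivAt).mdifferentiableAt

theorem dMat_mul_conjTranspose {g : M → IsoGroup 𝕂 (Fin n)} {x : M}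
    (hg : MatDiffAt (𝓡 d) (fun y => (g y).1) x) (v : TangentSpace (𝓡 d) x) :
    dMat (𝓡 d) (fun y => (g y).1) x v * (g x).1ᴴ +
      (g x).1 * (dMat (𝓡 d) (fun y => (g y).1) x v)ᴴ = 0 := by
  have h := dMat_mul (I := 𝓡 d) (F := fun y => (g y).1) (G := fun y => (g y).1ᴴ) (x := x) hg
    hg.star v
  rw [dMat_star hg] at h
  have hu : ∀ y, (g y).1 * (g y).1ᴴ = 1 := fun y => Unitary.coe_mul_star_self (g y)
  simp only [hu] at h
  rw [← h, dMat_const]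

theorem dMat_conjTranspose_mul {g : M → IsoGroup 𝕂 (Fin n)} {x : M}
    (hg : MatDiffAt (𝓡 d) (fun y => (g y).1) x) (v : TangentSpace (𝓡 d) x) :
    (dMat (𝓡 d) (fun y => (g y).1) x v)ᴴ * (g x).1 +
      (g x).1ᴴ * dMat (𝓡 d) (fun y => (g y).1) x v = 0 := by
  have h := dMat_mul (I := 𝓡 d) (F := fun y => (g y).1ᴴ) (G := fun y => (g y).1) (x := x)
    hg.star hg v
  rw [dMat_star hg] at h
  have hu : ∀ y, (g y).1ᴴ * (g y).1 = 1 := fun y => Unitary.coe_star_mul_self (g y)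
  simp only [hu] at h
  rw [← h, dMat_const]

namespace PrincipalBundle

variable (B) in
/-- The transition function from `s` to `t`. -/
def gaugeChange (s t : LocalSection M P) (x : M) : Matrix (Fin n) (Fin n) 𝕂 :=
  (B.trans (s.sec x) (t.sec x)).1

omit [HermitianScalars 𝕂] in
theorem gaugeChange_mul_star (s t : LocalSection M P) (x : M) :
    B.gaugeChange s t x * (B.gaugeChange s t x)ᴴ = 1 :=
  Unitary.coe_mul_star_self (B.trans (s.sec x) (t.sec x))

variable (B) in
/-- The one-form in the gauge `s` of the connection that has the form `η` in the gauge `σ`. -/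
def gaugeForm (s σ : LocalSection M P)
    (η : (x : M) → TangentSpace (𝓡 d) x →ₗ[ℝ] Matrix (Fin n) (Fin n) 𝕂) (x : M) :
    TangentSpace (𝓡 d) x →ₗ[ℝ] Matrix (Fin n) (Fin n) 𝕂 where
  -- With `σ = s g`, this is the transformation law `η = g⁻¹ A g + g⁻¹ dg` solved for `A`.
  toFun v := B.gaugeChange s σ x * η x v * (B.gaugeChange s σ x)ᴴ -
    dMat (𝓡 d) (B.gaugeChange s σ) x v * (B.gaugeChange s σ x)ᴴ
  map_add' v w := by
    rw [map_add, dMat_add_vec]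
    simp only [Matrix.mul_add, Matrix.add_mul]
    abel
  map_smul' c v := by
    rw [map_smul, dMat_smul_vec]
    simp only [Matrix.mul_smul, Matrix.smul_mul, smul_sub, RingHom.id_apply]

omit [HermitianScalars 𝕂] in
theorem gaugeForm_apply (s σ : LocalSection M P)
    (η : (x : M) → TangentSpace (𝓡 d) x →ₗ[ℝ] Matrix (Fin n) (Fin n) 𝕂) (x : M)
    (v : TangentSpace (𝓡 d) x) :
    B.gaugeForm s σ η x v = B.gaugeChange s σ x * η x v * (B.gaugeChange s σ x)ᴴ -
      dMat (𝓡 d) (B.gaugeChange s σ) x v * (B.gaugeChange s σ x)ᴴ := rfl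

variable {s t σ : LocalSection M P}
  {η : (x : M) → TangentSpace (𝓡 d) x →ₗ[ℝ] Matrix (Fin n) (Fin n) 𝕂} {x : M}

theorem matDiffAt_gaugeChange (hs : s ∈ B.atlas) (hσ : σ ∈ B.atlas) (hx : x ∈ s.dom)
    (hx' : x ∈ σ.dom) : MatDiffAt (𝓡 d) (B.gaugeChange s σ) x :=
  (smooth_trans_of_mem hs hσ).matDiffAt ((B.isOpen_dom s hs).inter (B.isOpen_dom σ hσ)) ⟨hx, hx'⟩

theorem gaugeForm_skew (hs : s ∈ B.atlas) (hσ : σ ∈ B.atlas) (hx : x ∈ s.dom) (hx' : x ∈ σ.dom)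
    {v : TangentSpace (𝓡 d) x} (hη : (η x v)ᴴ = -η x v) :
    (B.gaugeForm s σ η x v)ᴴ = -B.gaugeForm s σ η x v := by
  have h := dMat_mul_conjTranspose (g := fun y => B.trans (s.sec y) (σ.sec y))
    (matDiffAt_gaugeChange hs hσ hx hx') v
  change dMat (𝓡 d) (B.gaugeChange s σ) x v * (B.gaugeChange s σ x)ᴴ + B.gaugeChange s σ x *
    (dMat (𝓡 d) (B.gaugeChange s σ) x v)ᴴ = 0 at h
  simp only [gaugeForm_apply, Matrix.conjTranspose_sub, Matrix.conjTranspose_mul,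
    Matrix.conjTranspose_conjTranspose, hη]
  rw [eq_neg_of_add_eq_zero_right h]
  simp only [Matrix.neg_mul, Matrix.mul_neg, Matrix.mul_assoc]
  abel

theorem gaugeForm_smooth [IsManifold (𝓡 d) ∞ M] (hs : s ∈ B.atlas) (hσ : σ ∈ B.atlas)
    (hη : MatSmoothOn (𝓡 d).tangent (fun v : TangentBundle (𝓡 d) M => η v.proj v.snd)
      {v | v.proj ∈ σ.dom}) :
    MatSmoothOn (𝓡 d).tangent (fun v : TangentBundle (𝓡 d) M => B.gaugeForm s σ η v.proj v.snd)
      {v | v.proj ∈ s.dom ∩ σ.dom} := by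
  have h1 : MatSmoothOn (𝓡 d) (B.gaugeChange s σ) (s.dom ∩ σ.dom) := smooth_trans_of_mem hs hσ
  have h2 := h1.dMat_tangent ((B.isOpen_dom s hs).inter (B.isOpen_dom σ hσ))
  have h3 : MatSmoothOn (𝓡 d).tangent (fun v : TangentBundle (𝓡 d) M => B.gaugeChange s σ v.proj)
      {v | v.proj ∈ s.dom ∩ σ.dom} := fun i j =>
    (h1 i j).comp (Bundle.contMDiff_proj _).contMDiffOn fun v hv => hv
  exact ((h3.mul (hη.mono fun v hv => hv.2)).mul h3.star).sub (h2.mul h3.star)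

/-- The cocycle identity `gaugeChange t σ = (gaugeChange s t)⁻¹ gaugeChange s σ` is differentiated
by the product rule. -/
theorem gaugeForm_transform (hs : s ∈ B.atlas) (ht : t ∈ B.atlas) (hσ : σ ∈ B.atlas)
    (hxs : x ∈ s.dom) (hxt : x ∈ t.dom) (hx' : x ∈ σ.dom) (v : TangentSpace (𝓡 d) x) :
    B.gaugeForm t σ η x v =
      (B.gaugeChange s t x)ᴴ * B.gaugeForm s σ η x v * B.gaugeChange s t x +
        (B.gaugeChange s t x)ᴴ * dMat (𝓡 d) (B.gaugeChange s t) x v := by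
  have hopen : IsOpen (s.dom ∩ t.dom ∩ σ.dom) :=
    ((B.isOpen_dom s hs).inter (B.isOpen_dom t ht)).inter (B.isOpen_dom σ hσ)
  have heq : ∀ y ∈ s.dom ∩ t.dom ∩ σ.dom, B.gaugeChange t σ y =
      (B.gaugeChange s t y)ᴴ * B.gaugeChange s σ y := by
    intro y hy
    have e1 : B.proj (s.sec y) = y := B.proj_sec s hs y hy.1.1
    have e2 : B.proj (t.sec y) = y := B.proj_sec t ht y hy.1.2
    have e3 : B.proj (σ.sec y) = y := B.proj_sec σ hσ y hy.2
    have : B.trans (t.sec y) (σ.sec y) = (B.trans (s.sec y) (t.sec y))⁻¹ *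
        B.trans (s.sec y) (σ.sec y) := by
      rw [trans_inv (e1.trans e2.symm), trans_mul (e2.trans e1.symm) (e1.trans e3.symm)]
    exact congrArg Subtype.val this
  have hg := matDiffAt_gaugeChange hs ht hxs hxt
  have ha := matDiffAt_gaugeChange hs hσ hxs hx'
  have hd := dMat_congr (I := 𝓡 d) (Filter.eventually_of_mem (hopen.mem_nhds ⟨⟨hxs, hxt⟩, hx'⟩) heq) v
  rw [dMat_mul hg.star ha, dMat_star hg] at hd
  have hgd := dMat_conjTranspose_mul (g := fun y => B.trans (s.sec y) (t.sec y)) hg v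
  change (dMat (𝓡 d) (B.gaugeChange s t) x v)ᴴ * B.gaugeChange s t x + (B.gaugeChange s t x)ᴴ *
    dMat (𝓡 d) (B.gaugeChange s t) x v = 0 at hgd
  rw [gaugeForm_apply, gaugeForm_apply, hd, heq x ⟨⟨hxs, hxt⟩, hx'⟩]
  rw [eq_neg_of_add_eq_zero_right hgd]
  have hu := gaugeChange_mul_star (B := B) s σ x
  simp only [Matrix.conjTranspose_mul, Matrix.conjTranspose_conjTranspose, Matrix.add_mul,
    Matrix.mul_sub, Matrix.sub_mul, Matrix.mul_assoc]
  rw [← Matrix.mul_assoc (B.gaugeChange s σ x) (B.gaugeChange s σ x)ᴴ, hu, Matrix.one_mul]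
  abel

omit [HermitianScalars 𝕂] in
theorem gaugeForm_self (v : TangentSpace (𝓡 d) x) :
    B.gaugeForm σ σ η x v = η x v := by
  have h : B.gaugeChange σ σ = fun _ => (1 : Matrix (Fin n) (Fin n) 𝕂) := by
    ext1 y
    rw [gaugeChange, trans_self (B := B)]
    rfl
  rw [gaugeForm_apply, h, dMat_const]
  simp

/-- In gauges belonging to a Howe subbundle, `gaugeForm` stays in the algebra of the structure
group. -/
theorem gaugeForm_mem (hs : s ∈ B.atlas) (hσ : σ ∈ B.atlas) (hx : x ∈ s.dom) (hx' : x ∈ σ.dom)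
    (hH : IsHowe H) (hQ : B.IsReduction Q H) (hsQ : ∀ y ∈ s.dom, s.sec y ∈ Q)
    (hσQ : ∀ y ∈ σ.dom, σ.sec y ∈ Q) {v : TangentSpace (𝓡 d) x}
    (hη : η x v ∈ doubleCommutant H) : B.gaugeForm s σ η x v ∈ doubleCommutant H := by
  have hopen := (B.isOpen_dom s hs).inter (B.isOpen_dom σ hσ)
  have ha : ∀ y ∈ s.dom ∩ σ.dom, B.gaugeChange s σ y ∈ doubleCommutant H := fun y hy =>
    (hH.mem_iff _).1 (hQ.trans_mem (hsQ y hy.1) (hσQ y hy.2) (by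
      rw [B.proj_sec s hs y hy.1, B.proj_sec σ hσ y hy.2]))
  -- The algebra is cut out by the linear equations `z X = X z`, which survive differentiation.
  have hda : dMat (𝓡 d) (B.gaugeChange s σ) x v ∈ doubleCommutant H := by
    rw [mem_doubleCommutant_iff]
    intro z hz
    have h1 := matDiffAt_gaugeChange hs hσ hx hx'
    have hc : MatDiffAt (𝓡 d) (fun _ : M => z.1) x := fun i j => mdifferentiableAt_const
    have h2 := dMat_mul hc h1 v
    have h3 := dMat_mul h1 hc v
    rw [dMat_const] at h2 h3
    have h4 := dMat_congr (I := 𝓡 d) (F := fun y => z.1 * B.gaugeChange s σ y)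
      (G := fun y => B.gaugeChange s σ y * z.1) (x := x)
      (Filter.eventually_of_mem (hopen.mem_nhds ⟨hx, hx'⟩) fun y hy =>
        mem_doubleCommutant_iff.1 (ha y hy) z hz) v
    rw [h2, h3, Matrix.zero_mul, Matrix.mul_zero, zero_add, add_zero] at h4
    exact h4
  have ha' : (B.gaugeChange s σ x)ᴴ ∈ doubleCommutant H := star_mem (ha x ⟨hx, hx'⟩)
  rw [gaugeForm_apply]
  exact sub_mem (mul_mem (mul_mem (ha x ⟨hx, hx'⟩) hη) ha') (mul_mem hda ha')

variable [IsManifold (𝓡 d) ∞ M] {ι : Type*}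

open Classical in
/-- The connection glued from one-forms in local gauges by a partition of unity. -/
def glueConnection (σ : ι → LocalSection M P) (hσ : ∀ i, σ i ∈ B.atlas)
    (η : ι → (x : M) → TangentSpace (𝓡 d) x →ₗ[ℝ] Matrix (Fin n) (Fin n) 𝕂)
    (hskew : ∀ i, ∀ x ∈ (σ i).dom, ∀ v, (η i x v)ᴴ = -η i x v)
    (hη : ∀ i, MatSmoothOn (𝓡 d).tangent (fun v : TangentBundle (𝓡 d) M => η i v.proj v.snd)
      {v | v.proj ∈ (σ i).dom})
    (ρ : SmoothPartitionOfUnity ι (𝓡 d) M Set.univ) (hρ : ρ.IsSubordinate fun i => (σ i).dom) :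
    B.Connection where
  form s x := ∑ i ∈ ρ.finsupport x, ρ i x • B.gaugeForm s (σ i) (η i) x
  skew s hs x hx v := by
    rw [skewAdjoint.mem_iff, Matrix.star_eq_conjTranspose]
    simp only [LinearMap.sum_apply, LinearMap.smul_apply, Matrix.conjTranspose_sum,
      ← Finset.sum_neg_distrib]
    refine Finset.sum_congr rfl fun i hi => ?_
    have hx' : x ∈ (σ i).dom := hρ i (subset_tsupport _ ((ρ.mem_finsupport x).1 hi))
    rw [Matrix.conjTranspose_smul, gaugeForm_skew hs (hσ i) hx hx' (hskew i x hx' v), smul_neg]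
    simp
  smooth s hs := by
    refine matSmoothOn_of_locally fun v₀ hv₀ => ?_
    -- Near a given point the varying index set of the sum is contained in one fixed finite set, so
    -- smoothness reduces to finitely many summands.
    have hev := ρ.eventually_finsupport_subset v₀.proj
    obtain ⟨V, hV, hVo, hxV⟩ := eventually_nhds_iff.1 hev
    let D : Set M := V ∩ s.dom ∩ ⋂ i ∈ ρ.fintsupport v₀.proj, (σ i).dom
    have hDo : IsOpen D := (hVo.inter (B.isOpen_dom s hs)).inter
      (isOpen_biInter_finset fun i _ => B.isOpen_dom _ (hσ i))
    refine ⟨{v | v.proj ∈ D}, hDo.preimage (FiberBundle.continuous_proj _ _),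
      ⟨⟨hxV, hv₀⟩, Set.mem_iInter₂.2 fun i hi => hρ i ((ρ.mem_fintsupport_iff _ _).1 hi)⟩, ?_⟩
    have h1 : MatSmoothOn (𝓡 d).tangent (fun v : TangentBundle (𝓡 d) M =>
        ∑ i ∈ ρ.fintsupport v₀.proj, ρ i v.proj • B.gaugeForm s (σ i) (η i) v.proj v.snd)
        ({v | v.proj ∈ s.dom} ∩ {v | v.proj ∈ D}) := by
      refine MatSmoothOn.sum fun i hi => MatSmoothOn.smul ?_ ?_
      · exact ((ρ i).contMDiff.comp (Bundle.contMDiff_proj _)).contMDiffOn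
      · exact (gaugeForm_smooth hs (hσ i) (hη i)).mono fun v hv =>
          ⟨hv.1, Set.mem_iInter₂.1 hv.2.2 i hi⟩
    refine h1.congr fun v hv => ?_
    simp only [LinearMap.sum_apply, LinearMap.smul_apply]
    refine Finset.sum_subset (hV _ hv.2.1.1) fun i _ hi => ?_
    have : ρ i v.proj = 0 := by simpa using hi
    rw [this, zero_smul]
  transform s hs t ht g hg x hx v := by
    have hopen := (B.isOpen_dom s hs).inter (B.isOpen_dom t ht)
    have hg' : ∀ y ∈ s.dom ∩ t.dom, (g y).1 = B.gaugeChange s t y := fun y hy =>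
      congrArg Subtype.val (trans_eq (hg y hy)).symm
    have hd := dMat_congr (I := 𝓡 d) (Filter.eventually_of_mem (hopen.mem_nhds hx) hg') v
    change _ = (g x).1ᴴ * _ * (g x).1 + (g x).1ᴴ * dMat (𝓡 d) (fun y => (g y).1) x v
    rw [hd, hg' x hx]
    simp only [LinearMap.sum_apply, LinearMap.smul_apply, Matrix.mul_sum, Matrix.sum_mul]
    -- The inhomogeneous term is the same for all `i`, and the weights sum to one; thus averages of
    -- connections are connections.
    have h1 : (B.gaugeChange s t x)ᴴ * dMat (𝓡 d) (B.gaugeChange s t) x v =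
        ∑ i ∈ ρ.finsupport x, ρ i x •
          ((B.gaugeChange s t x)ᴴ * dMat (𝓡 d) (B.gaugeChange s t) x v) := by
      rw [← Finset.sum_smul, ρ.sum_finsupport x (Set.mem_univ x), one_smul]
    rw [h1, ← Finset.sum_add_distrib]
    refine Finset.sum_congr rfl fun i hi => ?_
    have hx' : x ∈ (σ i).dom := hρ i (subset_tsupport _ ((ρ.mem_finsupport x).1 hi))
    rw [gaugeForm_transform hs ht (hσ i) hx.1 hx.2 hx', smul_add, Matrix.mul_smul, Matrix.smul_mul]

section

variable {σ : ι → LocalSection M P} {hσ : ∀ i, σ i ∈ B.atlas}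
    {η : ι → (x : M) → TangentSpace (𝓡 d) x →ₗ[ℝ] Matrix (Fin n) (Fin n) 𝕂}
    {hskew : ∀ i, ∀ x ∈ (σ i).dom, ∀ v, (η i x v)ᴴ = -η i x v}
    {hη : ∀ i, MatSmoothOn (𝓡 d).tangent (fun v : TangentBundle (𝓡 d) M => η i v.proj v.snd)
      {v | v.proj ∈ (σ i).dom}}
    {ρ : SmoothPartitionOfUnity ι (𝓡 d) M Set.univ} {hρ : ρ.IsSubordinate fun i => (σ i).dom}

theorem glueConnection_form_apply (s : LocalSection M P) (v : TangentSpace (𝓡 d) x) :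
    (glueConnection σ hσ η hskew hη ρ hρ).form s x v =
      ∑ i ∈ ρ.finsupport x, ρ i x • B.gaugeForm s (σ i) (η i) x v := by
  simp [glueConnection]

theorem glueConnection_form_mem (hH : IsHowe H) (hQ : B.IsReduction Q H)
    (hσQ : ∀ i, ∀ y ∈ (σ i).dom, (σ i).sec y ∈ Q)
    (hηH : ∀ i, ∀ y ∈ (σ i).dom, ∀ v, η i y v ∈ doubleCommutant H) (hs : s ∈ B.atlas)
    (hsQ : ∀ y ∈ s.dom, s.sec y ∈ Q) (hx : x ∈ s.dom) (v : TangentSpace (𝓡 d) x) :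
    (glueConnection σ hσ η hskew hη ρ hρ).form s x v ∈ doubleCommutant H := by
  rw [glueConnection_form_apply]
  refine sum_mem fun i hi => ?_
  have hx' : x ∈ (σ i).dom := hρ i (subset_tsupport _ ((ρ.mem_finsupport x).1 hi))
  exact SMulMemClass.smul_mem _
    (gaugeForm_mem hs (hσ i) hx hx' hH hQ hsQ (hσQ i) (hηH i x hx' v))

theorem glueConnection_form_eq {i : ι} (hi : ∀ j, j ≠ i → ρ j x = 0)
    (v : TangentSpace (𝓡 d) x) :
    (glueConnection σ hσ η hskew hη ρ hρ).form (σ i) x v = η i x v := by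
  have h1 : ρ.finsupport x ⊆ {i} := fun j hj => by
    rw [Finset.mem_singleton]
    by_contra hne
    exact (ρ.mem_finsupport x).1 hj (hi j hne)
  have h2 := ρ.sum_finsupport' x (Set.mem_univ x) h1
  rw [Finset.sum_singleton] at h2
  rw [glueConnection_form_apply, Finset.sum_subset h1, Finset.sum_singleton, h2, one_smul,
    gaugeForm_self]
  intro j _ hj
  have : ρ j x = 0 := by simpa using hj
  rw [this, zero_smul]

end

end PrincipalBundle

end GluedConnection

/-! ### Matrix exponentials and the parallel transport equation. -/

section MatrixODE

open scoped Matrix.Norms.Operator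

variable {𝕂 : Type*} [NormedRing 𝕂] [StarRing 𝕂] [NormedAlgebra ℝ 𝕂] [HermitianScalars 𝕂]
  {n : ℕ}

theorem HasMatDerivWithin.of_hasDerivWithinAt {k : ℝ → Matrix (Fin n) (Fin n) 𝕂}
    {k' : Matrix (Fin n) (Fin n) 𝕂} {s : Set ℝ} {τ : ℝ} (h : HasDerivWithinAt k k' s τ) :
    HasMatDerivWithin k k' s τ := fun i j =>
  (LinearMap.toContinuousLinearMap
    (Matrix.entryLinearMap ℝ 𝕂 i j)).hasFDerivAt.comp_hasDerivWithinAt τ h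

theorem hasMatDerivWithin_exp (Y : Matrix (Fin n) (Fin n) 𝕂) (s : Set ℝ) (τ : ℝ) :
    HasMatDerivWithin (fun σ : ℝ => NormedSpace.exp (σ • Y)) (Y * NormedSpace.exp (τ • Y)) s τ :=
  HasMatDerivWithin.of_hasDerivWithinAt (hasDerivAt_exp_smul_const' Y τ).hasDerivWithinAt

/-- For skew `Y` the derivative of `kᴴ k` along `k = exp (σ Y)` vanishes. -/
theorem exp_smul_mem_unitary {Y : Matrix (Fin n) (Fin n) 𝕂} (hY : Yᴴ = -Y) (τ : ℝ) :
    NormedSpace.exp (τ • Y) ∈ unitary (Matrix (Fin n) (Fin n) 𝕂) := by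
  have h1 : ∀ σ ∈ (Set.univ : Set ℝ), HasMatDerivWithin
      (fun σ : ℝ => (NormedSpace.exp (σ • Y))ᴴ * NormedSpace.exp (σ • Y)) 0 Set.univ σ := by
    intro σ _
    have h2 := hasMatDerivWithin_exp Y Set.univ σ
    have h3 := h2.star.mul h2
    rw [Matrix.conjTranspose_mul, hY] at h3
    simpa [Matrix.mul_assoc] using h3
  have h2 := eq_of_hasMatDerivWithin_zero convex_univ h1 (Set.mem_univ τ) (Set.mem_univ 0)
  rw [zero_smul, NormedSpace.exp_zero, Matrix.conjTranspose_one, Matrix.one_mul] at h2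
  exact Unitary.mem_iff.2 ⟨h2, mul_conjTranspose_eq_one_comm h2⟩

/-- A matrix that commutes with a one-parameter group commutes with its generator. -/
theorem mul_comm_of_mul_exp_comm {z Y : Matrix (Fin n) (Fin n) 𝕂} {δ : ℝ} (hδ : 0 < δ)
    (h : ∀ τ ∈ Set.Icc 0 δ, z * NormedSpace.exp (τ • Y) = NormedSpace.exp (τ • Y) * z) :
    z * Y = Y * z := by
  have h0 : (0 : ℝ) ∈ Set.Icc 0 δ := ⟨le_rfl, hδ.le⟩
  have h1 := hasMatDerivWithin_exp Y (Set.Icc 0 δ) 0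
  have h2 := (hasMatDerivWithin_const (s := Set.Icc 0 δ) (τ := 0) z).mul h1
  have h3 := h1.mul (hasMatDerivWithin_const (s := Set.Icc 0 δ) (τ := 0) z)
  have h4 := h2.congr (l := fun σ => NormedSpace.exp (σ • Y) * z)
    (Filter.eventually_of_mem self_mem_nhdsWithin fun σ hσ => (h σ hσ).symm) (h 0 h0).symm
  ext i j
  have h5 := (uniqueDiffOn_Icc hδ 0 h0).eq_deriv _ (h4 i j) (h3 i j)
  simpa using h5

/-- Unitary solutions of a linear differential equation with small skew-adjoint coefficient. -/
theorem exists_unitary_solution {a : ℝ → Matrix (Fin n) (Fin n) 𝕂}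
    (ha : ∀ i j, ContinuousOn (fun τ => a τ i j) (Set.Icc 0 1))
    (hskew : ∀ τ ∈ Set.Icc (0 : ℝ) 1, (a τ)ᴴ = -a τ)
    (hsmall : ∀ τ ∈ Set.Icc (0 : ℝ) 1, ∀ i j, n * ‖a τ i j‖ ≤ 1 / 2) :
    ∃ K : ℝ → IsoGroup 𝕂 (Fin n), K 0 = 1 ∧ ∀ τ ∈ Set.Icc (0 : ℝ) 1,
      HasMatDerivWithin (fun σ => (K σ).1) (-(a τ * (K τ).1)) (Set.Icc 0 1) τ := by
  have hnorm : ∀ τ ∈ Set.Icc (0 : ℝ) 1, ‖a τ‖ ≤ 1 / 2 := by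
    intro τ hτ
    rw [Matrix.linfty_opNorm_def]
    have : (Finset.univ.sup fun i => ∑ j, ‖a τ i j‖₊) ≤ (1 / 2 : NNReal) := by
      refine Finset.sup_le fun i _ => ?_
      rcases Nat.eq_zero_or_pos n with hn | hn
      · subst hn; exact i.elim0
      · rw [← NNReal.coe_le_coe]
        push_cast
        have hn' : (0 : ℝ) < n := by exact_mod_cast hn
        calc ∑ j, ‖a τ i j‖ ≤ ∑ _j : Fin n, 1 / 2 / (n : ℝ) :=
              Finset.sum_le_sum fun j _ => by
                rw [le_div_iff₀ hn', mul_comm]; exact hsmall τ hτ i j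
          _ = 1 / 2 := by simp; field_simp
    exact_mod_cast this
  have hone : ‖(1 : Matrix (Fin n) (Fin n) 𝕂)‖ ≤ 1 := by
    have h1 : ‖(1 : 𝕂)‖ = 1 := by
      have h2 := HermitianScalars.star_mul_self (1 : 𝕂)
      rw [star_one, one_mul, eq_comm, FaithfulSMul.algebraMap_eq_one_iff] at h2
      exact (pow_eq_one_iff_of_nonneg (norm_nonneg _) two_ne_zero).1 h2
    rw [← Matrix.diagonal_one, Matrix.linfty_opNorm_diagonal]
    exact (pi_norm_le_iff_of_nonneg zero_le_one).2 fun _ => h1.le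
  -- On the unit ball about `1` one has `‖k‖ ≤ 2`, so `‖a‖ ≤ 1/2` bounds the speed by `1`, and the
  -- solution cannot leave the ball before time `1`.
  have hPL : IsPicardLindelof (fun τ k => -(a τ * k)) (tmin := 0) (tmax := 1) ⟨0, by simp⟩
      (1 : Matrix (Fin n) (Fin n) 𝕂) 1 0 1 1 := by
    refine ⟨fun τ hτ => ?_, fun k _ => ?_, fun τ hτ k hk => ?_, by simp⟩
    · refine LipschitzOnWith.of_dist_le_mul fun k _ l _ => ?_
      rw [dist_eq_norm, dist_eq_norm, neg_sub_neg, ← mul_sub, ← norm_neg, ← mul_neg, neg_sub]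
      refine (norm_mul_le _ _).trans (mul_le_mul_of_nonneg_right ?_ (norm_nonneg _))
      exact (hnorm τ hτ).trans (by norm_num)
    · have h1 : ContinuousOn a (Set.Icc 0 1) :=
        continuousOn_pi.2 fun i => continuousOn_pi.2 fun j => ha i j
      exact (h1.mul continuousOn_const).neg
    · rw [norm_neg]
      have h1 : ‖k‖ ≤ 2 := by
        have := norm_sub_norm_le k 1
        have h3 : ‖k - 1‖ ≤ 1 := by simpa [dist_eq_norm] using hk
        linarith
      refine (norm_mul_le _ _).trans ?_
      have h2 := hnorm τ hτ
      have := mul_le_mul h2 h1 (norm_nonneg _) (by norm_num)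
      simpa using this
  obtain ⟨k, hk0, hk⟩ := hPL.exists_eq_forall_mem_Icc_hasDerivWithinAt₀
  have hk' : ∀ τ ∈ Set.Icc (0 : ℝ) 1, HasMatDerivWithin k (-(a τ * k τ)) (Set.Icc 0 1) τ :=
    fun τ hτ => HasMatDerivWithin.of_hasDerivWithinAt (hk τ hτ)
  have hunit : ∀ τ ∈ Set.Icc (0 : ℝ) 1, (k τ)ᴴ * k τ = 1 := by
    intro τ hτ
    have h1 : ∀ σ ∈ Set.Icc (0 : ℝ) 1,
        HasMatDerivWithin (fun σ => (k σ)ᴴ * k σ) 0 (Set.Icc 0 1) σ := by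
      intro σ hσ
      have h2 := (hk' σ hσ).star.mul (hk' σ hσ)
      rw [Matrix.conjTranspose_neg, Matrix.conjTranspose_mul, hskew σ hσ] at h2
      simpa [Matrix.mul_assoc] using h2
    have h2 := eq_of_hasMatDerivWithin_zero (convex_Icc 0 1) h1 hτ
      (Set.left_mem_Icc.2 zero_le_one)
    have h3 : k 0 = 1 := hk0
    rw [h2, h3]; simp
  classical
  have hmem : ∀ τ ∈ Set.Icc (0 : ℝ) 1, k τ ∈ unitary (Matrix (Fin n) (Fin n) 𝕂) := fun τ hτ =>
    Unitary.mem_iff.2 ⟨hunit τ hτ, mul_conjTranspose_eq_one_comm (hunit τ hτ)⟩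
  -- The value outside `[0, 1]` is arbitrary, as all derivatives are taken within that interval.
  let K : ℝ → IsoGroup 𝕂 (Fin n) := fun τ =>
    if h : τ ∈ Set.Icc (0 : ℝ) 1 then ⟨k τ, hmem τ h⟩ else 1
  have hK : ∀ τ ∈ Set.Icc (0 : ℝ) 1, (K τ).1 = k τ := fun τ hτ => by simp only [K, dif_pos hτ]
  refine ⟨K, Subtype.ext ((hK 0 (by simp)).trans hk0), fun τ hτ => ?_⟩
  rw [hK τ hτ]
  exact (hk' τ hτ).congr (Filter.eventually_of_mem self_mem_nhdsWithin hK) (hK τ hτ)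

end MatrixODE

/-! ### Horizontal curves over coordinate segments. -/

section Segments

variable {𝕂 : Type*} [NormedRing 𝕂] [StarRing 𝕂] [NormedAlgebra ℝ 𝕂] [HermitianScalars 𝕂]
  {n d : ℕ}
  {M : Type*} [TopologicalSpace M] [ChartedSpace (EuclideanSpace ℝ (Fin d)) M]
  {P : Type*} {B : PrincipalBundle 𝕂 n d M P}
  {ψ : EuclideanSpace ℝ (Fin d) → M} {U : Set (EuclideanSpace ℝ (Fin d))}
  {y z : EuclideanSpace ℝ (Fin d)}

/-- The image under `ψ` of a straight segment. -/
def segmentCurve (ψ : EuclideanSpace ℝ (Fin d) → M) (y z : EuclideanSpace ℝ (Fin d)) (τ : ℝ) : M :=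
  ψ (AffineMap.lineMap y z τ)

theorem contMDiffOn_segmentCurve (hU : Convex ℝ U) (hψ : ContMDiffOn (𝓡 d) (𝓡 d) ∞ ψ U)
    (hy : y ∈ U) (hz : z ∈ U) :
    ContMDiffOn 𝓘(ℝ, ℝ) (𝓡 d) 1 (segmentCurve ψ y z) (Set.Icc 0 1) := by
  have h1 : ContMDiff 𝓘(ℝ, ℝ) (𝓡 d) 1 (fun τ : ℝ => AffineMap.lineMap y z τ) := by
    simp only [AffineMap.lineMap_apply_module']
    exact ((contDiff_id.smul contDiff_const).add contDiff_const).contMDiff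
  exact (hψ.of_le (by simp)).comp h1.contMDiffOn fun τ hτ => hU.lineMap_mem hy hz hτ

theorem mfderivWithin_segmentCurve (hUo : IsOpen U) (hU : Convex ℝ U)
    (hψ : ContMDiffOn (𝓡 d) (𝓡 d) ∞ ψ U) (hy : y ∈ U) (hz : z ∈ U) {τ : ℝ}
    (hτ : τ ∈ Set.Icc (0 : ℝ) 1) :
    mfderivWithin 𝓘(ℝ, ℝ) (𝓡 d) (segmentCurve ψ y z) (Set.Icc 0 1) τ (1 : ℝ) =
      mfderiv (𝓡 d) (𝓡 d) ψ (AffineMap.lineMap y z τ) (z - y) := by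
  have hmem := hU.lineMap_mem hy hz hτ
  have h1 := ((hψ.contMDiffAt (hUo.mem_nhds hmem)).mdifferentiableAt (by simp)).hasMFDerivAt
  have h2 : HasMFDerivWithinAt 𝓘(ℝ, ℝ) (𝓡 d) (fun τ : ℝ => AffineMap.lineMap y z τ)
      (Set.Icc 0 1) τ (ContinuousLinearMap.toSpanSingleton ℝ (z - y)) := by
    have h2' : HasFDerivWithinAt (fun τ : ℝ => AffineMap.lineMap y z τ)
        (ContinuousLinearMap.toSpanSingleton ℝ (z - y)) (Set.Icc 0 1) τ :=
      AffineMap.hasDerivWithinAt_lineMap.hasFDerivWithinAt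
    exact hasMFDerivWithinAt_iff_hasFDerivWithinAt.2 h2'
  have h3 := (h1.comp_hasMFDerivWithinAt τ h2).mfderivWithin
    (uniqueMDiffWithinAt_iff_uniqueDiffWithinAt.2 (uniqueDiffOn_Icc_zero_one τ hτ))
  refine (congrArg (fun L : ℝ →L[ℝ] EuclideanSpace ℝ (Fin d) => L (1 : ℝ)) h3).trans ?_
  let L : EuclideanSpace ℝ (Fin d) →L[ℝ] EuclideanSpace ℝ (Fin d) :=
    mfderiv (𝓡 d) (𝓡 d) ψ (AffineMap.lineMap y z τ)
  change L ((1 : ℝ) • (z - y)) = L (z - y)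
  rw [one_smul]

namespace PrincipalBundle

variable [IsManifold (𝓡 d) ∞ M] {A : B.Connection} {s : LocalSection M P}

/-- The local connection form in the gauge `s`, pulled back along `ψ`. -/
def Connection.pullback (A : B.Connection) (s : LocalSection M P)
    (ψ : EuclideanSpace ℝ (Fin d) → M) (y v : EuclideanSpace ℝ (Fin d)) :
    Matrix (Fin n) (Fin n) 𝕂 :=
  A.form s (ψ y) (mfderiv (𝓡 d) (𝓡 d) ψ y v)

omit [HermitianScalars 𝕂] in
theorem Connection.continuousOn_pullback (hs : s ∈ B.atlas) (hUo : IsOpen U)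
    (hψ : ContMDiffOn (𝓡 d) (𝓡 d) ∞ ψ U) (hUs : Set.MapsTo ψ U s.dom) (i j : Fin n) :
    ContinuousOn (fun p : EuclideanSpace ℝ (Fin d) × EuclideanSpace ℝ (Fin d) =>
      A.pullback s ψ p.1 p.2 i j) (U ×ˢ Set.univ) := by
  have h1 := hψ.continuousOn_tangentMapWithin (by simp) hUo.uniqueMDiffOn
  have h2 : ContinuousOn (fun p : EuclideanSpace ℝ (Fin d) × EuclideanSpace ℝ (Fin d) =>
      tangentMapWithin (𝓡 d) (𝓡 d) ψ U ((tangentBundleModelSpaceHomeomorph (𝓡 d)).symm p))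
      (U ×ˢ Set.univ) :=
    h1.comp (tangentBundleModelSpaceHomeomorph (𝓡 d)).symm.continuous.continuousOn fun p hp => hp.1
  refine ((A.smooth s hs i j).continuousOn.comp h2 fun p hp => hUs hp.1).congr fun p hp => ?_
  have h3 := mfderivWithin_of_isOpen (I := 𝓡 d) (I' := 𝓡 d) (f := ψ) hUo hp.1
  have h4 : (mfderiv (𝓡 d) (𝓡 d) ψ p.1 p.2 : EuclideanSpace ℝ (Fin d)) =
      mfderivWithin (𝓡 d) (𝓡 d) ψ U p.1 p.2 :=
    congrArg (fun L : EuclideanSpace ℝ (Fin d) →L[ℝ] EuclideanSpace ℝ (Fin d) => L p.2) h3.symm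
  exact congrArg (fun v : EuclideanSpace ℝ (Fin d) => A.form s (ψ p.1) v i j) h4

/-- Horizontal curves over the image of a segment, from solutions of the parallel transport
equation. -/
theorem Connection.isHorizontal_segmentCurve (hs : s ∈ B.atlas) (hUo : IsOpen U)
    (hU : Convex ℝ U) (hψ : ContMDiffOn (𝓡 d) (𝓡 d) ∞ ψ U) (hUs : Set.MapsTo ψ U s.dom)
    (hy : y ∈ U) (hz : z ∈ U) {K : ℝ → IsoGroup 𝕂 (Fin n)}
    (hK : ∀ τ ∈ Set.Icc (0 : ℝ) 1, HasMatDerivWithin (fun σ => (K σ).1)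
      (-(A.pullback s ψ (AffineMap.lineMap y z τ) (z - y) * (K τ).1)) (Set.Icc 0 1) τ) :
    A.IsHorizontal fun τ => B.act (s.sec (segmentCurve ψ y z τ)) (K τ) := by
  set c : ℝ → P := fun τ => B.act (s.sec (segmentCurve ψ y z τ)) (K τ) with hc
  have hdom : ∀ τ ∈ Set.Icc (0 : ℝ) 1, segmentCurve ψ y z τ ∈ s.dom := fun τ hτ =>
    hUs (hU.lineMap_mem hy hz hτ)
  have hproj : ∀ τ ∈ Set.Icc (0 : ℝ) 1, B.proj (c τ) = segmentCurve ψ y z τ := fun τ hτ => by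
    rw [hc, B.proj_act, B.proj_sec s hs _ (hdom τ hτ)]
  refine Connection.isHorizontal_of_horizontalAt
    ((contMDiffOn_segmentCurve hU hψ hy hz).congr hproj) fun τ hτ => ?_
  refine ⟨s, hs, by rw [hproj τ hτ]; exact hdom τ hτ, ?_⟩
  have htr : ∀ σ ∈ Set.Icc (0 : ℝ) 1, B.trans (s.sec (B.proj (c σ))) (c σ) = K σ := fun σ hσ => by
    rw [hproj σ hσ]; exact trans_act _ _
  have hform : A.form s (B.proj (c τ))
      (mfderivWithin 𝓘(ℝ, ℝ) (𝓡 d) (fun σ => B.proj (c σ)) (Set.Icc 0 1) τ (1 : ℝ)) =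
      A.pullback s ψ (AffineMap.lineMap y z τ) (z - y) := by
    have h1 : ∀ (x x' : M), x = x' → ∀ v : EuclideanSpace ℝ (Fin d),
        A.form s x v = A.form s x' v := by rintro x _ rfl v; rfl
    have h2 := mfderivWithin_congr (I := 𝓘(ℝ, ℝ)) (I' := 𝓡 d) hproj (hproj τ hτ)
    have h3 := congrArg (fun L : ℝ →L[ℝ] EuclideanSpace ℝ (Fin d) => L (1 : ℝ)) h2
    refine (h1 _ _ (hproj τ hτ) _).trans (congrArg (A.form s (segmentCurve ψ y z τ))
      (h3.trans (mfderivWithin_segmentCurve hUo hU hψ hy hz hτ)))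
  rw [Connection.HorizontalAt, hform, htr τ hτ]
  refine (hK τ hτ).congr ?_ (by rw [htr τ hτ])
  filter_upwards [self_mem_nhdsWithin] with σ hσ
  rw [htr σ hσ]

/-- Every point of the base has a neighbourhood in which any two points are joined by horizontal
curves with arbitrary starting point. -/
theorem Connection.exists_local_lift (A : B.Connection) (x₀ : M) :
    ∃ V ∈ nhds x₀, ∀ p, B.proj p ∈ V → ∀ x ∈ V,
      ∃ c, A.IsHorizontal c ∧ c 0 = p ∧ B.proj (c 1) = x := by
  obtain ⟨s, hs, hxs⟩ := B.covers x₀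
  let φ := extChartAt (𝓡 d) x₀
  have hφo : IsOpen φ.target := isOpen_extChartAt_target x₀
  have hψ : ContMDiffOn (𝓡 d) (𝓡 d) ∞ φ.symm φ.target := contMDiffOn_extChartAt_symm x₀
  let W := φ.target ∩ φ.symm ⁻¹' s.dom
  have hWo : IsOpen W := hψ.continuousOn.isOpen_inter_preimage hφo (B.isOpen_dom s hs)
  have hxφ : x₀ ∈ φ.source := mem_extChartAt_source x₀
  have hoW : φ x₀ ∈ W := ⟨φ.map_source hxφ, by
    rw [Set.mem_preimage, φ.left_inv hxφ]; exact hxs⟩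
  have hcont := fun i j => Connection.continuousOn_pullback (A := A) hs hWo
    (hψ.mono Set.inter_subset_left) (fun y hy => hy.2) i j
  -- The pulled-back form vanishes on the zero vector, so by joint continuity it meets the smallness
  -- condition of `exists_unitary_solution` for short vectors near the centre.
  have hsmall : ∀ᶠ p : EuclideanSpace ℝ (Fin d) × EuclideanSpace ℝ (Fin d) in
      nhds (φ x₀, 0), p.1 ∈ W ∧ ∀ i j, n * ‖A.pullback s φ.symm p.1 p.2 i j‖ < 1 / 2 := by
    refine ((continuous_fst.continuousAt (x := (φ x₀, (0 : EuclideanSpace ℝ (Fin d))))).eventually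
      (hWo.mem_nhds hoW)).and (Filter.eventually_all.2 fun i => Filter.eventually_all.2 fun j => ?_)
    have h1 := ((hcont i j).continuousAt ((hWo.prod isOpen_univ).mem_nhds
      (show (φ x₀, (0 : EuclideanSpace ℝ (Fin d))) ∈ W ×ˢ Set.univ from
        ⟨hoW, Set.mem_univ _⟩))).norm.const_mul (n : ℝ)
    refine h1.eventually_lt_const ?_
    have : A.pullback s φ.symm (φ x₀) 0 = 0 := by
      rw [Connection.pullback]
      exact (congrArg (A.form s (φ.symm (φ x₀)))
        (map_zero (mfderiv (𝓡 d) (𝓡 d) φ.symm (φ x₀)))).trans (map_zero _)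
    simp only [this]
    simp
  obtain ⟨δ, hδ, hball⟩ := Metric.eventually_nhds_iff_ball.1 hsmall
  -- Half the radius, so that differences of points of `U` are shorter than `δ`.
  let U := Metric.ball (φ x₀) (δ / 2)
  have hUball : ∀ u ∈ U, ∀ v : EuclideanSpace ℝ (Fin d), ‖v‖ < δ →
      (u, v) ∈ Metric.ball (φ x₀, (0 : EuclideanSpace ℝ (Fin d))) δ := by
    intro u hu v hv
    rw [← ball_prod_same]
    exact ⟨Metric.ball_subset_ball (by linarith) hu, by simpa using hv⟩
  have hUW : U ⊆ W := fun u hu => (hball _ (hUball u hu 0 (by simpa using hδ))).1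
  have hψU := hψ.mono (hUW.trans Set.inter_subset_left)
  refine ⟨φ.source ∩ φ ⁻¹' U, Filter.inter_mem (extChartAt_source_mem_nhds x₀)
    ((continuousAt_extChartAt x₀).preimage_mem_nhds (Metric.ball_mem_nhds _ (by linarith))),
    fun p hp x hx => ?_⟩
  set y := φ (B.proj p) with hy
  set z := φ x with hz
  have hyU : y ∈ U := hp.2
  have hzU : z ∈ U := hx.2
  have hzy : ‖z - y‖ < δ := by
    rw [← dist_eq_norm]
    calc dist z y ≤ dist z (φ x₀) + dist y (φ x₀) := dist_triangle_right _ _ _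
      _ < δ / 2 + δ / 2 := add_lt_add hzU hyU
      _ = δ := by ring
  have hUc : Convex ℝ U := convex_ball _ _
  have hline : ∀ τ ∈ Set.Icc (0 : ℝ) 1, AffineMap.lineMap y z τ ∈ U := fun τ hτ =>
    hUc.lineMap_mem hyU hzU hτ
  obtain ⟨K, hK0, hK⟩ := exists_unitary_solution
    (a := fun τ => A.pullback s φ.symm (AffineMap.lineMap y z τ) (z - y))
    (fun i j => by
      refine (hcont i j).comp (f := fun τ : ℝ => (AffineMap.lineMap y z τ, z - y)) ?_
        fun τ hτ => ⟨hUW (hline τ hτ), Set.mem_univ _⟩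
      exact (AffineMap.lineMap_continuous.prodMk continuous_const).continuousOn)
    (fun τ hτ => A.skew s hs _ (hUW (hline τ hτ)).2 _)
    (fun τ hτ i j => ((hball _ (hUball _ (hline τ hτ) _ hzy)).2 i j).le)
  let h := B.trans (s.sec (B.proj p)) p
  have hyp : φ.symm y = B.proj p := φ.left_inv hp.1
  have hps : B.proj p ∈ s.dom := by rw [← hyp]; exact (hUW hyU).2
  -- Right multiplication by the constant `h` preserves the equation and moves the starting point to
  -- `p`.
  refine ⟨_, Connection.isHorizontal_segmentCurve (A := A) (K := fun τ => K τ * h) hs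
    Metric.isOpen_ball hUc hψU (fun u hu => (hUW hu).2) hyU hzU fun τ hτ => ?_, ?_, ?_⟩
  · have h1 := (hK τ hτ).mul (hasMatDerivWithin_const h.1)
    rw [Matrix.mul_zero, add_zero, Matrix.neg_mul, Matrix.mul_assoc] at h1
    exact h1
  · simp only [segmentCurve, AffineMap.lineMap_apply_zero, hyp, hK0, one_mul]
    exact act_trans (B.proj_sec s hs _ hps)
  · have hzx : φ.symm z = x := φ.left_inv hx.1
    simp only [segmentCurve, AffineMap.lineMap_apply_one, hzx, B.proj_act]
    exact B.proj_sec s hs x (by rw [← hzx]; exact (hUW hzU).2)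

/-- By the local lifts, the set of base points reached is open and closed. -/
theorem Connection.exists_mem_holonomyBundle [PreconnectedSpace M] (A : B.Connection) (p₀ : P)
    (x : M) : ∃ p ∈ A.holonomyBundle p₀, B.proj p = x := by
  let S : Set M := {x | ∃ p ∈ A.holonomyBundle p₀, B.proj p = x}
  have hstep : ∀ {V : Set M}, (∀ p, B.proj p ∈ V → ∀ x ∈ V,
      ∃ c, A.IsHorizontal c ∧ c 0 = p ∧ B.proj (c 1) = x) → ∀ x ∈ V, ∀ x' ∈ V, x ∈ S → x' ∈ S := by
    rintro V hV _ hxV x' hx'V ⟨p, hp, rfl⟩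
    obtain ⟨c, hc, hc0, hc1⟩ := hV p hxV x' hx'V
    exact ⟨c 1, Relation.ReflTransGen.tail hp ⟨c, hc, hc0, rfl⟩, hc1⟩
  have hclopen : IsClopen S := by
    refine ⟨isOpen_compl_iff.1 (isOpen_iff_mem_nhds.2 fun x hx => ?_),
      isOpen_iff_mem_nhds.2 fun x hx => ?_⟩ <;> obtain ⟨V, hV, hlift⟩ := A.exists_local_lift x
    · filter_upwards [hV] with x' hx' hx'S
      exact hx (hstep hlift x' hx' x (mem_of_mem_nhds hV) hx'S)
    · filter_upwards [hV] with x' hx'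
      exact hstep hlift x (mem_of_mem_nhds hV) x' hx' hx
  have := hclopen.eq_univ ⟨B.proj p₀, p₀, Relation.ReflTransGen.refl, rfl⟩
  exact Set.eq_univ_iff_forall.1 this x

end PrincipalBundle

end Segments

/-- A polynomial with vector coefficients that vanishes on an interval is zero. -/
theorem eq_zero_of_sum_pow_smul_eq_zero {V : Type*} [AddCommGroup V] [Module ℝ V] {N : ℕ}
    {D : Fin N → V} {δ : ℝ} (hδ : 0 < δ)
    (h : ∀ u ∈ Set.Ioo 0 δ, ∑ j, u ^ (j.1 + 1) • D j = 0) (j : Fin N) : D j = 0 := by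
  rw [← Module.forall_dual_apply_eq_zero_iff ℝ]
  intro f
  let p : Polynomial ℝ := ∑ j : Fin N, Polynomial.monomial (j.1 + 1) (f (D j))
  have hp : p = 0 := by
    refine Polynomial.eq_zero_of_infinite_isRoot _ ((Set.Ioo_infinite hδ).mono fun u hu => ?_)
    have h1 := congrArg f (h u hu)
    simp only [map_sum, map_smul, smul_eq_mul, map_zero] at h1
    change Polynomial.eval u p = 0
    simp only [p, Polynomial.eval_finsetSum, Polynomial.eval_monomial]
    rw [← h1]
    exact Finset.sum_congr rfl fun _ _ => mul_comm _ _
  have h2 := congrArg (fun q => Polynomial.coeff q (j.1 + 1)) hp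
  simpa [p, Polynomial.coeff_monomial, Fin.val_inj] using h2

/-! ### Prescribing a connection near a point and confining its holonomy to the reduction. -/

section HolonomyInduced

variable {𝕂 : Type*} [NormedRing 𝕂] [StarRing 𝕂] [NormedAlgebra ℝ 𝕂] [HermitianScalars 𝕂]
  {n d : ℕ}
  {M : Type*} [TopologicalSpace M] [ChartedSpace (EuclideanSpace ℝ (Fin d)) M]
  {P : Type*} {B : PrincipalBundle 𝕂 n d M P} {H : Subgroup (IsoGroup 𝕂 (Fin n))} {Q : Set P}

/-- The one-form `∑ j, (x_{i₀})^{j+1} dx_{i₁} X_j` in chart coordinates centred at `x₀`. -/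
def coordForm (x₀ : M) (i₀ i₁ : Fin d) {N : ℕ} (X : Fin N → Matrix (Fin n) (Fin n) 𝕂) (x : M) :
    TangentSpace (𝓡 d) x →ₗ[ℝ] Matrix (Fin n) (Fin n) 𝕂 where
  -- Exponents start at one so that the form vanishes where the `i₀` coordinate is that of `x₀`;
  -- distinct exponents allow the `X j` to be separated later.
  toFun v := ∑ j, ((extChartAt (𝓡 d) x₀ x i₀ - extChartAt (𝓡 d) x₀ x₀ i₀) ^ (j.1 + 1) *
    dEntry (𝓡 d) (fun y => extChartAt (𝓡 d) x₀ y i₁) x v) • X j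
  map_add' v w := by
    rw [← Finset.sum_add_distrib]
    refine Finset.sum_congr rfl fun j _ => ?_
    rw [← add_smul, ← mul_add]
    congr 2
    exact (mfderiv (𝓡 d) 𝓘(ℝ, ℝ) (fun y => extChartAt (𝓡 d) x₀ y i₁) x).map_add v w
  map_smul' c v := by
    rw [RingHom.id_apply, Finset.smul_sum]
    refine Finset.sum_congr rfl fun j _ => ?_
    rw [smul_smul, mul_left_comm]
    congr 2
    exact (mfderiv (𝓡 d) 𝓘(ℝ, ℝ) (fun y => extChartAt (𝓡 d) x₀ y i₁) x).map_smul c v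

omit [StarRing 𝕂] [HermitianScalars 𝕂] in
theorem coordForm_apply (x₀ : M) (i₀ i₁ : Fin d) {N : ℕ} (X : Fin N → Matrix (Fin n) (Fin n) 𝕂)
    (x : M) (v : TangentSpace (𝓡 d) x) : coordForm x₀ i₀ i₁ X x v =
      ∑ j, ((extChartAt (𝓡 d) x₀ x i₀ - extChartAt (𝓡 d) x₀ x₀ i₀) ^ (j.1 + 1) *
        dEntry (𝓡 d) (fun y => extChartAt (𝓡 d) x₀ y i₁) x v) • X j := rfl

theorem contMDiffOn_extChartAt_coord [IsManifold (𝓡 d) ∞ M] (x₀ : M) (i : Fin d) :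
    ContMDiffOn (𝓡 d) 𝓘(ℝ, ℝ) ∞ (fun y => extChartAt (𝓡 d) x₀ y i)
      (chartAt (EuclideanSpace ℝ (Fin d)) x₀).source :=
  (EuclideanSpace.proj i : EuclideanSpace ℝ (Fin d) →L[ℝ] ℝ).contMDiff.comp_contMDiffOn
    contMDiffOn_extChartAt

omit [StarRing 𝕂] [HermitianScalars 𝕂] in
theorem coordForm_smooth [IsManifold (𝓡 d) ∞ M] (x₀ : M) (i₀ i₁ : Fin d) {N : ℕ}
    (X : Fin N → Matrix (Fin n) (Fin n) 𝕂) :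
    MatSmoothOn (𝓡 d).tangent
      (fun v : TangentBundle (𝓡 d) M => coordForm x₀ i₀ i₁ X v.proj v.snd)
      {v | v.proj ∈ (chartAt (EuclideanSpace ℝ (Fin d)) x₀).source} := by
  have h0 : ContMDiffOn (𝓡 d).tangent 𝓘(ℝ, ℝ) ∞
      (fun v : TangentBundle (𝓡 d) M => extChartAt (𝓡 d) x₀ v.proj i₀)
      {v | v.proj ∈ (chartAt (EuclideanSpace ℝ (Fin d)) x₀).source} :=
    (contMDiffOn_extChartAt_coord x₀ i₀).comp (Bundle.contMDiff_proj _).contMDiffOn fun v hv => hv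
  have h1 := contMDiffOn_dEntry_tangent (contMDiffOn_extChartAt_coord (M := M) x₀ i₁)
    (chartAt (EuclideanSpace ℝ (Fin d)) x₀).open_source
  simp only [coordForm_apply]
  refine MatSmoothOn.sum fun j _ => MatSmoothOn.smul ?_ (matSmoothOn_const _)
  have h2 : ContMDiffOn (𝓡 d).tangent 𝓘(ℝ, ℝ) ∞
      (fun v : TangentBundle (𝓡 d) M => (extChartAt (𝓡 d) x₀ v.proj i₀ -
        extChartAt (𝓡 d) x₀ x₀ i₀) ^ (j.1 + 1))
      {v | v.proj ∈ (chartAt (EuclideanSpace ℝ (Fin d)) x₀).source} :=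
    (h0.sub contMDiffOn_const).pow _
  exact h2.mul h1

theorem dEntry_extChartAt_coord [IsManifold (𝓡 d) ∞ M] (x₀ : M) (i : Fin d)
    {y : EuclideanSpace ℝ (Fin d)} (hy : y ∈ (extChartAt (𝓡 d) x₀).target)
    (w : EuclideanSpace ℝ (Fin d)) :
    dEntry (𝓡 d) (fun y => extChartAt (𝓡 d) x₀ y i) ((extChartAt (𝓡 d) x₀).symm y)
      (mfderiv (𝓡 d) (𝓡 d) (extChartAt (𝓡 d) x₀).symm y w) = w i := by
  set φ := extChartAt (𝓡 d) x₀ with hφ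
  have hopen : IsOpen φ.target := isOpen_extChartAt_target x₀
  have hsrc : φ.symm y ∈ (chartAt (EuclideanSpace ℝ (Fin d)) x₀).source := by
    rw [← extChartAt_source (𝓡 d)]; exact φ.map_target hy
  have h1 := (((contMDiffOn_extChartAt_symm (I := 𝓡 d) (n := ∞) x₀).contMDiffAt
    (hopen.mem_nhds hy)).mdifferentiableAt (by simp)).hasMFDerivAt
  have h2 := (((contMDiffOn_extChartAt_coord (M := M) x₀ i).contMDiffAt
    ((chartAt _ x₀).open_source.mem_nhds hsrc)).mdifferentiableAt (by simp)).hasMFDerivAt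
  have h3 := h2.comp y h1
  have h4 : HasMFDerivAt (𝓡 d) 𝓘(ℝ, ℝ) ((fun y => φ y i) ∘ φ.symm) y
      (EuclideanSpace.proj i : EuclideanSpace ℝ (Fin d) →L[ℝ] ℝ) := by
    refine HasMFDerivAt.congr_of_eventuallyEq
      (EuclideanSpace.proj i : EuclideanSpace ℝ (Fin d) →L[ℝ] ℝ).hasMFDerivAt ?_
    filter_upwards [hopen.mem_nhds hy] with z hz
    simp [φ.right_inv hz]
  have h5 := hasMFDerivAt_unique h3 h4
  exact congrArg (fun L : EuclideanSpace ℝ (Fin d) →L[ℝ] ℝ => L w) h5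

namespace PrincipalBundle

omit [HermitianScalars 𝕂] in
theorem IsSmoothSectionOn.mono {s : M → P} {V W : Set M} (hs : B.IsSmoothSectionOn s W)
    (hV : IsOpen V) (h : V ⊆ W) : B.IsSmoothSectionOn s V :=
  ⟨hV, fun x hx => hs.proj_eq x (h hx), fun t ht => by
    obtain ⟨g, hg, hgs⟩ := hs.smooth t ht
    exact ⟨g, fun x hx => hg x ⟨hx.1, h hx.2⟩,
      MatSmoothOn.mono hgs fun x hx => ⟨hx.1, h hx.2⟩⟩⟩

variable [IsManifold (𝓡 d) ∞ M] {A : B.Connection}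

/-- If the local connection forms in the gauges of a Howe subbundle take values in the algebra of
its structure group, then horizontal curves that start in the subbundle remain there. -/
theorem Connection.IsHorizontal.mem_of_mem {c : ℝ → P} (h : A.IsHorizontal c) (hH : IsHowe H)
    (hQ : B.IsReduction Q H) (hat : ∀ s : SectionIn B Q, s.1 ∈ B.atlas)
    (hA : ∀ s : SectionIn B Q, ∀ x ∈ s.1.dom, ∀ v, A.form s.1 x v ∈ doubleCommutant H)
    (h0 : c 0 ∈ Q) : c 1 ∈ Q := by
  choose i hi using hQ.exists_sectionIn
  let K : ℝ → IsoGroup 𝕂 (Fin n) := fun σ => B.trans ((i (B.proj (c σ))).1.sec (B.proj (c σ))) (c σ)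
  have hproj : ∀ x, B.proj ((i x).1.sec x) = x := fun x => (i x).proj_eq (hi x)
  have hK0 : K 0 ∈ H := hQ.trans_mem ((i _).2.2 _ (hi _)) h0 (hproj _)
  suffices hK1 : K 1 ∈ H by
    have := (hQ.act_mem_iff ((i (B.proj (c 1))).1.sec (B.proj (c 1))) ((i _).2.2 _ (hi _)) (K 1)).2
      hK1
    rwa [act_trans (hproj _)] at this
  rw [← hH, Subgroup.mem_centralizer_iff]
  intro z hz
  -- The gauge defining `K` jumps with the parameter, but `Kᴴ z K` does not notice: gauge changes
  -- within `Q` lie in `H` and commute with `z`. Its derivative vanishes because the connection form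
  -- is skew and commutes with `z`.
  have hder : ∀ τ ∈ Set.Icc (0 : ℝ) 1,
      HasMatDerivWithin (fun σ => (K σ).1ᴴ * z.1 * (K σ).1) 0 (Set.Icc 0 1) τ := by
    intro τ hτ
    set s := i (B.proj (c τ)) with hs
    have hxs : B.proj (c τ) ∈ s.1.dom := hi _
    have h1 := h.horizontalAt (hat s) hτ hxs
    have h2 := (h1.star.mul (hasMatDerivWithin_const z.1)).mul h1
    have hskew : ∀ v, (A.form s.1 (B.proj (c τ)) v)ᴴ = -A.form s.1 (B.proj (c τ)) v :=
      A.skew s.1 (hat s) _ hxs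
    have hcomm := fun v => mem_doubleCommutant_iff.1 (hA s _ hxs v) z hz
    have hval : ∀ σ, B.proj (c σ) ∈ s.1.dom → (K σ).1ᴴ * z.1 * (K σ).1 =
        (B.trans (s.1.sec (B.proj (c σ))) (c σ)).1ᴴ * z.1 *
          (B.trans (s.1.sec (B.proj (c σ))) (c σ)).1 := by
      intro σ hσ
      set j := i (B.proj (c σ))
      have hg := hQ.trans_mem (s.2.2 _ hσ) (j.2.2 _ (hi _)) (s.proj_eq_proj j hσ (hi _))
      have he : B.trans (s.1.sec (B.proj (c σ))) (c σ) =
          B.trans (s.1.sec (B.proj (c σ))) (j.1.sec (B.proj (c σ))) * K σ :=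
        (trans_mul (s.proj_eq_proj j hσ (hi _)) (hproj _)).symm
      rw [he]
      set g := B.trans (s.1.sec (B.proj (c σ))) (j.1.sec (B.proj (c σ)))
      have h3 : g.1ᴴ * (z.1 * g.1) = z.1 := by
        have h4 : z.1 * g.1 = g.1 * z.1 :=
          (congrArg Subtype.val (Subgroup.mem_centralizer_iff.1 hz g hg)).symm
        have h5 : g.1ᴴ * g.1 = 1 := Unitary.coe_star_mul_self g
        rw [h4, ← Matrix.mul_assoc, h5, Matrix.one_mul]
      change _ = (g.1 * (K σ).1)ᴴ * z.1 * (g.1 * (K σ).1)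
      calc (K σ).1ᴴ * z.1 * (K σ).1 = (K σ).1ᴴ * (g.1ᴴ * (z.1 * g.1)) * (K σ).1 := by rw [h3]
        _ = _ := by simp only [Matrix.conjTranspose_mul, Matrix.mul_assoc]
    have h6 := h2.congr (l := fun σ => (K σ).1ᴴ * z.1 * (K σ).1)
      ((eventually_mem_dom (B.isOpen_dom _ (hat s)) h.base_contMDiffOn hτ hxs).mono hval)
      (hval τ hxs)
    convert h6 using 1
    simp only [Matrix.conjTranspose_neg, Matrix.conjTranspose_mul, hskew, Matrix.mul_zero, add_zero,
      Matrix.mul_neg, neg_neg]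
    rw [eq_comm, add_neg_eq_zero]
    simp only [Matrix.mul_assoc]
    rw [← Matrix.mul_assoc z.1, hcomm]
    simp only [Matrix.mul_assoc]
  have heq := eq_of_hasMatDerivWithin_zero (convex_Icc 0 1) hder
    (Set.left_mem_Icc.2 zero_le_one) (Set.right_mem_Icc.2 zero_le_one)
  have h7 : (K 0)⁻¹ * z * K 0 = (K 1)⁻¹ * z * K 1 := Subtype.ext heq
  have h8 : (K 0)⁻¹ * z * K 0 = z := by
    rw [mul_assoc, ← Subgroup.mem_centralizer_iff.1 hz _ hK0, inv_mul_cancel_left]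
  rw [h8, mul_assoc, eq_inv_mul_iff_mul_eq] at h7
  exact h7.symm

theorem Connection.holonomyBundle_subset (hH : IsHowe H) (hQ : B.IsReduction Q H)
    (hat : ∀ s : SectionIn B Q, s.1 ∈ B.atlas)
    (hA : ∀ s : SectionIn B Q, ∀ x ∈ s.1.dom, ∀ v, A.form s.1 x v ∈ doubleCommutant H)
    {p₀ : P} (h0 : p₀ ∈ Q) : A.holonomyBundle p₀ ⊆ Q := by
  intro p hp
  induction hp with
  | refl => exact h0
  | tail _ hstep ih =>
    obtain ⟨c, hc, rfl, rfl⟩ := hstep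
    exact hc.mem_of_mem hH hQ hat hA ih

/-- A Howe subbundle admits a reducible connection that has a prescribed form near a point. -/
theorem IsReduction.exists_connection [T2Space M] [SigmaCompactSpace M] (hH : IsHowe H)
    (hQ : B.IsReduction Q H) (hat : ∀ s : SectionIn B Q, s.1 ∈ B.atlas) (x₀ : M) (i₀ i₁ : Fin d)
    {N : ℕ} {X : Fin N → Matrix (Fin n) (Fin n) 𝕂} (hX : ∀ j, (X j)ᴴ = -X j)
    (hXH : ∀ j, X j ∈ doubleCommutant H) :
    ∃ (A : B.Connection) (σ : SectionIn B Q) (V : Set M), V ∈ nhds x₀ ∧ V ⊆ σ.1.dom ∧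
      (∀ s : SectionIn B Q, ∀ x ∈ s.1.dom, ∀ v, A.form s.1 x v ∈ doubleCommutant H) ∧
      ∀ x ∈ V, ∀ v, A.form σ.1 x v = coordForm x₀ i₀ i₁ X x v := by
  choose s hs using hQ.exists_sectionIn
  have : LocallyCompactSpace M := ChartedSpace.locallyCompactSpace (EuclideanSpace ℝ (Fin d)) M
  let D₀ : Set M := (s x₀).1.dom ∩ (chartAt (EuclideanSpace ℝ (Fin d)) x₀).source
  have hD₀ : IsOpen D₀ := (s x₀).2.1.isOpen.inter (chartAt _ x₀).open_source
  have hxD₀ : x₀ ∈ D₀ := ⟨hs x₀, mem_chart_source _ x₀⟩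
  obtain ⟨C, hC, hCc, hCD⟩ := exists_mem_nhds_isClosed_subset (hD₀.mem_nhds hxD₀)
  -- The closed neighbourhood `C` is removed from all domains except that of `none`, so on `C` only
  -- the prescribed form contributes to the glued connection.
  let σ : Option M → SectionIn B Q := fun i => i.elim
    ⟨⟨D₀, (s x₀).1.sec⟩, (s x₀).2.1.mono hD₀ Set.inter_subset_left, fun y hy => (s x₀).2.2 y hy.1⟩
    fun x => ⟨⟨(s x).1.dom \ C, (s x).1.sec⟩,
      (s x).2.1.mono ((s x).2.1.isOpen.sdiff hCc) Set.sdiff_subset, fun y hy => (s x).2.2 y hy.1⟩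
  have hσ : ∀ i, (σ i).1 ∈ B.atlas := fun i => hat _
  obtain ⟨ρ, hρ⟩ := SmoothPartitionOfUnity.exists_isSubordinate (𝓡 d) isClosed_univ
    (fun i => (σ i).1.dom) (fun i => B.isOpen_dom _ (hσ i)) (fun x _ => by
      by_cases hx : x ∈ C
      · exact Set.mem_iUnion.2 ⟨none, hCD hx⟩
      · exact Set.mem_iUnion.2 ⟨some x, hs x, hx⟩)
  let η : Option M → (x : M) → TangentSpace (𝓡 d) x →ₗ[ℝ] Matrix (Fin n) (Fin n) 𝕂 := fun i =>
    i.elim (coordForm x₀ i₀ i₁ X) fun _ _ => 0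
  have hskew : ∀ i, ∀ x ∈ (σ i).1.dom, ∀ v, (η i x v)ᴴ = -η i x v := by
    rintro (_ | y) x - v
    · change (coordForm x₀ i₀ i₁ X x v)ᴴ = -coordForm x₀ i₀ i₁ X x v
      rw [coordForm_apply, Matrix.conjTranspose_sum, ← Finset.sum_neg_distrib]
      refine Finset.sum_congr rfl fun j _ => ?_
      rw [Matrix.conjTranspose_smul, hX, smul_neg, star_trivial]
    · change (0 : Matrix (Fin n) (Fin n) 𝕂)ᴴ = -0
      simp
  have hsm : ∀ i, MatSmoothOn (𝓡 d).tangent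
      (fun v : TangentBundle (𝓡 d) M => η i v.proj v.snd) {v | v.proj ∈ (σ i).1.dom} := by
    rintro (_ | y)
    · exact (coordForm_smooth x₀ i₀ i₁ X).mono fun v hv => hv.2
    · exact matSmoothOn_const 0
  have hηH : ∀ i, ∀ y ∈ (σ i).1.dom, ∀ v, η i y v ∈ doubleCommutant H := by
    rintro (_ | y) x - v
    · change coordForm x₀ i₀ i₁ X x v ∈ _
      rw [coordForm_apply]
      exact sum_mem fun j _ => SMulMemClass.smul_mem _ (hXH j)
    · exact zero_mem _
  refine ⟨glueConnection (fun i => (σ i).1) hσ η hskew hsm ρ hρ, σ none, C, hC, hCD,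
    fun t x hx v => glueConnection_form_mem hH hQ (fun i => (σ i).2.2) hηH (hat t) t.2.2 hx v,
    fun x hx v => glueConnection_form_eq (σ := fun i => (σ i).1) (i := none) ?_ v⟩
  rintro (_ | y) hne
  · exact absurd rfl hne
  · by_contra h
    exact (hρ (some y) (subset_tsupport _ h)).2 hx

/-! ### Holonomy around small coordinate rectangles. -/

section Rectangles

variable {ψ : EuclideanSpace ℝ (Fin d) → M} {U : Set (EuclideanSpace ℝ (Fin d))}
  {y z : EuclideanSpace ℝ (Fin d)} {s : LocalSection M P} {p₀ : P}

/-- Parallel transport along a segment on which the connection form is constant. -/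
theorem Connection.exists_exp_mem_holonomyBundle (hs : s ∈ B.atlas) (hUo : IsOpen U)
    (hU : Convex ℝ U) (hψ : ContMDiffOn (𝓡 d) (𝓡 d) ∞ ψ U) (hUs : Set.MapsTo ψ U s.dom)
    (hy : y ∈ U) (hz : z ∈ U) {Y : Matrix (Fin n) (Fin n) 𝕂} (hY : Yᴴ = -Y)
    (hA : ∀ τ ∈ Set.Icc (0 : ℝ) 1, A.pullback s ψ (AffineMap.lineMap y z τ) (z - y) = -Y)
    {h : IsoGroup 𝕂 (Fin n)} (hmem : B.act (s.sec (ψ y)) h ∈ A.holonomyBundle p₀) :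
    ∃ k : IsoGroup 𝕂 (Fin n), k.1 = NormedSpace.exp Y ∧
      B.act (s.sec (ψ z)) (k * h) ∈ A.holonomyBundle p₀ := by
  let E : ℝ → IsoGroup 𝕂 (Fin n) := fun τ => ⟨_, exp_smul_mem_unitary hY τ⟩
  have hor := Connection.isHorizontal_segmentCurve (A := A) (K := fun τ => E τ * h) hs hUo hU hψ hUs
    hy hz fun τ hτ => by
      have h1 := (hasMatDerivWithin_exp Y (Set.Icc 0 1) τ).mul (hasMatDerivWithin_const h.1)
      rw [Matrix.mul_zero, add_zero] at h1
      rw [hA τ hτ, Matrix.neg_mul, neg_neg]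
      rw [Matrix.mul_assoc] at h1
      exact h1
  refine ⟨E 1, by simp [E], Relation.ReflTransGen.tail hmem ⟨_, hor, ?_, ?_⟩⟩
  · have : E 0 = 1 := Subtype.ext (by simp [E])
    simp [segmentCurve, this]
  · simp [segmentCurve]

theorem Connection.act_mem_holonomyBundle_of_pullback_eq_zero (hs : s ∈ B.atlas) (hUo : IsOpen U)
    (hU : Convex ℝ U) (hψ : ContMDiffOn (𝓡 d) (𝓡 d) ∞ ψ U) (hUs : Set.MapsTo ψ U s.dom)
    (hy : y ∈ U) (hz : z ∈ U)
    (hA : ∀ τ ∈ Set.Icc (0 : ℝ) 1, A.pullback s ψ (AffineMap.lineMap y z τ) (z - y) = 0)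
    {h : IsoGroup 𝕂 (Fin n)} (hmem : B.act (s.sec (ψ y)) h ∈ A.holonomyBundle p₀) :
    B.act (s.sec (ψ z)) h ∈ A.holonomyBundle p₀ := by
  obtain ⟨k, hk, hmem'⟩ := Connection.exists_exp_mem_holonomyBundle hs hUo hU hψ hUs hy hz
    (Y := 0) (by simp) (by simpa using hA) hmem
  have : k = 1 := Subtype.ext (by rw [hk]; simp)
  rwa [this, one_mul] at hmem'

/-- Holonomies along small rectangles of a connection in the normal form `coordForm`. -/
theorem Connection.exists_exp_holonomy {x₀ : M} {i₀ i₁ : Fin d} (hi : i₀ ≠ i₁) {N : ℕ}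
    {X : Fin N → Matrix (Fin n) (Fin n) 𝕂} (hX : ∀ j, (X j)ᴴ = -X j) (hs : s ∈ B.atlas)
    {V : Set M} (hV : V ∈ nhds x₀) (hVs : V ⊆ s.dom)
    (hA : ∀ x ∈ V, ∀ v, A.form s x v = coordForm x₀ i₀ i₁ X x v) :
    ∃ δ > (0 : ℝ), ∀ t ∈ Set.Icc 0 δ, ∀ u ∈ Set.Icc 0 δ, ∃ k : IsoGroup 𝕂 (Fin n),
      k.1 = NormedSpace.exp (t • ∑ j, u ^ (j.1 + 1) • X j) ∧
        B.act (s.sec x₀) k ∈ A.holonomyBundle (s.sec x₀) := by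
  let φ := extChartAt (𝓡 d) x₀
  set o := φ x₀ with ho
  have hφo : IsOpen φ.target := isOpen_extChartAt_target x₀
  have hψ : ContMDiffOn (𝓡 d) (𝓡 d) ∞ φ.symm φ.target := contMDiffOn_extChartAt_symm x₀
  have hoψ : φ.symm o = x₀ := φ.left_inv (mem_extChartAt_source x₀)
  have hnear : φ.target ∩ φ.symm ⁻¹' V ∈ nhds o := by
    have hot : φ.target ∈ nhds o := extChartAt_target_mem_nhds x₀
    refine Filter.inter_mem hot ((hψ.continuousOn.continuousAt hot).preimage_mem_nhds ?_)
    rwa [hoψ]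
  obtain ⟨r, hr, hball⟩ := Metric.mem_nhds_iff.1 hnear
  let U := Metric.ball o r
  have hUc : Convex ℝ U := convex_ball _ _
  have hψU : ContMDiffOn (𝓡 d) (𝓡 d) ∞ φ.symm U := hψ.mono fun y hy => (hball hy).1
  have hUs : Set.MapsTo φ.symm U s.dom := fun y hy => hVs (hball hy).2
  have hpull : ∀ y ∈ U, ∀ w, A.pullback s φ.symm y w =
      ∑ j, ((y i₀ - o i₀) ^ (j.1 + 1) * w i₁) • X j := by
    intro y hy w
    have h1 : A.pullback s φ.symm y w =
        coordForm x₀ i₀ i₁ X (φ.symm y) (mfderiv (𝓡 d) (𝓡 d) φ.symm y w) := hA _ (hball hy).2 _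
    rw [h1, coordForm_apply, dEntry_extChartAt_coord x₀ i₁ (hball hy).1,
      show extChartAt (𝓡 d) x₀ (φ.symm y) = y from φ.right_inv (hball hy).1]
  let e : ℝ → ℝ → EuclideanSpace ℝ (Fin d) := fun t u =>
    o + (t • EuclideanSpace.single i₁ (1 : ℝ) + u • EuclideanSpace.single i₀ (1 : ℝ))
  have he₀ : ∀ t u, e t u i₀ = o i₀ + u := fun t u => by simp [e, hi]
  have he₁ : ∀ t u, e t u i₁ = o i₁ + t := fun t u => by simp [e, hi.symm]
  have hline₀ : ∀ t u t' u' τ, (AffineMap.lineMap (e t u) (e t' u') τ :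
      EuclideanSpace ℝ (Fin d)) i₀ - o i₀ = u + τ * (u' - u) := fun t u t' u' τ => by
    rw [AffineMap.lineMap_apply_module']
    simp only [PiLp.add_apply, PiLp.smul_apply, PiLp.sub_apply, he₀, smul_eq_mul]
    ring
  have hdiff₁ : ∀ t u t' u', (e t' u' - e t u) i₁ = t' - t := fun t u t' u' => by
    rw [PiLp.sub_apply, he₁, he₁]; ring
  -- The displacement has norm at most `t + u ≤ 2 r / 3 < r`, which keeps the rectangle in the ball.
  refine ⟨r / 3, by linarith, fun t ht u hu => ?_⟩
  have heU : ∀ t ∈ Set.Icc 0 (r / 3), ∀ u ∈ Set.Icc 0 (r / 3), e t u ∈ U := by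
    intro t ht u hu
    rw [Metric.mem_ball, dist_eq_norm]
    have h1 : e t u - o = t • EuclideanSpace.single i₁ (1 : ℝ) +
        u • EuclideanSpace.single i₀ (1 : ℝ) := by simp [e]
    rw [h1]
    refine (norm_add_le _ _).trans_lt ?_
    rw [norm_smul, norm_smul, PiLp.norm_single, PiLp.norm_single, norm_one,
      mul_one, mul_one, Real.norm_of_nonneg ht.1, Real.norm_of_nonneg hu.1]
    linarith [ht.2, hu.2]
  have h0 : (0 : ℝ) ∈ Set.Icc 0 (r / 3) := ⟨le_rfl, by linarith⟩
  have he00 : e 0 0 = o := by simp [e]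
  have hstart : B.act (s.sec (φ.symm (e 0 0))) 1 ∈ A.holonomyBundle (s.sec x₀) := by
    rw [he00, hoψ, B.act_one]; exact Relation.ReflTransGen.refl
  have hmemU : ∀ {y z}, y ∈ U → z ∈ U → ∀ τ ∈ Set.Icc (0 : ℝ) 1, AffineMap.lineMap y z τ ∈ U :=
    fun hy hz τ hτ => hUc.lineMap_mem hy hz hτ
  -- On the first side the coefficients vanish, and on the two sides parallel to the `i₀` axis
  -- `dx_{i₁}` does. Only the third side, at height `u`, contributes: there the form is constant,
  -- and running backwards supplies the minus sign that cancels the one in the transport equation.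
  have h1 := Connection.act_mem_holonomyBundle_of_pullback_eq_zero hs Metric.isOpen_ball hUc hψU hUs
    (heU 0 h0 0 h0) (heU t ht 0 h0) (fun τ hτ => by
      rw [hpull _ (hmemU (heU 0 h0 0 h0) (heU t ht 0 h0) τ hτ), hline₀]
      simp) hstart
  have h2 := Connection.act_mem_holonomyBundle_of_pullback_eq_zero hs Metric.isOpen_ball hUc hψU hUs
    (heU t ht 0 h0) (heU t ht u hu) (fun τ hτ => by
      rw [hpull _ (hmemU (heU t ht 0 h0) (heU t ht u hu) τ hτ), hdiff₁]
      simp) h1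
  obtain ⟨k, hk, h3⟩ := Connection.exists_exp_mem_holonomyBundle (A := A) hs Metric.isOpen_ball hUc
    hψU hUs (heU t ht u hu) (heU 0 h0 u hu) (Y := t • ∑ j, u ^ (j.1 + 1) • X j)
    (by
      rw [Matrix.conjTranspose_smul, Matrix.conjTranspose_sum, star_trivial, ← smul_neg,
        ← Finset.sum_neg_distrib]
      congr 1
      refine Finset.sum_congr rfl fun j _ => ?_
      rw [Matrix.conjTranspose_smul, hX, smul_neg, star_trivial])
    (fun τ hτ => by
      rw [hpull _ (hmemU (heU t ht u hu) (heU 0 h0 u hu) τ hτ), hdiff₁, hline₀, Finset.smul_sum,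
        ← Finset.sum_neg_distrib]
      refine Finset.sum_congr rfl fun j _ => ?_
      rw [sub_self, mul_zero, add_zero, zero_sub, mul_neg, neg_smul, smul_smul, mul_comm]) h2
  have h4 := Connection.act_mem_holonomyBundle_of_pullback_eq_zero hs Metric.isOpen_ball hUc hψU hUs
    (heU 0 h0 u hu) (heU 0 h0 0 h0) (fun τ hτ => by
      rw [hpull _ (hmemU (heU 0 h0 u hu) (heU 0 h0 0 h0) τ hτ), hdiff₁]
      simp) h3
  rw [he00, hoψ, mul_one] at h4
  exact ⟨k, hk, h4⟩

end Rectangles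

/-! ### The generating connection and the equivalence. -/

/-- If the structure group has no forbidden factor and the bundle atlas contains all sections of
the reduction, some connection generates the reduction. -/
theorem IsReduction.exists_generating_connection [T2Space M] [SigmaCompactSpace M]
    [ConnectedSpace M] (hd : 2 ≤ d) (hH : IsHowe H) (hQ : B.IsReduction Q H)
    (hat : ∀ s : SectionIn B Q, s.1 ∈ B.atlas) (h₂ : ¬ HasFactorO2 H)
    (h₁ : ¬ HasDoubleFactorO1 H) :
    ∃ (A : B.Connection) (p₀ : P), B.IsGeneratedBy Q (A.holonomyBundle p₀) := by
  obtain ⟨x₀⟩ : Nonempty M := inferInstance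
  let L : Submodule ℝ (Matrix (Fin n) (Fin n) 𝕂) :=
    { carrier := {X | X ∈ doubleCommutant H ∧ Xᴴ = -X}
      add_mem' := fun ha hb => ⟨add_mem ha.1 hb.1, by
        rw [Matrix.conjTranspose_add, ha.2, hb.2, neg_add]⟩
      zero_mem' := ⟨zero_mem _, by simp⟩
      smul_mem' := fun c X hX => ⟨SMulMemClass.smul_mem c hX.1, by
        rw [Matrix.conjTranspose_smul, hX.2, smul_neg, star_trivial]⟩ }
  let b := Module.finBasis ℝ L
  let X := fun j => (b j).1
  let i₀ : Fin d := ⟨0, by omega⟩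
  let i₁ : Fin d := ⟨1, by omega⟩
  have hi : i₀ ≠ i₁ := by simp [i₀, i₁]
  obtain ⟨A, σ, V, hV, hVσ, hA, hform⟩ := hQ.exists_connection hH hat x₀ i₀ i₁ (X := X)
    (fun j => (b j).2.2) fun j => (b j).2.1
  obtain ⟨δ, hδ, hhol⟩ := Connection.exists_exp_holonomy (A := A) hi (fun j => (b j).2.2) (hat σ)
    hV hVσ hform
  set p₀ := σ.1.sec x₀ with hp₀
  have hp₀Q : p₀ ∈ Q := σ.2.2 x₀ (hVσ (mem_of_mem_nhds hV))
  have hRQ : A.holonomyBundle p₀ ⊆ Q := Connection.holonomyBundle_subset hH hQ hat hA hp₀Q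
  refine ⟨A, p₀, ⟨⟨H, hH, hQ⟩, hRQ⟩, ?_⟩
  rintro Q' ⟨⟨H', hH', hQ'⟩, hRQ'⟩
  have hp₀Q' : p₀ ∈ Q' := hRQ' Relation.ReflTransGen.refl
  -- Both groups are double centralizers, so it suffices that whatever centralizes `H'` centralizes
  -- `H`.
  have hle : H ≤ H' := by
    rw [← hH, ← hH']
    refine Subgroup.centralizer_le fun z hz => ?_
    have hz' : ∀ Y ∈ doubleCommutant H, star Y = -Y → z.1 * Y = Y * z.1 := by
      have hsum : ∀ u ∈ Set.Ioo 0 δ, ∑ j, u ^ (j.1 + 1) • (z.1 * X j - X j * z.1) = 0 := by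
        intro u hu
        have h1 : z.1 * ∑ j, u ^ (j.1 + 1) • X j = (∑ j, u ^ (j.1 + 1) • X j) * z.1 := by
          refine mul_comm_of_mul_exp_comm hδ fun t ht => ?_
          obtain ⟨k, hk, hkR⟩ := hhol t ht u ⟨hu.1.le, hu.2.le⟩
          have hkH : k ∈ H' := (hQ'.act_mem_iff p₀ hp₀Q' k).1 (hRQ' hkR)
          rw [← hk]
          exact (congrArg Subtype.val (Subgroup.mem_centralizer_iff.1 hz k hkH)).symm
        rw [Matrix.mul_sum, Matrix.sum_mul, ← sub_eq_zero, ← Finset.sum_sub_distrib] at h1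
        rw [← h1]
        refine Finset.sum_congr rfl fun j _ => ?_
        rw [smul_sub, Matrix.mul_smul, Matrix.smul_mul]
      have hj := fun j => sub_eq_zero.1 (eq_zero_of_sum_pow_smul_eq_zero hδ hsum j)
      intro Y hY hYs
      have hYL : Y ∈ L := ⟨hY, hYs⟩
      have hrep : Y = ∑ j, b.repr ⟨Y, hYL⟩ j • X j := by
        have := congrArg L.subtype (b.sum_repr ⟨Y, hYL⟩)
        rw [map_sum] at this
        exact this.symm
      rw [hrep, Matrix.mul_sum, Matrix.sum_mul]
      refine Finset.sum_congr rfl fun j _ => ?_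
      rw [Matrix.mul_smul, Matrix.smul_mul, hj]
    have hcomm := commute_of_commute_skew hH h₂ h₁ hz'
    refine Subgroup.mem_centralizer_iff.2 fun h hh => Subtype.ext ?_
    exact (hcomm h.1 ((hH.mem_iff h).1 hh)).symm
  -- The holonomy bundle meets the fibre of `q` in some `r`, which lies in both reductions; `q`
  -- differs from `r` by an element of `H ≤ H'`.
  intro q hq
  obtain ⟨r, hr, hrq⟩ := A.exists_mem_holonomyBundle p₀ (B.proj q)
  have h1 := hQ.trans_mem (hRQ hr) hq hrq
  rw [← act_trans hrq]
  exact (hQ'.act_mem_iff r (hRQ' hr) _).2 (hle h1)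

omit [IsManifold (𝓡 d) ∞ M] in
theorem IsSmoothSectionOn.max {s : M → P} {W : Set M} (hs : B.IsSmoothSectionOn s W) :
    B.max.IsSmoothSectionOn s W :=
  ⟨hs.isOpen, hs.proj_eq, fun t ht => ⟨fun x => B.trans (t.sec x) (s x),
    fun _ hx => (act_trans (IsSmoothSectionOn.proj_eq_proj ht hs hx)).symm,
    IsSmoothSectionOn.smooth_trans ht hs⟩⟩

omit [IsManifold (𝓡 d) ∞ M] in
theorem IsReduction.max (hQ : B.IsReduction Q H) : B.max.IsReduction Q H :=
  ⟨hQ.act_mem_iff, fun x => by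
    obtain ⟨W, s, hx, hs, hsQ⟩ := hQ.exists_section x
    exact ⟨W, s, hx, hs.max, hsQ⟩⟩

/-- The connection is built in the maximal atlas and then restricted; its holonomy bundle is
unchanged, and reductions of the bundle remain reductions for the maximal atlas. -/
theorem IsReduction.isHolonomyInduced [T2Space M] [SigmaCompactSpace M] [ConnectedSpace M]
    (hd : 2 ≤ d) (hH : IsHowe H) (hQ : B.IsReduction Q H) (h₂ : ¬ HasFactorO2 H)
    (h₁ : ¬ HasDoubleFactorO1 H) : B.IsHolonomyInduced Q := by
  obtain ⟨A, p₀, ⟨-, hRQ⟩, hleast⟩ := hQ.max.exists_generating_connection hd hH (fun s =>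
    ⟨s.2.1.isOpen, s.2.1.proj_eq, fun t ht => s.2.1.smooth t (atlas_subset_max ht)⟩) h₂ h₁
  refine ⟨A.ofMax, p₀, ?_⟩
  rw [Connection.holonomyBundle_ofMax]
  refine ⟨⟨⟨H, hH, hQ⟩, hRQ⟩, ?_⟩
  rintro Q' ⟨⟨H', hH', hQ'⟩, hRQ'⟩
  exact hleast ⟨⟨H', hH', hQ'.max⟩, hRQ'⟩

theorem isHolonomyInduced_iff [T2Space M] [SigmaCompactSpace M] [SimplyConnectedSpace M]
    (hd : 2 ≤ d) (hH : IsHowe H) (hQ : B.IsReduction Q H) :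
    B.IsHolonomyInduced Q ↔ ¬ HasFactorO2 H ∧ ¬ HasDoubleFactorO1 H :=
  ⟨fun h => h.not_hasFactor hH hQ, fun h => hQ.isHolonomyInduced hd hH h.1 h.2⟩

end PrincipalBundle

end HolonomyInduced

end

end HoweBundle

theorem theorem6p4 {d : ℕ} (hd : 2 ≤ d) {M : Type*} [TopologicalSpace M]
    [ChartedSpace (EuclideanSpace ℝ (Fin d)) M] [IsManifold (𝓡 d) ∞ M]
    [T2Space M] [SigmaCompactSpace M] [SimplyConnectedSpace M] (n : ℕ) {P : Type*} :
    (∀ (B : HoweBundle.PrincipalBundle ℝ n d M P)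
      (H : Subgroup (HoweBundle.IsoGroup ℝ (Fin n))) (Q : Set P),
      HoweBundle.IsHowe H → B.IsReduction Q H →
      (B.IsHolonomyInduced Q ↔
        ¬ HoweBundle.HasFactorO2 H ∧ ¬ HoweBundle.HasDoubleFactorO1 H)) ∧
    (∀ (B : HoweBundle.PrincipalBundle ℍ[ℝ] n d M P)
      (H : Subgroup (HoweBundle.IsoGroup ℍ[ℝ] (Fin n))) (Q : Set P),
      HoweBundle.IsHowe H → B.IsReduction Q H →
      (B.IsHolonomyInduced Q ↔
        ¬ HoweBundle.HasFactorO2 H ∧ ¬ HoweBundle.HasDoubleFactorO1 H)) :=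
  ⟨fun _ _ _ hH hQ => HoweBundle.PrincipalBundle.isHolonomyInduced_iff hd hH hQ,
    fun _ _ _ hH hQ => HoweBundle.PrincipalBundle.isHolonomyInduced_iff hd hH hQ⟩
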